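/- Cost model. Let $F$ be a field. A straight-line program over $F$ is a finite sequence of operations $+,-,\times,\div$, each applied to inputs, constants of $F$ or earlier results, that never divides by zero on an admissible input; its cost is the number of its operations. A verification program additionally ends with equality tests, which are counted as well. ``Cost $O(B)$'' means that there is such a program of cost at most $C\cdot B$, where $C$ is one absolute constant, independent of $F$ and of all parameters below. Scheme. Let $a,b,c,K_1,m,s\ge 1$ and $N,X\ge 0$ be integers with $K_1\mid a$, $m\mid b$, $s\mid c$, and put $D=K_1m+X$. Let $A\in F^{a\times b}$, $U\in F^{b\times c}$, $V\in F^{a\times c}$ be partitioned into $K_1\times m$, $m\times s$ and $K_1\times s$ equal blocks $A_{j,k}$, $U_{j,k}$, $V_{j,k}$. Let $R_i\in F^{\frac a{K_1}\times\frac bm}$, $T_i\in F^{\frac bm\times\frac cs}$, $H_i\in F^{\frac a{K_1}\times\frac cs}$ $(1\le i\le X)$ be masking matrices. For points $x_1,\dots,x_N\in F$ the data of worker $i$ are $$\bar A_i=\sum_{j=1}^{K_1}\sum_{k=1}^{m}A_{j,k}x_i^{(k-1)+(j-1)m}+\sum_{t=1}^{X}R_t x_i^{K_1m+t-1},$$ $$\bar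 U_i=\sum_{j=1}^{m}\sum_{k=1}^{s}U_{j,k}x_i^{(m-j)+(k-1)D}+\sum_{t=1}^{X}T_t x_i^{(s-1)D+K_1m+t-1},$$ $$\bar V_i=\sum_{j=1}^{K_1}\sum_{k=1}^{s}V_{j,k}x_i^{(K_1-j)m+(k-1)D}+\sum_{t=1}^{X}H_t x_i^{(s-1)D+K_1m+t-1}.$$ In phase I (computing $AU$) worker $i$ returns $\bar A_i\bar U_i$; in phase II (computing $A^TV$) it returns $\bar A_i^T\bar V_i$. Theorem. 1. All $\bar A_i$, $i\le N$, are computed from $A$, the $R_t$ and the points at total cost $O\!\left(\frac{K_1m+X}{K_1m}Nab\right)$. 2. From the $\bar A_i$ and key vectors $r^1_i\in F^{1\times\frac a{K_1}}$, $r^2_i\in F^{1\times\frac bm}$, all check vectors $s^1_i=r^1_i\bar A_i$ and $s^2_i=r^2_i\bar A_i^T$, $i\le N$, are computed at total cost $O\!\left(\frac{abN}{K_1m}\right)$. 3. The computation of one worker, $\bar A_i\bar U_i$ in phase I or $\bar A_i^T\bar V_i$ in phase II, has cost $O\!\left(\frac{abc}{K_1ms}\right)$. 4. The Freivalds check of one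 response, deciding $r^1_i\lambda_i=s^1_i\bar U_i$ for a response $\lambda_i\in F^{\frac a{K_1}\times\frac cs}$ in phase I or $r^2_i\mu_i=s^2_i\bar V_i$ for a response $\mu_i\in F^{\frac bm\times\frac cs}$ in phase II, has cost $O\!\left(\frac cs\left(\frac a{K_1}+\frac bm\right)\right)$. 5. Given the powers $x_i^e$, $0\le e<sD$, of the points (which are fixed once and for all), all $\bar U_i$, $i\le N$, are computed from $U$ and the $T_t$ at total cost $O\!\left(\frac{ms+X}{ms}Nbc\right)$, and all $\bar V_i$, $i\le N$, from $V$ and the $H_t$ at total cost $O\!\left(\frac{K_1s+X}{K_1s}Nac\right)$. 6. Let $n=(s+1)(K_1m+X)-1\ge 3$ and let the $x_i$ be distinct. From the points and the correct responses of any $n$ workers (the worst case), $AU$ is decoded in phase I at cost $O\!\left(\frac{ac}{K_1s}\,n\log^2 n\,\log\log n\right)$ and $A^TV$ in phase II at cost $O\!\left(\frac{bc}{ms}\,n\log^2 n\,\log\log n\right)$. 7. A worker stores exactly $\frac{ab}{K_1m}$ field elements, the entries of $\bar A_i$, and this same memory serves its computations in both phases. -/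

import Mathlib

namespace CodedMM

/-! ### Arithmetic cost model

Straight-line programs over a field `F`. Every executed field operation costs one unit;
field constants and reading an input or an earlier result are free. -/

/-- An operand of an instruction: a constant of the field, an input of the program, or the
result of the `k`-th instruction executed so far (counted from `0`). -/
inductive Operand (F ι : Type*) where
  | const (v : F) : Operand F ι
  | input (i : ι) : Operand F ι
  | reg (k : ℕ) : Operand F ι

/-- The four field operations. -/
inductive ArithOp where
  | add : ArithOp
  | sub : ArithOp
  | mul : ArithOp
  | div : ArithOp

/-- One instruction: a field operation applied to two operands. -/
structure Instr (F ι : Type*) where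
  op : ArithOp
  lhs : Operand F ι
  rhs : Operand F ι

/-- The value of an operand; undefined if it refers to a result that does not exist yet. -/
def Operand.value {F ι : Type*} (inp : ι → F) (regs : List F) : Operand F ι → Option F
  | .const v => some v
  | .input i => some (inp i)
  | .reg k => regs[k]?

open Classical in
/-- The result of a field operation; a division by zero is undefined. -/
noncomputable def ArithOp.apply {F : Type*} [Field F] : ArithOp → F → F → Option F
  | .add, x, y => some (x + y)
  | .sub, x, y => some (x - y)
  | .mul, x, y => some (x * y)
  | .div, x, y => if y = 0 then none else some (x / y)

/-- Execute one instruction. -/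
noncomputable def Instr.exec {F ι : Type*} [Field F] (inp : ι → F) (regs : List F)
    (c : Instr F ι) : Option F :=
  (c.lhs.value inp regs).bind fun x => (c.rhs.value inp regs).bind fun y => c.op.apply x y

/-- Execute a list of instructions in order, appending every result to the register list.
The outcome is `none` if some instruction is undefined. -/
noncomputable def execCode {F ι : Type*} [Field F] (inp : ι → F) :
    List (Instr F ι) → List F → Option (List F)
  | [], regs => some regs
  | c :: cs, regs => (c.exec inp regs).bind fun v => execCode inp cs (regs ++ [v])

/-- A straight-line program with inputs indexed by `ι` and outputs indexed by `κ`. -/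
structure Program (F ι κ : Type*) where
  code : List (Instr F ι)
  out : κ → Operand F ι

/-- The number of field operations of a program. -/
def Program.cost {F ι κ : Type*} (P : Program F ι κ) : ℕ := P.code.length

/-- On the input `inp` the program executes without a division by zero and outputs `y`. -/
def Program.Computes {F ι κ : Type*} [Field F] (P : Program F ι κ) (inp : ι → F)
    (y : κ → F) : Prop :=
  ∃ regs : List F, execCode inp P.code [] = some regs ∧
    ∀ k, (P.out k).value inp regs = some (y k)

/-- A verification program: a straight-line program followed by equality tests between
pairs of operands. -/
structure CheckProgram (F ι : Type*) where
  code : List (Instr F ι)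
  tests : List (Operand F ι × Operand F ι)

/-- Field operations plus equality tests. -/
def CheckProgram.cost {F ι : Type*} (P : CheckProgram F ι) : ℕ :=
  P.code.length + P.tests.length

/-- On the input `inp` the program executes without an undefined step, and all its equality
tests succeed exactly when `p` holds. -/
def CheckProgram.Decides {F ι : Type*} [Field F] (P : CheckProgram F ι) (inp : ι → F)
    (p : Prop) : Prop :=
  ∃ regs : List F, execCode inp P.code [] = some regs ∧
    (∀ t ∈ P.tests, (t.1.value inp regs).isSome ∧ (t.2.value inp regs).isSome) ∧
    ((∀ t ∈ P.tests, t.1.value inp regs = t.2.value inp regs) ↔ p)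

/-! ### The coding scheme -/

/-- The index `j * (a / K) + u` of row (column) `u` of the `j`-th of `K` equal blocks. -/
def blockIndex {a : ℕ} (K : ℕ) (j : Fin K) (u : Fin (a / K)) : Fin a :=
  ⟨j * (a / K) + u, by
    have h1 : (j : ℕ) * (a / K) + u < (j + 1) * (a / K) := by
      rw [Nat.add_mul, Nat.one_mul]; exact Nat.add_lt_add_left u.2 _
    exact lt_of_lt_of_le h1
      ((Nat.mul_le_mul_right _ (Nat.succ_le_of_lt j.2)).trans (Nat.mul_div_le a K))⟩

/-- Block `(j, k)` of the partition of `M` into `K × L` equal blocks (counted from `0`). -/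
def block {F : Type*} {a b : ℕ} (K L : ℕ) (M : Matrix (Fin a) (Fin b) F)
    (j : Fin K) (k : Fin L) : Matrix (Fin (a / K)) (Fin (b / L)) F :=
  M.submatrix (blockIndex K j) (blockIndex L k)

/-- The encoding of `A`, with masking matrices `R`, at the evaluation point `x`. All block
indices are counted from `0`. -/
def encA {F : Type*} [Field F] {a b : ℕ} (K₁ m X : ℕ) (A : Matrix (Fin a) (Fin b) F)
    (R : Fin X → Matrix (Fin (a / K₁)) (Fin (b / m)) F) (x : F) :
    Matrix (Fin (a / K₁)) (Fin (b / m)) F :=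
  (∑ j : Fin K₁, ∑ k : Fin m, x ^ ((k : ℕ) + j * m) • block K₁ m A j k)
    + ∑ i : Fin X, x ^ (K₁ * m + i) • R i

/-- The encoding of `U` (phase I), with masking matrices `T`, at the point `x`. -/
def encU {F : Type*} [Field F] {b c : ℕ} (K₁ m s X : ℕ) (U : Matrix (Fin b) (Fin c) F)
    (T : Fin X → Matrix (Fin (b / m)) (Fin (c / s)) F) (x : F) :
    Matrix (Fin (b / m)) (Fin (c / s)) F :=
  (∑ j : Fin m, ∑ k : Fin s, x ^ ((m - 1 - j) + k * (K₁ * m + X)) • block m s U j k)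
    + ∑ i : Fin X, x ^ ((s - 1) * (K₁ * m + X) + K₁ * m + i) • T i

/-- The encoding of `V` (phase II), with masking matrices `H`, at the point `x`. -/
def encV {F : Type*} [Field F] {a c : ℕ} (K₁ m s X : ℕ) (V : Matrix (Fin a) (Fin c) F)
    (H : Fin X → Matrix (Fin (a / K₁)) (Fin (c / s)) F) (x : F) :
    Matrix (Fin (a / K₁)) (Fin (c / s)) F :=
  (∑ j : Fin K₁, ∑ k : Fin s, x ^ ((K₁ - 1 - j) * m + (K₁ * m + X) * k) • block K₁ s V j k)
    + ∑ i : Fin X, x ^ ((s - 1) * (K₁ * m + X) + K₁ * m + i) • H i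

/-- The worst-case number of responses from which a product is decoded. -/
def threshold (K₁ m s X : ℕ) : ℕ := (s + 1) * (K₁ * m + X) - 1

/-! ### Laying out matrices as program inputs and outputs -/

/-- The entries of a matrix. -/
def ents {F α β : Type*} (M : Matrix α β F) : α × β → F := fun p => M p.1 p.2

/-- The entries of a family of matrices. -/
def famEnts {F γ α β : Type*} (M : γ → Matrix α β F) : γ × α × β → F :=
  fun p => M p.1 p.2.1 p.2.2

/-- The entries of a family of vectors. -/
def famVec {F γ α : Type*} (v : γ → α → F) : γ × α → F := fun p => v p.1 p.2

/-- The powers with exponents below `d` of the evaluation points. -/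
def powerTable {F : Type*} [Field F] {N : ℕ} (d : ℕ) (x : Fin N → F) : Fin N × Fin d → F :=
  fun p => x p.1 ^ (p.2 : ℕ)

end CodedMM

namespace CodedMM

open Polynomial

/-! ### Cost relations -/

/-! Apart from the powers of the points, everything in items 1–5 is a family of dot products. An
entry of an encoding is a dot product whose length is the number of blocks plus the number of masks.
Check vectors, worker products and Freivalds tests are dot products along a block dimension.
Counting entries times length gives the bounds, and item 7 is the number of entries of a block. The
substance is item 6.

Each entry of a response is the value at `x i` of a polynomial of degree less than `threshold`
(`polyI`, `polyII`). Reading exponents first in steps of `D = K₁ m + X` and then in steps of `m`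
shows that certain exponents are hit exactly by the pairs of blocks whose products add up to one
block of `A U` or `Aᵀ V`. No mask and no other pair interferes (`expA_add_expU_iff`,
`expA_add_expV_iff`). Decoding is therefore interpolation at arbitrary distinct points, once per
entry of a response.

Interpolation costs `O(log n)` multiplications of polynomials of length about `n`
(`interpolation_cost`). In Lagrange's formula the weights `∏ (x t - x u)` are values of one
polynomial at all points. They come from one power series inversion and a descent of the subproduct
tree (`exists_inverse`, `exists_descent`), and the numerators are then summed up along the same tree
(`numer_dyadic_cost`).

Multiplication in `O(n log n log log n)` over every field follows Schönhage and Strassen. A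
polynomial is cut into blocks, the blocks are regarded as elements of a quotient of `A[X]` by `1 + X
^ N + ⋯ + X ^ ((ℓ - 1) * N)`, where `X` itself is a root of unity and its powers multiply by shifts,
and an FFT of radix `ℓ` runs over this quotient (`MulCost.step`, `mulCost_fast`). The radix is `2`,
except in characteristic two, where it is `3`, because `ℓ` has to be invertible.

Costs are derivations in a commutative `F`-algebra `A`. For `A = Ω → F`, the functions of the
admissible inputs `ω : Ω`, a derivation is a single program valid on all inputs (`exists_program`),
and division by a unit of `A` is division by something that never vanishes. `CostRel` and
`CostRel.comap` carry costs over to polynomials and to quotients, so that the FFT can be treated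
over an abstract ring. -/

/-- A notion of cost on a type: `rel S n T` says that all elements of `T` are obtained from those
of `S` at cost at most `n`. -/
structure CostRel (R : Type*) where
  rel : Set R → ℕ → Set R → Prop
  of_subset : ∀ {S T}, T ⊆ S → rel S 0 T
  mono : ∀ {S S' T T' n n'}, S ⊆ S' → n ≤ n' → T' ⊆ T → rel S n T → rel S' n' T'
  trans : ∀ {S T U n n'}, rel S n T → rel (S ∪ T) n' U → rel S (n + n') (T ∪ U)

namespace CostRel

variable {R R' : Type*} (K : CostRel R) {S S' T T' U : Set R} {n n' : ℕ}

lemma andThen (h : K.rel S n T) (h' : K.rel (S ∪ T) n' U) : K.rel S (n + n') U :=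
  K.mono subset_rfl le_rfl Set.subset_union_right (K.trans h h')

lemma union (h : K.rel S n T) (h' : K.rel S n' U) : K.rel S (n + n') (T ∪ U) :=
  K.trans h (K.mono Set.subset_union_left le_rfl subset_rfl h')

lemma mono_cost (hn : n ≤ n') (h : K.rel S n T) : K.rel S n' T :=
  K.mono subset_rfl hn subset_rfl h

lemma of_subset' (h : T ⊆ S) : K.rel S n T := K.mono_cost (Nat.zero_le _) (K.of_subset h)

lemma mono_src (hS : S ⊆ S') (h : K.rel S n T) : K.rel S' n T :=
  K.mono hS le_rfl subset_rfl h

lemma mono_tgt (hT : T' ⊆ T) (h : K.rel S n T) : K.rel S n T' :=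
  K.mono subset_rfl le_rfl hT h

lemma biUnion_sum {ι : Type*} (I : Finset ι) (T : ι → Set R) (n : ι → ℕ)
    (h : ∀ i ∈ I, K.rel S (n i) (T i)) : K.rel S (∑ i ∈ I, n i) (⋃ i ∈ I, T i) := by
  classical
  induction I using Finset.induction_on with
  | empty => exact K.of_subset (by simp)
  | insert i I hi ih =>
    rw [Finset.sum_insert hi, Finset.set_biUnion_insert]
    exact K.union (h i (by simp)) (ih fun j hj => h j (by simp [hj]))

lemma biUnion {ι : Type*} (I : Finset ι) (T : ι → Set R) (n : ℕ)
    (h : ∀ i ∈ I, K.rel S n (T i)) : K.rel S (I.card * n) (⋃ i ∈ I, T i) := by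
  simpa using K.biUnion_sum I T (fun _ => n) h

/-- The cost of elements represented by sets of elements of `R`. -/
def comap (φ : R' → Set R) : CostRel R' where
  rel S n T := K.rel (⋃ d ∈ S, φ d) n (⋃ d ∈ T, φ d)
  of_subset h := K.of_subset (Set.biUnion_subset_biUnion_left h)
  mono hS hn hT h := K.mono (Set.biUnion_subset_biUnion_left hS) hn
    (Set.biUnion_subset_biUnion_left hT) h
  trans h h' := by
    rw [Set.biUnion_union] at *
    exact K.trans h h'

lemma comap_rel (φ : R' → Set R) (S T : Set R') :
    (K.comap φ).rel S n T ↔ K.rel (⋃ d ∈ S, φ d) n (⋃ d ∈ T, φ d) := Iff.rfl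

/-- The sum of `p` elements, each of cost `w`, costs `2 * p * w` if an addition costs `w`. -/
lemma sum_range [AddCommMonoid R] {w : ℕ} (h0 : ∀ S, K.rel S 0 {0})
    (hadd : ∀ S a b, a ∈ S → b ∈ S → K.rel S w {a + b}) (p : ℕ) (f : ℕ → R) (v : ℕ)
    (hf : ∀ i < p, K.rel S v {f i}) : K.rel S (p * (v + w)) {∑ i ∈ Finset.range p, f i} := by
  induction p with
  | zero => simpa using h0 S
  | succ p ih =>
    rw [Finset.sum_range_succ]
    have h1 := K.union (ih fun i hi => hf i (by omega)) (hf p (by omega))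
    refine K.mono_cost ?_ (K.andThen h1 (hadd _ _ _ ?_ ?_))
    · apply le_of_eq; ring
    · simp
    · simp

end CostRel

/-! ### Arithmetic cost in an algebra -/

section Derives

variable (F : Type*) {A : Type*} [Field F] [CommRing A] [Algebra F A]

/-- `a` is the result of one arithmetic operation on elements of `S` and constants. -/
def Step (S : Set A) (a : A) : Prop :=
  ∃ x ∈ S ∪ Set.range (algebraMap F A), ∃ y ∈ S ∪ Set.range (algebraMap F A),
    a = x + y ∨ a = x - y ∨ a = x * y ∨ (IsUnit y ∧ a * y = x)

/-- All elements of `T` are obtained from `S` and constants by at most `n` operations. -/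
inductive Derives : Set A → ℕ → Set A → Prop
  | of_subset {S T : Set A} {n : ℕ} (h : T ⊆ S ∪ Set.range (algebraMap F A)) : Derives S n T
  | step {S T : Set A} {n : ℕ} (a : A) (h : Step F S a) (h' : Derives (insert a S) n T) :
      Derives S (n + 1) T

variable {F}

lemma Step.mono {S S' : Set A} {a : A} (hS : S ⊆ S') (h : Step F S a) : Step F S' a := by
  obtain ⟨x, hx, y, hy, h⟩ := h
  exact ⟨x, Set.union_subset_union_left _ hS hx, y, Set.union_subset_union_left _ hS hy, h⟩

lemma Derives.mono {S S' T T' : Set A} {n n' : ℕ} (hS : S ⊆ S') (hn : n ≤ n') (hT : T' ⊆ T)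
    (h : Derives F S n T) : Derives F S' n' T' := by
  induction h generalizing S' n' with
  | of_subset h => exact .of_subset (hT.trans (h.trans (Set.union_subset_union_left _ hS)))
  | @step S T n a h h' ih =>
    obtain ⟨k, rfl⟩ := Nat.exists_eq_add_of_le hn
    rw [show n + 1 + k = (n + k) + 1 by ring]
    exact .step a (h.mono hS) (ih (Set.insert_subset_insert hS) (by omega) hT)

/-- Constants are already free operands, so adding them to the sources gains nothing. Composition
needs this when the first derivation takes no steps and its targets may be constants. -/
lemma Derives.const_union {S T : Set A} {n : ℕ}
    (h : Derives F (S ∪ Set.range (algebraMap F A)) n T) : Derives F S n T := by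
  generalize hS' : S ∪ Set.range (algebraMap F A) = S' at h
  induction h generalizing S with
  | of_subset h =>
    subst hS'
    exact .of_subset (by rwa [Set.union_assoc, Set.union_self] at h)
  | @step S' T n a h h' ih =>
    subst hS'
    refine .step a ?_ (ih (by rw [Set.insert_union]))
    obtain ⟨x, hx, y, hy, h⟩ := h
    rw [Set.union_assoc, Set.union_self] at hx hy
    exact ⟨x, hx, y, hy, h⟩

lemma Derives.trans {S T U : Set A} {n n' : ℕ} (h : Derives F S n T)
    (h' : Derives F (S ∪ T) n' U) : Derives F S (n + n') (T ∪ U) := by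
  induction h with
  | @of_subset S T n h =>
    -- Targets that are available at the start remain available to the end of any derivation.
    have key : ∀ {S₀ T₀ U₀ : Set A} {m : ℕ}, Derives F S₀ m U₀ →
        T₀ ⊆ S₀ ∪ Set.range (algebraMap F A) → Derives F S₀ m (T₀ ∪ U₀) := by
      intro S₀ T₀ U₀ m hd hT
      induction hd with
      | of_subset h => exact .of_subset (Set.union_subset hT h)
      | step a h h' ih =>
        exact .step a h (ih (hT.trans (Set.union_subset_union_left _ (Set.subset_insert _ _))))
    refine key ?_ h
    refine Derives.const_union (h'.mono ?_ (by omega) subset_rfl)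
    exact Set.union_subset Set.subset_union_left h
  | @step S T n a h h1 ih =>
    rw [show n + 1 + n' = (n + n') + 1 by ring]
    exact .step a h (ih (h'.mono (Set.union_subset_union_left _ (Set.subset_insert _ _)) le_rfl
      subset_rfl))

variable (F A) in
/-- The arithmetic cost in an algebra. -/
def arith : CostRel A where
  rel := Derives F
  of_subset h := .of_subset (h.trans Set.subset_union_left)
  mono := Derives.mono
  trans := Derives.trans

lemma arith_const {S T : Set A} (h : T ⊆ S ∪ Set.range (algebraMap F A)) {n : ℕ} :
    (arith F A).rel S n T := Derives.of_subset h

lemma arith_step {S : Set A} {a : A} (h : Step F S a) : (arith F A).rel S 1 {a} :=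
  .step a h (.of_subset (by simp))

lemma arith_zero (S : Set A) : (arith F A).rel S 0 {0} :=
  .of_subset (by simpa using Or.inr ⟨0, map_zero _⟩)

variable {S : Set A} {a b : A}

lemma arith_add (ha : a ∈ S) (hb : b ∈ S) : (arith F A).rel S 1 {a + b} :=
  arith_step ⟨a, .inl ha, b, .inl hb, .inl rfl⟩

lemma arith_sub (ha : a ∈ S) (hb : b ∈ S) : (arith F A).rel S 1 {a - b} :=
  arith_step ⟨a, .inl ha, b, .inl hb, .inr (.inl rfl)⟩

lemma arith_mul (ha : a ∈ S) (hb : b ∈ S) : (arith F A).rel S 1 {a * b} :=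
  arith_step ⟨a, .inl ha, b, .inl hb, .inr (.inr (.inl rfl))⟩

lemma arith_const_mul (c : F) (ha : a ∈ S) : (arith F A).rel S 1 {algebraMap F A c * a} :=
  arith_step ⟨_, .inr ⟨c, rfl⟩, a, .inl ha, .inr (.inr (.inl rfl))⟩

lemma arith_const_sub (c : F) (ha : a ∈ S) : (arith F A).rel S 1 {algebraMap F A c - a} :=
  arith_step ⟨_, .inr ⟨c, rfl⟩, a, .inl ha, .inr (.inl rfl)⟩

lemma arith_div {q : A} (ha : a ∈ S) (hb : b ∈ S) (hu : IsUnit b) (hq : q * b = a) :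
    (arith F A).rel S 1 {q} :=
  arith_step ⟨a, .inl ha, b, .inl hb, .inr (.inr (.inr ⟨hu, hq⟩))⟩

end Derives

/-! ### From derivations to programs -/

section Compile

variable {F ι Ω : Type*}

/-- `f` is the value of an operand, given registers and inputs depending on `ω`. -/
def IsValue (inp : Ω → ι → F) (regs : List (Ω → F)) (f : Ω → F) : Prop :=
  ∃ o : Operand F ι, ∀ ω, o.value (inp ω) (regs.map fun r => r ω) = some (f ω)

/-- Results are appended at the end of the register list, so an old register index keeps its
meaning. -/
lemma IsValue.append {inp : Ω → ι → F} {regs : List (Ω → F)} {f : Ω → F}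
    (h : IsValue inp regs f) (g : Ω → F) : IsValue inp (regs ++ [g]) f := by
  obtain ⟨o, ho⟩ := h
  cases o with
  | const v => exact ⟨.const v, fun ω => by simpa [Operand.value] using ho ω⟩
  | input i => exact ⟨.input i, fun ω => by simpa [Operand.value] using ho ω⟩
  | reg k =>
    refine ⟨.reg k, fun ω => ?_⟩
    have := ho ω
    simp only [Operand.value, List.map_append] at this ⊢
    rw [List.getElem?_append_left, this]
    exact (List.getElem?_eq_some_iff.mp this).1

lemma isValue_last (inp : Ω → ι → F) (regs : List (Ω → F)) (g : Ω → F) :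
    IsValue inp (regs ++ [g]) g :=
  ⟨.reg regs.length, fun ω => by simp [Operand.value]⟩

variable [Field F]

/-- The instruction must not depend on `ω`. Division is harmless because a unit of `Ω → F` is
nonzero at every `ω`. -/
lemma Step.exists_instr {inp : Ω → ι → F} {regs : List (Ω → F)} {S : Set (Ω → F)} {f : Ω → F}
    (hS : ∀ g ∈ S, IsValue inp regs g) (h : Step F S f) :
    ∃ c : Instr F ι, ∀ ω, c.exec (inp ω) (regs.map fun r => r ω) = some (f ω) := by
  have hS' : ∀ g ∈ S ∪ Set.range (algebraMap F (Ω → F)), IsValue inp regs g := by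
    rintro g (hg | ⟨v, rfl⟩)
    · exact hS g hg
    · exact ⟨.const v, fun ω => rfl⟩
  obtain ⟨x, hx, y, hy, h⟩ := h
  obtain ⟨ox, hox⟩ := hS' x hx
  obtain ⟨oy, hoy⟩ := hS' y hy
  rcases h with rfl | rfl | rfl | ⟨hu, rfl⟩
  · exact ⟨⟨.add, ox, oy⟩, fun ω => by simp [Instr.exec, hox, hoy, ArithOp.apply]⟩
  · exact ⟨⟨.sub, ox, oy⟩, fun ω => by simp [Instr.exec, hox, hoy, ArithOp.apply]⟩
  · exact ⟨⟨.mul, ox, oy⟩, fun ω => by simp [Instr.exec, hox, hoy, ArithOp.apply]⟩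
  · refine ⟨⟨.div, ox, oy⟩, fun ω => ?_⟩
    have : y ω ≠ 0 := (Pi.isUnit_iff.mp hu ω).ne_zero
    simp [Instr.exec, hox, hoy, ArithOp.apply, this]

lemma Derives.exists_code {inp : Ω → ι → F} {S T : Set (Ω → F)} {n : ℕ} (h : Derives F S n T)
    (regs : List (Ω → F)) (hS : ∀ g ∈ S, IsValue inp regs g) :
    ∃ (code : List (Instr F ι)) (regs' : List (Ω → F)), code.length ≤ n ∧
      (∀ ω, execCode (inp ω) code (regs.map fun r => r ω) = some (regs'.map fun r => r ω)) ∧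
      ∀ g ∈ T, IsValue inp regs' g := by
  induction h generalizing regs with
  | of_subset h =>
    refine ⟨[], regs, by simp, fun ω => rfl, fun g hg => ?_⟩
    rcases h hg with hg | ⟨v, rfl⟩
    · exact hS g hg
    · exact ⟨.const v, fun ω => rfl⟩
  | step a h h' ih =>
    obtain ⟨c, hc⟩ := h.exists_instr hS
    obtain ⟨code, regs', hl, hex, hT⟩ := ih (regs ++ [a]) (by
      rintro g (rfl | hg)
      · exact isValue_last _ _ _
      · exact (hS g hg).append _)
    refine ⟨c :: code, regs', by simpa using hl, fun ω => ?_, hT⟩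
    rw [execCode, hc]
    simpa using hex ω

/-- A derivation from the input functions yields a program. -/
lemma exists_program {κ : Type*} (inp : Ω → ι → F) (y : Ω → κ → F) {n : ℕ}
    (h : (arith F (Ω → F)).rel (Set.range fun i ω => inp ω i) n (Set.range fun k ω => y ω k)) :
    ∃ P : Program F ι κ, P.cost ≤ n ∧ ∀ ω, P.Computes (inp ω) (y ω) := by
  obtain ⟨code, regs, hl, hex, hT⟩ := Derives.exists_code (inp := inp) h [] (by
    rintro _ ⟨i, rfl⟩
    exact ⟨.input i, fun ω => rfl⟩)
  choose o ho using fun k => hT _ ⟨k, rfl⟩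
  exact ⟨⟨code, o⟩, hl, fun ω => ⟨_, hex ω, fun k => ho k ω⟩⟩

/-- A derivation of two families from the input functions yields a program that compares them. -/
lemma exists_checkProgram {κ : Type*} [Fintype κ] (inp : Ω → ι → F) (y z : Ω → κ → F) {n : ℕ}
    (h : (arith F (Ω → F)).rel (Set.range fun i ω => inp ω i) n
      ((Set.range fun k ω => y ω k) ∪ (Set.range fun k ω => z ω k))) :
    ∃ P : CheckProgram F ι, P.cost ≤ n + Fintype.card κ ∧
      ∀ ω, P.Decides (inp ω) (y ω = z ω) := by
  obtain ⟨code, regs, hl, hex, hT⟩ := Derives.exists_code (inp := inp) h [] (by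
    rintro _ ⟨i, rfl⟩
    exact ⟨.input i, fun ω => rfl⟩)
  choose o ho using fun k => hT _ (.inl ⟨k, rfl⟩)
  choose o' ho' using fun k => hT _ (.inr ⟨k, rfl⟩)
  refine ⟨⟨code, Finset.univ.toList.map fun k => (o k, o' k)⟩, ?_, fun ω => ⟨_, hex ω, ?_, ?_⟩⟩
  · simpa [CheckProgram.cost] using hl
  · simp [ho, ho']
  · simp [ho, ho', funext_iff]

end Compile

/-! ### Blocks of a polynomial -/

section Blocks

variable {R : Type*} [CommRing R]

/-- The polynomial formed by the coefficients `u * h, …, u * h + h - 1`. -/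
noncomputable def polyBlock (h u : ℕ) (p : R[X]) : R[X] :=
  ∑ i ∈ Finset.range h, monomial i (p.coeff (u * h + i))

/-- The polynomial whose blocks of length `h` are `P 0, …, P (n - 1)`. -/
noncomputable def glue (h n : ℕ) (P : ℕ → R[X]) : R[X] :=
  ∑ u ∈ Finset.range n, X ^ (u * h) * P u

lemma coeff_polyBlock (h u : ℕ) (p : R[X]) (i : ℕ) :
    (polyBlock h u p).coeff i = if i < h then p.coeff (u * h + i) else 0 := by
  simp [polyBlock, coeff_monomial]

lemma degree_polyBlock_lt (h u : ℕ) (p : R[X]) : (polyBlock h u p).degree < h := by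
  rw [degree_lt_iff_coeff_zero]
  intro i hi
  rw [coeff_polyBlock, if_neg (by omega)]

/-- Blocks of degree less than `h`, shifted by multiples of `h`, do not overlap, so only the block
with index `i / h` contributes. -/
lemma coeff_glue {h n : ℕ} (hh : 0 < h) {P : ℕ → R[X]} (hP : ∀ u < n, (P u).degree < h) (i : ℕ) :
    (glue h n P).coeff i = if i / h < n then (P (i / h)).coeff (i % h) else 0 := by
  have key : ∀ u ∈ Finset.range n, (X ^ (u * h) * P u).coeff i =
      if u = i / h then (P (i / h)).coeff (i % h) else 0 := by
    intro u hu
    rw [coeff_X_pow_mul']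
    have hdm := Nat.div_add_mod i h
    have hlt := Nat.mod_lt i hh
    split_ifs with h1 h2 h2
    · subst h2
      congr 1
      rw [mul_comm] at hdm; omega
    · apply (degree_lt_iff_coeff_zero _ _).mp (hP u (by simpa using hu))
      have h3 : u ≤ i / h := (Nat.le_div_iff_mul_le hh).mpr h1
      have h4 : u + 1 ≤ i / h := by omega
      have h5 := (Nat.le_div_iff_mul_le hh).mp h4
      rw [Nat.add_mul] at h5
      omega
    · exact absurd (h2 ▸ Nat.div_mul_le_self i h) h1
    · rfl
  rw [glue, finsetSum_coeff, Finset.sum_congr rfl key]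
  simp

lemma glue_polyBlock {h n : ℕ} (hh : 0 < h) {p : R[X]} (hp : p.degree < (n * h : ℕ)) :
    glue h n (fun u => polyBlock h u p) = p := by
  ext i
  rw [coeff_glue hh fun u _ => degree_polyBlock_lt h u p]
  split_ifs with h1
  · rw [coeff_polyBlock, if_pos (Nat.mod_lt _ hh), Nat.div_add_mod']
  · refine ((degree_lt_iff_coeff_zero _ _).mp hp i ?_).symm
    exact (Nat.le_div_iff_mul_le hh).mp (by omega)

lemma degree_glue_lt {h n : ℕ} (hh : 0 < h) {P : ℕ → R[X]} (hP : ∀ u < n, (P u).degree < h) :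
    (glue h n P).degree < (n * h : ℕ) := by
  rw [degree_lt_iff_coeff_zero]
  intro i hi
  rw [coeff_glue hh hP, if_neg]
  rw [not_lt, Nat.le_div_iff_mul_le hh]
  exact hi

/-- Modulo `X ^ h - z` the shift `X ^ (u * h)` becomes `z ^ u`: reduction is the evaluation of a
polynomial in the blocks. -/
lemma sub_dvd_glue_sub (h n : ℕ) (P : ℕ → R[X]) (z : R) :
    (X ^ h - C z) ∣ glue h n P - ∑ u ∈ Finset.range n, C (z ^ u) * P u := by
  rw [glue, ← Finset.sum_sub_distrib]
  refine Finset.dvd_sum fun u _ => ?_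
  rw [← sub_mul, mul_comm u h, pow_mul, C_pow]
  exact Dvd.dvd.mul_right (sub_dvd_pow_sub_pow _ _ _) _

end Blocks

/-! ### Multiplication modulo `X ^ h - ξ ^ e` -/

section Convolution

variable {D : Type*} [CommRing D]

/-- The cost of polynomials, in terms of their coefficients. -/
def CostRel.poly (K : CostRel D) : CostRel D[X] := K.comap fun p => Set.range p.coeff

lemma CostRel.poly_rel (K : CostRel D) {S T : Set D[X]} {n : ℕ} :
    K.poly.rel S n T ↔ K.rel (⋃ p ∈ S, Set.range p.coeff) n (⋃ p ∈ T, Set.range p.coeff) := Iff.rfl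

/-- Additions, subtractions, multiplications by powers of `ξ` and by `ι` have cost at most `w`. -/
structure LinCost (K : CostRel D) (ξ ι : D) (w : ℕ) : Prop where
  zero : ∀ S, K.rel S 0 {0}
  add : ∀ S a b, a ∈ S → b ∈ S → K.rel S w {a + b}
  powMul : ∀ S a (e : ℕ), a ∈ S → K.rel S w {ξ ^ e * a}
  sub : ∀ S a b, a ∈ S → b ∈ S → K.rel S w {a - b}
  inv_mul : ∀ S a, a ∈ S → K.rel S w {ι * a}

/-- Only `h` coefficients have to be paid for; the others are zero, which is free. -/
lemma poly_rel_of_coeff {K : CostRel D} (h0 : ∀ S, K.rel S 0 {0}) {S : Set D[X]} {p : D[X]}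
    {h v : ℕ} (hp : p.degree < h)
    (hc : ∀ i < h, K.rel (⋃ p ∈ S, Set.range p.coeff) v {p.coeff i}) :
    K.poly.rel S (h * v) {p} := by
  rw [CostRel.poly_rel]
  have h1 := K.union (K.biUnion (Finset.range h) (fun i => {p.coeff i}) v
    fun i hi => hc i (by simpa using hi)) (h0 _)
  refine K.mono subset_rfl (by simp) ?_ h1
  intro x hx
  simp only [Set.mem_singleton_iff, Set.iUnion_iUnion_eq_left, Set.mem_range] at hx
  obtain ⟨i, rfl⟩ := hx
  by_cases hi : i < h
  · left
    simp only [Set.mem_iUnion]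
    exact ⟨i, by simpa using hi, rfl⟩
  · right
    simpa using (degree_lt_iff_coeff_zero _ _).mp hp i (by omega)

lemma coeff_mem_biUnion {S : Set D[X]} {p : D[X]} (hp : p ∈ S) (i : ℕ) :
    p.coeff i ∈ ⋃ p ∈ S, Set.range p.coeff := by
  simp only [Set.mem_iUnion]
  exact ⟨p, hp, i, rfl⟩

lemma degree_sum_C_mul_lt {h : ℕ} (p : ℕ) (c : ℕ → D) {f : ℕ → D[X]}
    (hd : ∀ u < p, (f u).degree < h) :
    (∑ u ∈ Finset.range p, C (c u) * f u).degree < h := by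
  rw [degree_lt_iff_coeff_zero]
  intro i hi
  rw [finsetSum_coeff]
  refine Finset.sum_eq_zero fun u hu => ?_
  rw [coeff_C_mul, (degree_lt_iff_coeff_zero _ _).mp (hd u (by simpa using hu)) i hi, mul_zero]

lemma degree_C_mul_lt {h : ℕ} (c : D) {f : D[X]} (hd : f.degree < h) :
    (C c * f).degree < h := by
  simpa using degree_sum_C_mul_lt 1 (fun _ => c) (f := fun _ => f) fun _ _ => hd

variable {K : CostRel D} {ξ ι : D} {w : ℕ}

lemma LinCost.lincomb (hK : LinCost K ξ ι w) {S : Set D[X]} {h : ℕ} (p : ℕ) (e : ℕ → ℕ)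
    {f : ℕ → D[X]} (hf : ∀ u < p, f u ∈ S) (hd : ∀ u < p, (f u).degree < h) :
    K.poly.rel S (h * (p * (w + w))) {∑ u ∈ Finset.range p, C (ξ ^ e u) * f u} := by
  refine poly_rel_of_coeff hK.zero (degree_sum_C_mul_lt p _ hd) fun i _ => ?_
  simp only [finsetSum_coeff, coeff_C_mul]
  exact K.sum_range hK.zero hK.add p _ w
    fun u hu => hK.powMul _ _ _ (coeff_mem_biUnion (hf u hu) i)

lemma LinCost.inv_mul_poly (hK : LinCost K ξ ι w) {S : Set D[X]} {h : ℕ} {f : D[X]}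
    (hf : f ∈ S) (hd : f.degree < h) : K.poly.rel S (h * w) {C ι * f} := by
  refine poly_rel_of_coeff hK.zero (degree_C_mul_lt _ hd) fun i _ => ?_
  rw [coeff_C_mul]
  exact hK.inv_mul _ _ (coeff_mem_biUnion hf i)

/-- Cutting a polynomial into blocks merely renames coefficients; no operation is executed. -/
lemma LinCost.polyBlock_mem (hK : LinCost K ξ ι w) (h u : ℕ) {S : Set D[X]} {p : D[X]} (hp : p ∈ S) :
    K.poly.rel S 0 {polyBlock h u p} := by
  rw [← Nat.mul_zero h]
  refine poly_rel_of_coeff hK.zero (degree_polyBlock_lt h u p) fun i hi => ?_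
  rw [coeff_polyBlock, if_pos hi]
  exact K.of_subset (by simpa using coeff_mem_biUnion hp _)

lemma LinCost.glue_mem (hK : LinCost K ξ ι w) {h n : ℕ} (hh : 0 < h) {S : Set D[X]} {P : ℕ → D[X]}
    (hP : ∀ u < n, P u ∈ S) (hd : ∀ u < n, (P u).degree < h) :
    K.poly.rel S 0 {glue h n P} := by
  rw [← Nat.mul_zero (n * h)]
  refine poly_rel_of_coeff hK.zero (degree_glue_lt hh hd) fun i hi => ?_
  have : i / h < n := (Nat.div_lt_iff_lt_mul hh).mpr hi
  rw [coeff_glue hh hd, if_pos this]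
  exact K.of_subset (by simpa using coeff_mem_biUnion (hP _ this) _)

/-- The product modulo several factors `X ^ h - ξ ^ (t * N + e)` by evaluation and
interpolation. -/
lemma LinCost.split_mul (hK : LinCost K ξ ι w) {ℓ N : ℕ} (hpos : 0 < ℓ * N)
    (hord : ξ ^ (ℓ * N) = 1)
    (hsum : ∀ e, ∑ u ∈ Finset.range ℓ, (ξ ^ N) ^ (e * u) = if ℓ ∣ e then (ℓ : D) else 0)
    (hι : ι * ℓ = 1) {I : Finset ℕ} (hI : I ⊆ Finset.range ℓ) {h : ℕ} (hh : 0 < h) (e M : ℕ)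
    (ih : ∀ t ∈ I, ∀ f g : D[X], f.degree < h → g.degree < h → ∃ p : D[X], p.degree < h ∧
      (X ^ h - C (ξ ^ (t * N + e))) ∣ f * g - p ∧ K.poly.rel {f, g} M {p})
    (f g : D[X]) (hf : f.degree < (ℓ * h : ℕ)) (hg : g.degree < (ℓ * h : ℕ)) :
    ∃ H : D[X], H.degree < (ℓ * h : ℕ) ∧
      (∀ t ∈ I, (X ^ h - C (ξ ^ (t * N + e))) ∣ f * g - H) ∧
      K.poly.rel {f, g} (I.card * M + (6 * ℓ + 1) * (ℓ * h) * w) {H} := by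
  classical
  let z : ℕ → D := fun t => ξ ^ (t * N + e)
  let ev : D[X] → ℕ → D[X] := fun f t => ∑ u ∈ Finset.range ℓ, C (z t ^ u) * polyBlock h u f
  have hev_deg : ∀ f t, (ev f t).degree < h := fun f t =>
    degree_sum_C_mul_lt ℓ _ fun u _ => degree_polyBlock_lt h u f
  have hev_dvd : ∀ f : D[X], f.degree < (ℓ * h : ℕ) → ∀ t, (X ^ h - C (z t)) ∣ f - ev f t := by
    intro f hf t
    have := sub_dvd_glue_sub h ℓ (fun u => polyBlock h u f) (z t)
    rwa [glue_polyBlock hh hf] at this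
  have hev_cost : ∀ (S : Set D[X]) (f : D[X]), f ∈ S → ∀ t,
      K.poly.rel S (h * (ℓ * (w + w))) {ev f t} := by
    intro S f hf t
    have h1 := K.poly.biUnion (Finset.range ℓ) (fun u => {polyBlock h u f}) 0
      (S := S) fun u _ => hK.polyBlock_mem h u hf
    have h2 := hK.lincomb (S := S ∪ ⋃ u ∈ Finset.range ℓ, {polyBlock h u f}) (h := h) ℓ
      (fun u => (t * N + e) * u) (f := fun u => polyBlock h u f)
      (fun u hu => Or.inr (by
        simp only [Set.mem_iUnion]; exact ⟨u, by simpa using hu, rfl⟩))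
      (fun u _ => degree_polyBlock_lt h u f)
    have h3 := K.poly.andThen h1 h2
    simp only [pow_mul] at h3
    exact K.poly.mono_cost (by simp) h3
  choose! p hp_deg hp_dvd hp_cost using fun t ht => ih t ht (ev f t) (ev g t) (hev_deg f t)
    (hev_deg g t)
  -- The residues with `t ∉ I` are not prescribed. Setting them to zero lets the full inverse
  -- transform of length `ℓ` be used.
  let p' : ℕ → D[X] := fun t => if t ∈ I then p t else 0
  have hp'_deg : ∀ t, (p' t).degree < h := by
    intro t
    by_cases ht : t ∈ I
    · simpa [p', ht] using hp_deg t ht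
    · simp only [p', ht, if_false, degree_zero]
      exact WithBot.bot_lt_coe h
  -- The inverse transform: since `ξ ^ (ℓ * N) = 1`, the factor `ℓ * N - 1` in the exponent plays
  -- the role of `-1`, and `ι` is `1 / ℓ`.
  let comb : ℕ → D[X] := fun u =>
    ∑ t ∈ Finset.range ℓ, C (ξ ^ ((t * N + e) * u * (ℓ * N - 1))) * p' t
  have hcomb_deg : ∀ u, (comb u).degree < h := fun u => degree_sum_C_mul_lt ℓ _ fun t _ => hp'_deg t
  have hglue_deg : ∀ u < ℓ, (C ι * comb u).degree < h := fun u _ => degree_C_mul_lt _ (hcomb_deg u)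
  refine ⟨glue h ℓ (fun u => C ι * comb u), degree_glue_lt hh hglue_deg, ?_, ?_⟩
  · intro s hs
    have hs' : s < ℓ := by simpa using hI hs
    have h1 := sub_dvd_glue_sub h ℓ (fun u => C ι * comb u) (z s)
    have h2 : ∑ u ∈ Finset.range ℓ, C (z s ^ u) * (C ι * comb u) = p s := by
      have e1 : ∀ u ∈ Finset.range ℓ, C (z s ^ u) * (C ι * comb u) =
          ∑ t ∈ Finset.range ℓ, C (ι * (ξ ^ N) ^ ((s + t * (ℓ * N - 1)) * u)) * p' t := by
        intro u _
        simp only [comb, Finset.mul_sum]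
        refine Finset.sum_congr rfl fun t _ => ?_
        rw [← mul_assoc, ← mul_assoc, ← C_mul, ← C_mul]
        congr 2
        rw [mul_comm (z s ^ u) ι, mul_assoc]
        congr 1
        simp only [z]
        rw [← pow_mul, ← pow_add, ← pow_mul]
        obtain ⟨k, hk⟩ : ∃ k, ℓ * N = k + 1 := ⟨ℓ * N - 1, by omega⟩
        have : (s * N + e) * u + (t * N + e) * u * (ℓ * N - 1) =
            N * ((s + t * (ℓ * N - 1)) * u) + (ℓ * N) * (e * u) := by
          rw [hk]; simp only [Nat.add_sub_cancel]; ring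
        rw [this, pow_add, pow_mul ξ (ℓ * N), hord, one_pow, mul_one]
      rw [Finset.sum_congr rfl e1, Finset.sum_comm]
      -- Orthogonality: the exponent is `s - t` modulo `ℓ`, and it is divisible by `ℓ` only for `t =
      -- s`.
      have e2 : ∀ t ∈ Finset.range ℓ,
          ∑ u ∈ Finset.range ℓ, C (ι * (ξ ^ N) ^ ((s + t * (ℓ * N - 1)) * u)) * p' t =
            if t = s then p s else 0 := by
        intro t ht
        have ht' : t < ℓ := by simpa using ht
        rw [← Finset.sum_mul, ← map_sum, ← Finset.mul_sum, hsum]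
        have : ℓ ∣ s + t * (ℓ * N - 1) ↔ t = s := by
          have h4 : s + t * (ℓ * N - 1) + t = s + ℓ * (t * N) := by
            obtain ⟨k, hk⟩ : ∃ k, ℓ * N = k + 1 := ⟨ℓ * N - 1, by omega⟩
            rw [hk]; simp only [Nat.add_sub_cancel]
            rw [show ℓ * (t * N) = t * (ℓ * N) by ring, hk]; ring
          constructor
          · rintro ⟨q, hq⟩
            rw [hq] at h4
            have h5 : (ℓ * q + t) % ℓ = (s + ℓ * (t * N)) % ℓ := by rw [h4]
            rwa [Nat.mul_add_mod, Nat.add_mul_mod_self_left, Nat.mod_eq_of_lt ht',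
              Nat.mod_eq_of_lt hs'] at h5
          · rintro rfl
            exact ⟨t * N, by omega⟩
        simp only [this]
        split_ifs with h6
        · subst h6
          simp [hι, p', hs]
        · simp
      rw [Finset.sum_congr rfl e2]
      simp [hs']
    rw [h2] at h1
    have h3 : f * g - glue h ℓ (fun u => C ι * comb u) =
        (f - ev f s) * g + ev f s * (g - ev g s) + (ev f s * ev g s - p s) -
          (glue h ℓ (fun u => C ι * comb u) - p s) := by ring
    rw [h3]
    exact dvd_sub (dvd_add (dvd_add ((hev_dvd f hf s).mul_right _) ((hev_dvd g hg s).mul_left _))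
      (hp_dvd s hs)) h1
  · have c1 := K.poly.biUnion (S := {f, g}) (Finset.range ℓ) (fun t => {ev f t} ∪ {ev g t})
      (h * (ℓ * (w + w)) + h * (ℓ * (w + w)))
      fun t _ => K.poly.union (hev_cost _ f (by simp) t) (hev_cost _ g (by simp) t)
    have c2 := K.poly.biUnion
      (S := {f, g} ∪ ⋃ t ∈ Finset.range ℓ, ({ev f t} ∪ {ev g t})) I (fun t => {p t}) M
      fun t ht => K.poly.mono_src (by
        intro q hq
        right
        simp only [Set.mem_iUnion]
        refine ⟨t, hI ht, ?_⟩
        simpa [or_comm] using hq) (hp_cost t ht)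
    have c3 := K.poly.andThen c1 c2
    have c4 : K.poly.rel {f, g} 0 {0} := by
      have := hK.lincomb (S := {f, g}) (h := 0) 0 (fun _ => 0) (f := fun _ => 0) (by simp) (by simp)
      simpa using this
    have c5 := K.poly.union c3 c4
    have c6 : ∀ u ∈ Finset.range ℓ, K.poly.rel ({f, g} ∪ ((⋃ t ∈ I, {p t}) ∪ {0}))
        (h * (ℓ * (w + w)) + h * w) {C ι * comb u} := by
      intro u _
      refine K.poly.andThen (hK.lincomb ℓ (fun t => (t * N + e) * u * (ℓ * N - 1)) (f := p')
        ?_ fun t _ => hp'_deg t) (hK.inv_mul_poly (by right; rfl) (hcomb_deg u))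
      intro t _
      right
      by_cases ht : t ∈ I
      · left
        simp only [Set.mem_iUnion]
        exact ⟨t, ht, by simp [p', ht]⟩
      · right; simp [p', ht]
    have c7 := K.poly.andThen c5 (K.poly.biUnion (Finset.range ℓ) _ _ c6)
    have c8 := K.poly.andThen c7 (hK.glue_mem (n := ℓ) (P := fun u => C ι * comb u) hh
      (fun u hu => Or.inr (by
        simp only [Set.mem_iUnion]; exact ⟨u, by simpa using hu, rfl⟩)) hglue_deg)
    refine K.poly.mono_cost (le_of_eq ?_) c8
    simp only [Finset.card_range]
    ring

end Convolution

/-! ### Cyclotomic moduli -/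

section Cyc

variable {R : Type*} [CommRing R]

/-- The polynomial `1 + X ^ N + ⋯ + X ^ ((ℓ - 1) * N)`. -/
noncomputable def cyc (R : Type*) [CommRing R] (ℓ N : ℕ) : R[X] :=
  ∑ t ∈ Finset.range ℓ, X ^ (t * N)

lemma cyc_eq_geom (ℓ N : ℕ) : cyc R ℓ N = ∑ t ∈ Finset.range ℓ, (X ^ N) ^ t :=
  Finset.sum_congr rfl fun t _ => by rw [← pow_mul, mul_comm]

lemma map_cyc {R' : Type*} [CommRing R'] (φ : R →+* R') (ℓ N : ℕ) :
    (cyc R ℓ N).map φ = cyc R' ℓ N := by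
  simp [cyc, Polynomial.map_sum]

lemma monic_cyc {ℓ N : ℕ} (hℓ : 0 < ℓ) (hN : 0 < N) : (cyc R ℓ N).Monic := by
  nontriviality R
  rw [cyc_eq_geom]
  exact (monic_X_pow N).geom_sum (by simpa using hN) (by omega)

lemma degree_cyc [Nontrivial R] {ℓ N : ℕ} (hℓ : 0 < ℓ) (hN : 0 < N) :
    (cyc R ℓ N).degree = ((ℓ - 1) * N : ℕ) := by
  obtain ⟨k, rfl⟩ : ∃ k, ℓ = k + 1 := ⟨ℓ - 1, by omega⟩
  rw [cyc, Finset.sum_range_succ, add_comm, degree_add_eq_left_of_degree_lt, degree_X_pow]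
  · simp
  · rw [degree_X_pow]
    refine (degree_sum_le _ _).trans_lt ?_
    rw [Finset.sup_lt_iff (WithBot.bot_lt_coe _)]
    intro t ht
    rw [degree_X_pow]
    exact_mod_cast Nat.mul_lt_mul_of_pos_right (by simpa using ht) hN

lemma cyc_mul_eq_glue (ℓ N : ℕ) (q : R[X]) : cyc R ℓ N * q = glue N ℓ fun _ => q := by
  rw [cyc, glue, Finset.sum_mul]

/-- The quotient is the top block of length `N`, since the modulus times a block repeats that block
`ℓ` times. Reduction thus subtracts the top block from each of the others. -/
lemma coeff_modByMonic_cyc {ℓ N : ℕ} (hℓ : 0 < ℓ) (hN : 0 < N) {p : R[X]}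
    (hp : p.degree < (ℓ * N : ℕ)) (i : ℕ) :
    (p %ₘ cyc R ℓ N).coeff i =
      if i < (ℓ - 1) * N then p.coeff i - p.coeff ((ℓ - 1) * N + i % N) else 0 := by
  nontriviality R
  set q := polyBlock N (ℓ - 1) p
  have hc : ∀ j, (p - cyc R ℓ N * q).coeff j =
      if j < (ℓ - 1) * N then p.coeff j - p.coeff ((ℓ - 1) * N + j % N) else 0 := by
    intro j
    rw [coeff_sub, cyc_mul_eq_glue, coeff_glue hN fun _ _ => degree_polyBlock_lt _ _ _,
      coeff_polyBlock, if_pos (Nat.mod_lt _ hN)]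
    have e1 : ℓ * N = (ℓ - 1) * N + N := by
      obtain ⟨k, rfl⟩ : ∃ k, ℓ = k + 1 := ⟨ℓ - 1, by omega⟩
      simp [Nat.add_mul]
    by_cases h1 : j < ℓ * N
    · rw [if_pos ((Nat.div_lt_iff_lt_mul hN).mpr h1)]
      split_ifs with h2
      · rfl
      · have h3 : j / N = ℓ - 1 := by
          apply le_antisymm
          · have := (Nat.div_lt_iff_lt_mul hN).mpr h1; omega
          · exact (Nat.le_div_iff_mul_le hN).mpr (by omega)
        rw [← h3, Nat.div_add_mod', sub_self]
    · rw [if_neg (by rwa [Nat.div_lt_iff_lt_mul hN]), if_neg (by omega),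
        (degree_lt_iff_coeff_zero _ _).mp hp j (by omega), sub_zero]
  have hdeg : (p - cyc R ℓ N * q).degree < (cyc R ℓ N).degree := by
    rw [degree_cyc hℓ hN, degree_lt_iff_coeff_zero]
    intro j hj
    rw [hc, if_neg (by omega)]
  rw [(div_modByMonic_unique q _ (monic_cyc hℓ hN) ⟨by ring, hdeg⟩).2, hc]

lemma degree_modByMonic_cyc_lt {ℓ N : ℕ} (hℓ : 0 < ℓ) (hN : 0 < N) (p : R[X]) :
    (p %ₘ cyc R ℓ N).degree < ((ℓ - 1) * N : ℕ) := by
  rcases subsingleton_or_nontrivial R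
  · rw [Subsingleton.elim (p %ₘ cyc R ℓ N) 0, degree_zero]; exact WithBot.bot_lt_coe _
  rw [← degree_cyc (R := R) hℓ hN]
  exact degree_modByMonic_lt _ (monic_cyc hℓ hN)

/-- Reduction modulo a cyclotomic modulus takes one subtraction per coefficient. -/
lemma modByMonic_cyc_cost {K : CostRel R} {w : ℕ} (h0 : ∀ S, K.rel S 0 {0})
    (hsub : ∀ S a b, a ∈ S → b ∈ S → K.rel S w {a - b}) {ℓ N : ℕ} (hℓ : 0 < ℓ) (hN : 0 < N)
    {S : Set R[X]} {p : R[X]} (hpS : p ∈ S) (hp : p.degree < (ℓ * N : ℕ)) :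
    K.poly.rel S ((ℓ - 1) * N * w) {p %ₘ cyc R ℓ N} := by
  refine poly_rel_of_coeff h0 (degree_modByMonic_cyc_lt hℓ hN p) fun i hi => ?_
  rw [coeff_modByMonic_cyc hℓ hN hp, if_pos hi]
  exact hsub _ _ _ (coeff_mem_biUnion hpS _) (coeff_mem_biUnion hpS _)

/-- Reduction modulo a polynomial with integer coefficients preserves additive subgroups. -/
lemma coeff_modByMonic_cyc_mem {ℓ N : ℕ} (hℓ : 0 < ℓ) (hN : 0 < N) (G : AddSubgroup R) {p : R[X]}
    (hp : ∀ i, p.coeff i ∈ G) (j : ℕ) : (p %ₘ cyc R ℓ N).coeff j ∈ G := by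
  have h1 : p %ₘ cyc R ℓ N =
      ∑ i ∈ p.support, p.coeff i • ((X ^ i : R[X]) %ₘ cyc R ℓ N) := by
    conv_lhs => rw [p.as_sum_support]
    rw [← modByMonicHom_apply, map_sum]
    refine Finset.sum_congr rfl fun i _ => ?_
    rw [← C_mul_X_pow_eq_monomial, ← smul_eq_C_mul, map_smul, modByMonicHom_apply]
  rw [h1, finsetSum_coeff]
  refine G.sum_mem fun i _ => ?_
  -- The modulus is monic over `ℤ`, so the reduced powers of `X` have integer coefficients.
  have h2 : (X ^ i : R[X]) %ₘ cyc R ℓ N =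
      ((X ^ i : ℤ[X]) %ₘ cyc ℤ ℓ N).map (Int.castRingHom R) := by
    rw [map_modByMonic _ (monic_cyc hℓ hN), map_cyc, Polynomial.map_pow, map_X]
  rw [coeff_smul, h2, coeff_map, smul_eq_mul, mul_comm, eq_intCast, ← zsmul_eq_mul]
  exact G.zsmul_mem (hp i) _

end Cyc

/-! ### Principal roots of unity of order `2` and `3` -/

section Roots

variable {D : Type*} [CommRing D] {ℓ : ℕ} {ω : D}

lemma pow_eq_one_of_geom_sum (h : ∑ t ∈ Finset.range ℓ, ω ^ t = 0) : ω ^ ℓ = 1 := by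
  have := geom_sum_mul ω ℓ
  rw [h, zero_mul] at this
  exact (sub_eq_zero.mp this.symm)

/-- The ring may have zero divisors, so `ω ^ ℓ = 1` would not suffice; the vanishing geometric sum
makes `ω` a principal root of unity. As `ℓ` is `2` or `3`, the residues of `e` can be checked one by
one. -/
lemma sum_pow_mul_eq (hℓ : ℓ = 2 ∨ ℓ = 3) (h : ∑ t ∈ Finset.range ℓ, ω ^ t = 0) (e : ℕ) :
    ∑ u ∈ Finset.range ℓ, ω ^ (e * u) = if ℓ ∣ e then (ℓ : D) else 0 := by
  have h1 := pow_eq_one_of_geom_sum h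
  have h2 : ω ^ e = ω ^ (e % ℓ) := pow_eq_pow_mod e h1
  simp only [pow_mul, h2, Nat.dvd_iff_mod_eq_zero]
  have h3 : e % ℓ < ℓ := Nat.mod_lt _ (by omega)
  generalize e % ℓ = d at h3
  rcases hℓ with rfl | rfl
  · interval_cases d
    · norm_num [Finset.sum_range_succ]
    · simpa [Finset.sum_range_succ] using h
  · simp only [Finset.sum_range_succ, Finset.sum_range_zero] at h ⊢
    interval_cases d
    · norm_num
    · simpa using h
    · simp only [OfNat.ofNat_ne_zero, if_false]
      linear_combination h + ω * h1

/-- Up to units the difference is `1 - ω ^ d` with `0 < d < ℓ`. This divides `∏ (1 - ω ^ d) = ℓ`,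
which `ι` inverts. -/
lemma isUnit_pow_sub_pow (hℓ : ℓ = 2 ∨ ℓ = 3) (h : ∑ t ∈ Finset.range ℓ, ω ^ t = 0) {ι : D}
    (hι : ι * ℓ = 1) {s t : ℕ} (hs : s < ℓ) (ht : t < ℓ) (hst : s ≠ t) :
    IsUnit (ω ^ s - ω ^ t) := by
  have h1 := pow_eq_one_of_geom_sum h
  have key : ∀ d, 0 < d → d < ℓ → IsUnit (1 - ω ^ d) := by
    intro d hd hd'
    rcases hℓ with rfl | rfl
    · obtain rfl : d = 1 := by omega
      simp only [Finset.sum_range_succ, Finset.sum_range_zero] at h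
      push_cast at hι
      exact IsUnit.of_mul_eq_one ι (by linear_combination hι - ι * h)
    · simp only [Finset.sum_range_succ, Finset.sum_range_zero] at h
      push_cast at hι
      have h2 : (1 - ω ^ 1) * (1 - ω ^ 2) * ι = 1 := by linear_combination hι - ι * h + ι * h1
      interval_cases d
      · exact IsUnit.of_mul_eq_one ((1 - ω ^ 2) * ι) (by linear_combination h2)
      · exact IsUnit.of_mul_eq_one ((1 - ω ^ 1) * ι) (by linear_combination h2)
  have hω : IsUnit ω := IsUnit.of_pow_eq_one h1 (by omega)
  rcases lt_or_gt_of_ne hst with h2 | h2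
  · have : ω ^ s - ω ^ t = ω ^ s * (1 - ω ^ (t - s)) := by
      rw [mul_sub, ← pow_add, mul_one, Nat.add_sub_cancel' h2.le]
    rw [this]
    exact (hω.pow s).mul (key _ (by omega) (by omega))
  · have : ω ^ s - ω ^ t = -(ω ^ t * (1 - ω ^ (s - t))) := by
      rw [mul_sub, ← pow_add, mul_one, Nat.add_sub_cancel' h2.le]; ring
    rw [this]
    exact ((hω.pow t).mul (key _ (by omega) (by omega))).neg

lemma prod_sub_pow_mul (hℓ : ℓ = 2 ∨ ℓ = 3) (h : ∑ t ∈ Finset.range ℓ, ω ^ t = 0) (Z c : D) :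
    ∏ t ∈ Finset.range ℓ, (Z - ω ^ t * c) = Z ^ ℓ - c ^ ℓ := by
  have h1 := pow_eq_one_of_geom_sum h
  rcases hℓ with rfl | rfl
  · simp only [Finset.sum_range_succ, Finset.sum_range_zero, Finset.prod_range_succ,
      Finset.prod_range_zero] at h ⊢
    linear_combination c * (c - Z) * h
  · simp only [Finset.sum_range_succ, Finset.sum_range_zero, Finset.prod_range_succ,
      Finset.prod_range_zero] at h ⊢
    linear_combination (-c * Z ^ 2 + c ^ 2 * Z * ω) * h - c ^ 3 * h1

lemma prod_erase_sub_pow (hℓ : ℓ = 2 ∨ ℓ = 3) (h : ∑ t ∈ Finset.range ℓ, ω ^ t = 0) (Z : D) :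
    ∏ t ∈ (Finset.range ℓ).erase 0, (Z - ω ^ t) = ∑ t ∈ Finset.range ℓ, Z ^ t := by
  have h1 := pow_eq_one_of_geom_sum h
  rcases hℓ with rfl | rfl
  · rw [show (Finset.range 2).erase 0 = {1} by decide]
    simp only [Finset.sum_range_succ, Finset.sum_range_zero, Finset.prod_singleton] at h ⊢
    linear_combination -h
  · rw [show (Finset.range 3).erase 0 = {1, 2} by decide, Finset.prod_pair (by decide)]
    simp only [Finset.sum_range_succ, Finset.sum_range_zero] at h ⊢
    linear_combination -Z * h + h1

end Roots

/-! ### Fast multiplication over a ring with roots of unity -/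

section FastConvolution

variable {D : Type*} [CommRing D] {K : CostRel D} {ξ ι : D} {w ℓ κ T : ℕ}

/-- Two of the factors differ by a constant that is a unit, hence they are coprime. -/
lemma prod_dvd_of_forall (hℓ : ℓ = 2 ∨ ℓ = 3) {N : ℕ}
    (h : ∑ t ∈ Finset.range ℓ, (ξ ^ N) ^ t = 0) (hN : 0 < N)
    (hι : ι * ℓ = 1) {I : Finset ℕ} (hI : I ⊆ Finset.range ℓ) (L e : ℕ) {q : D[X]}
    (hq : ∀ t ∈ I, (X ^ L - C (ξ ^ (t * N + e))) ∣ q) :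
    ∏ t ∈ I, (X ^ L - C (ξ ^ (t * N + e))) ∣ q := by
  refine Finset.prod_dvd_of_coprime ?_ hq
  intro s hs t ht hst
  have hu := isUnit_pow_sub_pow hℓ h hι (by simpa using hI hs) (by simpa using hI ht) hst
  have hξ : IsUnit ξ := by
    have := pow_eq_one_of_geom_sum h
    rw [← pow_mul] at this
    exact IsUnit.of_pow_eq_one this (Nat.mul_ne_zero hN.ne' (by omega))
  obtain ⟨u, hu⟩ := (hu.mul (hξ.pow e)).exists_right_inv
  refine ⟨-C u, C u, ?_⟩
  have e1 : ∀ t, ξ ^ (t * N + e) = (ξ ^ N) ^ t * ξ ^ e := fun t => by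
    rw [pow_add, mul_comm t N, pow_mul]
  simp only [e1]
  rw [← C_1, ← hu]
  simp only [C_mul, C_sub, C_pow]
  ring

/-- Multiplication modulo `X ^ ℓ ^ r - ξ ^ e`. -/
lemma LinCost.exists_mul_mod_pow (hK : LinCost K ξ ι w) (hℓ : ℓ = 2 ∨ ℓ = 3)
    (hξ : ∑ t ∈ Finset.range ℓ, (ξ ^ ℓ ^ κ) ^ t = 0) (hι : ι * ℓ = 1)
    (hmul : ∀ S a b, a ∈ S → b ∈ S → K.rel S T {a * b}) (r : ℕ) (hr : r ≤ κ + 1) :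
    ∀ e, ℓ ^ r ∣ e → ∀ f g : D[X], f.degree < (ℓ ^ r : ℕ) → g.degree < (ℓ ^ r : ℕ) →
      ∃ p : D[X], p.degree < (ℓ ^ r : ℕ) ∧ (X ^ ℓ ^ r - C (ξ ^ e)) ∣ f * g - p ∧
        K.poly.rel {f, g} (ℓ ^ r * T + r * ((6 * ℓ + 1) * ℓ ^ r * w)) {p} := by
  have hpos : 0 < ℓ := by omega
  induction r with
  | zero =>
    intro e _ f g hf hg
    have hf' : f = C (f.coeff 0) := eq_C_of_degree_le_zero (by
      simpa [Nat.WithBot.lt_one_iff_le_zero] using hf)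
    have hg' : g = C (g.coeff 0) := eq_C_of_degree_le_zero (by
      simpa [Nat.WithBot.lt_one_iff_le_zero] using hg)
    have hd : (C (f.coeff 0 * g.coeff 0) : D[X]).degree < (ℓ ^ 0 : ℕ) := by
      refine degree_C_le.trans_lt ?_
      rw [pow_zero]
      exact_mod_cast Nat.one_pos
    refine ⟨C (f.coeff 0 * g.coeff 0), hd, ?_, ?_⟩
    · rw [C_mul, ← hf', ← hg', sub_self]
      exact dvd_zero _
    · simp only [Nat.zero_mul, Nat.add_zero]
      refine poly_rel_of_coeff hK.zero hd fun i hi => ?_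
      obtain rfl : i = 0 := by simpa using hi
      rw [coeff_C_zero]
      exact hmul _ _ _ (coeff_mem_biUnion (by simp) _) (coeff_mem_biUnion (by simp) _)
  | succ r ih =>
    rintro _ ⟨e, rfl⟩ f g hf hg
    rw [pow_succ'] at hf hg ⊢
    have hord : ξ ^ (ℓ * ℓ ^ κ) = 1 := by
      rw [mul_comm, pow_mul]; exact pow_eq_one_of_geom_sum hξ
    -- One FFT level: divisibility of the exponent by `ℓ ^ (r + 1)` provides an `ℓ`-th root of the
    -- constant, and `r ≤ κ` keeps the exponents of all `ℓ` factors divisible by `ℓ ^ r`.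
    obtain ⟨H, hd, hdvd, hcost⟩ := hK.split_mul (ℓ := ℓ) (N := ℓ ^ κ) (by positivity) hord
      (sum_pow_mul_eq hℓ hξ) hι (subset_refl (Finset.range ℓ)) (h := ℓ ^ r) (by positivity)
      (ℓ ^ r * e) _
      (fun t _ => ih (by omega) (t * ℓ ^ κ + ℓ ^ r * e)
        (dvd_add ((pow_dvd_pow ℓ (by omega)).mul_left t) (dvd_mul_right _ _)))
      f g hf hg
    refine ⟨H, hd, ?_, ?_⟩
    · have h1 := prod_dvd_of_forall hℓ hξ (by positivity) hι subset_rfl _ _ hdvd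
      have hω : ∑ t ∈ Finset.range ℓ, (C (ξ ^ ℓ ^ κ) : D[X]) ^ t = 0 := by
        rw [← map_zero C, ← hξ, map_sum]
        simp only [C_pow]
      have h2 := prod_sub_pow_mul hℓ hω (X ^ ℓ ^ r) (C (ξ ^ (ℓ ^ r * e)))
      have h3 : ∏ t ∈ Finset.range ℓ, (X ^ ℓ ^ r - C (ξ ^ (t * ℓ ^ κ + ℓ ^ r * e))) =
          X ^ (ℓ * ℓ ^ r) - C (ξ ^ (ℓ * ℓ ^ r * e)) := by
        rw [mul_comm ℓ, pow_mul, show ℓ ^ r * ℓ * e = ℓ ^ r * e * ℓ by ring, pow_mul ξ, C_pow,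
          ← h2]
        refine Finset.prod_congr rfl fun t _ => ?_
        rw [pow_add, C_mul, mul_comm t, pow_mul, C_pow]
      rwa [h3] at h1
    · refine K.poly.mono_cost (le_of_eq ?_) hcost
      simp only [Finset.card_range]
      ring

/-- Multiplication modulo `1 + X ^ ℓ ^ r + ⋯ + X ^ ((ℓ - 1) * ℓ ^ r)`. -/
lemma LinCost.exists_mul_mod_cyc (hK : LinCost K ξ ι w) (hℓ : ℓ = 2 ∨ ℓ = 3)
    (hξ : ∑ t ∈ Finset.range ℓ, (ξ ^ ℓ ^ κ) ^ t = 0) (hι : ι * ℓ = 1)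
    (hmul : ∀ S a b, a ∈ S → b ∈ S → K.rel S T {a * b}) {r : ℕ} (hr : r ≤ κ)
    {f g : D[X]} (hf : f.degree < (ℓ * ℓ ^ r : ℕ)) (hg : g.degree < (ℓ * ℓ ^ r : ℕ)) :
    ∃ H : D[X], H.degree < (ℓ * ℓ ^ r : ℕ) ∧ cyc D ℓ (ℓ ^ r) ∣ f * g - H ∧
      K.poly.rel {f, g} ((ℓ - 1) * (ℓ ^ r * T + r * ((6 * ℓ + 1) * ℓ ^ r * w)) +
        (6 * ℓ + 1) * (ℓ * ℓ ^ r) * w) {H} := by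
  have hpos : 0 < ℓ := by omega
  have hord : ξ ^ (ℓ * ℓ ^ κ) = 1 := by
    rw [mul_comm, pow_mul]; exact pow_eq_one_of_geom_sum hξ
  -- The modulus is `X ^ (ℓ * ℓ ^ r) - 1` without its factor `X ^ ℓ ^ r - 1`, so the index `0` is
  -- omitted and only `ℓ - 1` products are needed.
  obtain ⟨H, hd, hdvd, hcost⟩ := hK.split_mul (ℓ := ℓ) (N := ℓ ^ κ) (by positivity) hord
    (sum_pow_mul_eq hℓ hξ) hι (Finset.erase_subset 0 (Finset.range ℓ)) (h := ℓ ^ r) (by positivity)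
    0 _
    (fun t _ => hK.exists_mul_mod_pow hℓ hξ hι hmul r (by omega) (t * ℓ ^ κ + 0)
      ((pow_dvd_pow ℓ (by omega)).mul_left t))
    f g hf hg
  refine ⟨H, hd, ?_, ?_⟩
  · have h1 := prod_dvd_of_forall hℓ hξ (by positivity) hι (Finset.erase_subset 0 _) _ _ hdvd
    have hω : ∑ t ∈ Finset.range ℓ, (C (ξ ^ ℓ ^ κ) : D[X]) ^ t = 0 := by
      rw [← map_zero C, ← hξ, map_sum]
      simp only [C_pow]
    have h2 := prod_erase_sub_pow hℓ hω (X ^ ℓ ^ r)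
    rw [cyc_eq_geom, ← h2]
    convert h1 using 4 with t _
    rw [Nat.add_zero, mul_comm, pow_mul]
    simp only [C_pow]
  · refine K.poly.mono_cost (le_of_eq ?_) hcost
    rw [Finset.card_erase_of_mem (by simpa using hpos), Finset.card_range]

end FastConvolution

/-! ### Coefficientwise operations and shifts modulo a cyclotomic modulus -/

section PolyArith

variable {F A : Type*} [Field F] [CommRing A] [Algebra F A] {S T : Set A[X]} {p q : A[X]} {h : ℕ}

lemma poly_rel_free {n : ℕ} (hT : ∀ p ∈ T, ∀ i, p.coeff i = 0 ∨ ∃ q ∈ S, ∃ j, p.coeff i = q.coeff j) :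
    (arith F A).poly.rel S n T := by
  refine arith_const fun x hx => ?_
  simp only [Set.mem_iUnion] at hx
  obtain ⟨p, hp, i, rfl⟩ := hx
  rcases hT p hp i with h | ⟨q, hq, j, h⟩
  · right; exact ⟨0, by rw [map_zero, h]⟩
  · left
    show p.coeff i ∈ _
    rw [h]
    exact coeff_mem_biUnion hq j

lemma poly_rel_zero (n : ℕ) : (arith F A).poly.rel S n {0} :=
  poly_rel_free (by simp)

lemma poly_rel_add (hp : p ∈ S) (hq : q ∈ S) (hdp : p.degree < h) (hdq : q.degree < h) :
    (arith F A).poly.rel S h {p + q} := by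
  rw [← Nat.mul_one h]
  refine poly_rel_of_coeff arith_zero ((degree_add_le _ _).trans_lt (max_lt hdp hdq)) fun i _ => ?_
  rw [coeff_add]
  exact arith_add (coeff_mem_biUnion hp i) (coeff_mem_biUnion hq i)

lemma poly_rel_sub (hp : p ∈ S) (hq : q ∈ S) (hdp : p.degree < h) (hdq : q.degree < h) :
    (arith F A).poly.rel S h {p - q} := by
  rw [← Nat.mul_one h]
  refine poly_rel_of_coeff arith_zero ((degree_sub_le _ _).trans_lt (max_lt hdp hdq)) fun i _ => ?_
  rw [coeff_sub]
  exact arith_sub (coeff_mem_biUnion hp i) (coeff_mem_biUnion hq i)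

lemma poly_rel_const_mul (c : F) (hp : p ∈ S) (hdp : p.degree < h) :
    (arith F A).poly.rel S h {C (algebraMap F A c) * p} := by
  rw [← Nat.mul_one h]
  refine poly_rel_of_coeff arith_zero (degree_C_mul_lt _ hdp) fun i _ => ?_
  rw [coeff_C_mul]
  exact arith_const_mul c (coeff_mem_biUnion hp i)

/-- Multiplication by a power of `X` modulo a cyclotomic modulus. -/
lemma poly_rel_X_pow_mul_mod {ℓ N : ℕ} (hℓ : 0 < ℓ) (hN : 0 < N) (hp : p ∈ S)
    (hd : p.degree < ((ℓ - 1) * N : ℕ)) (e : ℕ) :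
    (arith F A).poly.rel S (2 * (ℓ * N)) {(X ^ e * p) %ₘ cyc A ℓ N} := by
  set L := ℓ * N with hL
  have hLpos : 0 < L := by positivity
  -- The modulus divides `X ^ L - 1`, so `X ^ e` acts as a cyclic shift: one addition of two blocks
  -- of length `L` wraps the overflow around, and one reduction follows.
  set y : A[X] := X ^ (e % L) * p with hy
  have hle : (ℓ - 1) * N ≤ L := Nat.mul_le_mul_right _ (by omega)
  have hdy : y.degree < (2 * L : ℕ) := by
    rw [degree_lt_iff_coeff_zero]
    intro i hi
    have := Nat.mod_lt e hLpos
    rw [hy, coeff_X_pow_mul', if_pos (by omega), (degree_lt_iff_coeff_zero _ _).mp hd]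
    omega
  have h1 : (arith F A).poly.rel S 0 ({polyBlock L 0 y} ∪ {polyBlock L 1 y}) := by
    refine poly_rel_free ?_
    have key : ∀ u i, (polyBlock L u y).coeff i = 0 ∨
        ∃ q ∈ S, ∃ j, (polyBlock L u y).coeff i = q.coeff j := by
      intro u i
      rw [coeff_polyBlock]
      split_ifs with h2
      · rw [hy, coeff_X_pow_mul']
        split_ifs
        · exact .inr ⟨p, hp, _, rfl⟩
        · exact .inl rfl
      · exact .inl rfl
    rintro q (rfl | rfl) i
    · exact key 0 i
    · exact key 1 i
  have h2 := (arith F A).poly.andThen h1 (poly_rel_add (h := L) (p := polyBlock L 0 y)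
    (q := polyBlock L 1 y) (by simp) (by simp) (degree_polyBlock_lt _ _ _)
    (degree_polyBlock_lt _ _ _))
  have h3 := (arith F A).poly.andThen h2 (modByMonic_cyc_cost arith_zero (w := 1)
    (fun S a b => arith_sub) hℓ hN (p := polyBlock L 0 y + polyBlock L 1 y) (by simp)
    ((degree_add_le _ _).trans_lt (max_lt (degree_polyBlock_lt _ _ _) (degree_polyBlock_lt _ _ _))))
  have h4 : (X ^ e * p) %ₘ cyc A ℓ N = (polyBlock L 0 y + polyBlock L 1 y) %ₘ cyc A ℓ N := by
    refine modByMonic_eq_of_dvd_sub (monic_cyc hℓ hN) ?_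
    have hdvd : cyc A ℓ N ∣ X ^ L - 1 := by
      rw [cyc_eq_geom, hL, mul_comm ℓ, pow_mul, ← geom_sum_mul]
      exact dvd_mul_right _ _
    have e1 : y = polyBlock L 0 y + X ^ L * polyBlock L 1 y := by
      conv_lhs => rw [← glue_polyBlock hLpos hdy]
      simp [glue, Finset.sum_range_succ]
    have e2 : X ^ e * p - (polyBlock L 0 y + polyBlock L 1 y) =
        ((X ^ L) ^ (e / L) - 1 ^ (e / L)) * y + (X ^ L - 1) * polyBlock L 1 y := by
      have : X ^ e * p = (X ^ L) ^ (e / L) * y := by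
        rw [hy, ← mul_assoc, ← pow_mul, ← pow_add, Nat.div_add_mod]
      rw [this]
      linear_combination e1
    rw [e2]
    exact dvd_add ((hdvd.trans (sub_dvd_pow_sub_pow _ _ _)).mul_right _) (hdvd.mul_right _)
  rw [h4]
  exact (arith F A).poly.mono_cost (by omega) h3

end PolyArith

/-! ### Adjoining a root of unity and the recursive step of fast multiplication -/

section Adjoin

variable {F A : Type*} [Field F] [CommRing A] [Algebra F A] {ℓ N : ℕ}

/-- The cost of elements of the quotient of `A[X]` by a cyclotomic modulus, in terms of the
coefficients of their reduced representatives. -/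
noncomputable def adjoinCost (F : Type*) {A : Type*} [Field F] [CommRing A] [Algebra F A] {ℓ N : ℕ}
    (hℓ : 0 < ℓ) (hN : 0 < N) : CostRel (AdjoinRoot (cyc A ℓ N)) :=
  (arith F A).poly.comap fun d => {AdjoinRoot.modByMonicHom (monic_cyc hℓ hN) d}

lemma adjoinCost_rel (hℓ : 0 < ℓ) (hN : 0 < N) {S : Set (AdjoinRoot (cyc A ℓ N))} {n : ℕ}
    {d : AdjoinRoot (cyc A ℓ N)}
    (h : (arith F A).poly.rel (AdjoinRoot.modByMonicHom (monic_cyc hℓ hN) '' S) n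
      {AdjoinRoot.modByMonicHom (monic_cyc hℓ hN) d}) :
    (adjoinCost F hℓ hN).rel S n {d} := by
  rw [adjoinCost, CostRel.comap_rel]
  refine (arith F A).poly.mono ?_ le_rfl ?_ h
  · rintro _ ⟨x, hx, rfl⟩
    simp only [Set.mem_iUnion]
    exact ⟨x, hx, rfl⟩
  · simp

lemma degree_modByMonicHom_lt (hℓ : 0 < ℓ) (hN : 0 < N) (d : AdjoinRoot (cyc A ℓ N)) :
    (AdjoinRoot.modByMonicHom (monic_cyc hℓ hN) d).degree < ((ℓ - 1) * N : ℕ) := by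
  obtain ⟨p, rfl⟩ := AdjoinRoot.mk_surjective d
  rw [AdjoinRoot.modByMonicHom_mk]
  exact degree_modByMonic_cyc_lt hℓ hN p

/-- This is the reason for adjoining a root of unity: its powers multiply by shifting coefficients,
so the FFT spends only linear time per ring operation outside the products of values. -/
lemma linCost_adjoin (hℓ : 0 < ℓ) (hN : 0 < N) (c : F) :
    LinCost (adjoinCost F hℓ hN) (AdjoinRoot.root (cyc A ℓ N))
      (AdjoinRoot.of (cyc A ℓ N) (algebraMap F A c)) (2 * (ℓ * N)) := by
  have hle : (ℓ - 1) * N ≤ 2 * (ℓ * N) :=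
    (Nat.mul_le_mul_right _ (Nat.sub_le ℓ 1)).trans (by omega)
  set φ := AdjoinRoot.modByMonicHom (monic_cyc (R := A) hℓ hN) with hφ
  have hdeg := degree_modByMonicHom_lt (A := A) hℓ hN
  refine ⟨fun S => ?_, fun S a b ha hb => ?_, fun S a e ha => ?_, fun S a b ha hb => ?_,
    fun S a ha => ?_⟩ <;> apply adjoinCost_rel
  · rw [map_zero]
    exact poly_rel_zero 0
  · rw [map_add]
    exact (arith F A).poly.mono_cost hle (poly_rel_add ⟨a, ha, rfl⟩ ⟨b, hb, rfl⟩ (hdeg a) (hdeg b))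
  · have : φ (AdjoinRoot.root (cyc A ℓ N) ^ e * a) = (X ^ e * φ a) %ₘ cyc A ℓ N := by
      rw [← AdjoinRoot.modByMonicHom_mk (monic_cyc hℓ hN), map_mul (AdjoinRoot.mk _),
        map_pow (AdjoinRoot.mk _), AdjoinRoot.mk_X, AdjoinRoot.mk_leftInverse]
    rw [← hφ, this]
    exact poly_rel_X_pow_mul_mod hℓ hN (Set.mem_image_of_mem φ ha) (hdeg a) e
  · rw [map_sub]
    exact (arith F A).poly.mono_cost hle (poly_rel_sub ⟨a, ha, rfl⟩ ⟨b, hb, rfl⟩ (hdeg a) (hdeg b))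
  · have : φ (AdjoinRoot.of (cyc A ℓ N) (algebraMap F A c) * a) =
        C (algebraMap F A c) * φ a := by
      rw [← smul_eq_C_mul, ← map_smul, Algebra.smul_def, AdjoinRoot.algebraMap_eq]
    rw [← hφ, this]
    exact (arith F A).poly.mono_cost hle (poly_rel_const_mul c ⟨a, ha, rfl⟩ (hdeg a))

/-- `T` bounds the cost of multiplication modulo `cyc A ℓ (ℓ ^ k)`. -/
def MulCost (F A : Type*) [Field F] [CommRing A] [Algebra F A] (ℓ k T : ℕ) : Prop :=
  ∀ (S : Set A[X]) (a b : A[X]), a ∈ S → b ∈ S → a.degree < ((ℓ - 1) * ℓ ^ k : ℕ) →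
    b.degree < ((ℓ - 1) * ℓ ^ k : ℕ) → (arith F A).poly.rel S T {(a * b) %ₘ cyc A ℓ (ℓ ^ k)}

lemma eq_sum_of_degree_lt {p : A[X]} {h : ℕ} (hp : p.degree < h) :
    p = ∑ i ∈ Finset.range h, C (p.coeff i) * X ^ i := by
  ext j
  simp only [finsetSum_coeff, coeff_C_mul_X_pow, Finset.sum_ite_eq, Finset.mem_range]
  split_ifs with hj
  · rfl
  · exact (degree_lt_iff_coeff_zero _ _).mp hp j (by omega)

/-- Schoolbook multiplication with the shifts `X ^ i * b` already reduced; it starts the recursion.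
-/
lemma mulCost_naive (hℓ : 0 < ℓ) (k : ℕ) : MulCost F A ℓ k
    ((ℓ - 1) * ℓ ^ k * (2 * (ℓ * ℓ ^ k) + 2 * ((ℓ - 1) * ℓ ^ k))) := by
  intro S a b ha hb hda hdb
  set N := ℓ ^ k
  have hN : 0 < N := by positivity
  set d := (ℓ - 1) * N
  have h1 : (a * b) %ₘ cyc A ℓ N =
      ∑ i ∈ Finset.range d, C (a.coeff i) * ((X ^ i * b) %ₘ cyc A ℓ N) := by
    have e1 : a * b = ∑ i ∈ Finset.range d, a.coeff i • (X ^ i * b) := by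
      conv_lhs => rw [eq_sum_of_degree_lt hda, Finset.sum_mul]
      refine Finset.sum_congr rfl fun i _ => ?_
      rw [smul_eq_C_mul, mul_assoc]
    rw [e1, ← modByMonicHom_apply, map_sum]
    refine Finset.sum_congr rfl fun i _ => ?_
    rw [map_smul, modByMonicHom_apply, smul_eq_C_mul]
  have c1 := (arith F A).poly.biUnion (S := S) (Finset.range d)
    (fun i => {(X ^ i * b) %ₘ cyc A ℓ N}) (2 * (ℓ * N))
    fun i _ => poly_rel_X_pow_mul_mod hℓ hN hb hdb i
  have c2 : (arith F A).poly.rel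
      (S ∪ ⋃ i ∈ Finset.range d, {(X ^ i * b) %ₘ cyc A ℓ N}) (d * (d * (1 + 1)))
      {(a * b) %ₘ cyc A ℓ N} := by
    refine poly_rel_of_coeff arith_zero (degree_modByMonic_cyc_lt hℓ hN _) fun j _ => ?_
    rw [h1, finsetSum_coeff]
    refine (arith F A).sum_range arith_zero (fun S a b => arith_add) d _ 1 fun i hi => ?_
    rw [coeff_C_mul]
    refine arith_mul (coeff_mem_biUnion (.inl ha) i) (coeff_mem_biUnion (.inr ?_) j)
    simp only [Set.mem_iUnion]
    exact ⟨i, by simpa using hi, rfl⟩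
  refine (arith F A).poly.mono_cost (le_of_eq ?_) ((arith F A).poly.andThen c1 c2)
  rw [Finset.card_range]
  ring

/-- The polynomial in two variables whose coefficients are the blocks of `p`. -/
noncomputable def bivariate (h n : ℕ) (p : A[X]) : A[X][X] :=
  ∑ i ∈ Finset.range n, monomial i (polyBlock h i p)

lemma coeff_bivariate (h n : ℕ) (p : A[X]) (i : ℕ) :
    (bivariate h n p).coeff i = if i < n then polyBlock h i p else 0 := by
  simp [bivariate, coeff_monomial]

lemma eval_bivariate {h n : ℕ} (hh : 0 < h) {p : A[X]} (hp : p.degree < (n * h : ℕ)) :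
    (bivariate h n p).eval (X ^ h) = p := by
  conv_rhs => rw [← glue_polyBlock hh hp]
  rw [bivariate, eval_finsetSum, glue]
  refine Finset.sum_congr rfl fun i _ => ?_
  rw [eval_monomial, ← pow_mul, mul_comm h, mul_comm]

lemma degree_bivariate_lt (h n : ℕ) (p : A[X]) : (bivariate h n p).degree < n := by
  rw [degree_lt_iff_coeff_zero]
  intro i hi
  rw [coeff_bivariate, if_neg (by omega)]

lemma degree_coeff_bivariate_lt (h n : ℕ) (p : A[X]) (i : ℕ) :
    ((bivariate h n p).coeff i).degree < h := by
  rw [coeff_bivariate]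
  split_ifs
  · exact degree_polyBlock_lt _ _ _
  · rw [degree_zero]; exact WithBot.bot_lt_coe _

lemma degree_mul_lt_add {p q : A[X]} {m n : ℕ} (hp : p.degree < m) (hq : q.degree < n) :
    (p * q).degree < (m + n : ℕ) := by
  rw [degree_lt_iff_coeff_zero] at *
  intro i hi
  rw [coeff_mul]
  refine Finset.sum_eq_zero fun x hx => ?_
  have : x.1 + x.2 = i := by simpa using hx
  by_cases h : m ≤ x.1
  · rw [hp _ h, zero_mul]
  · rw [hq _ (by omega), mul_zero]

/-- Multiplication modulo a cyclotomic modulus of large degree is reduced to multiplications modulo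
one of smaller degree. -/
lemma MulCost.step [Nontrivial A] (hℓ : ℓ = 2 ∨ ℓ = 3) (hF : (ℓ : F) ≠ 0) {r r₂ κ T : ℕ}
    (hr : r ≤ κ) (hκ : 2 * ℓ ^ r₂ ≤ (ℓ - 1) * ℓ ^ κ) (h : MulCost F A ℓ κ T) :
    MulCost F A ℓ (r + r₂) ((ℓ - 1) * (ℓ ^ r * T +
        r * ((6 * ℓ + 1) * ℓ ^ r * (2 * (ℓ * ℓ ^ κ)))) +
      (6 * ℓ + 1) * (ℓ * ℓ ^ r) * (2 * (ℓ * ℓ ^ κ)) + (ℓ - 1) * ℓ ^ r * (2 * (ℓ * ℓ ^ κ)) +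
      ℓ * ℓ ^ (r + r₂) + (ℓ - 1) * ℓ ^ (r + r₂)) := by
  intro S a b ha hb hda hdb
  have hpos : 0 < ℓ := by omega
  have hNκ : 0 < ℓ ^ κ := by positivity
  have hn₁ : 0 < ℓ ^ r := by positivity
  have hn₂ : 0 < ℓ ^ r₂ := by positivity
  have hN : 0 < ℓ ^ (r + r₂) := by positivity
  set n := (ℓ - 1) * ℓ ^ r with hn
  have hnN : (ℓ - 1) * ℓ ^ (r + r₂) = n * ℓ ^ r₂ := by rw [pow_add, hn, mul_assoc]
  rw [hnN] at hda hdb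
  set Q := cyc A ℓ (ℓ ^ κ) with hQ
  have hQm : Q.Monic := monic_cyc hpos hNκ
  set φ := AdjoinRoot.modByMonicHom (monic_cyc (R := A) hpos hNκ) with hφ
  let KD := adjoinCost F (A := A) hpos hNκ
  have hK : LinCost KD (AdjoinRoot.root Q) (AdjoinRoot.of Q (algebraMap F A (ℓ : F)⁻¹))
      (2 * (ℓ * ℓ ^ κ)) := linCost_adjoin hpos hNκ _
  have hξ : ∑ t ∈ Finset.range ℓ, (AdjoinRoot.root Q ^ ℓ ^ κ) ^ t = 0 := by
    have h1 : AdjoinRoot.mk Q (∑ t ∈ Finset.range ℓ, (X ^ ℓ ^ κ) ^ t) = 0 := by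
      rw [← cyc_eq_geom]; exact AdjoinRoot.mk_self
    simpa only [map_sum, map_pow, AdjoinRoot.mk_X] using h1
  have hι : AdjoinRoot.of Q (algebraMap F A (ℓ : F)⁻¹) * (ℓ : AdjoinRoot Q) = 1 := by
    rw [← map_natCast (AdjoinRoot.of Q), ← map_natCast (algebraMap F A), ← map_mul, ← map_mul,
      inv_mul_cancel₀ hF, map_one, map_one]
  have hmul : ∀ S a b, a ∈ S → b ∈ S → KD.rel S T {a * b} := by
    intro S a b ha hb
    apply adjoinCost_rel
    have : φ (a * b) = (φ a * φ b) %ₘ cyc A ℓ (ℓ ^ κ) := by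
      rw [← AdjoinRoot.modByMonicHom_mk hQm, map_mul (AdjoinRoot.mk _),
        AdjoinRoot.mk_leftInverse, AdjoinRoot.mk_leftInverse]
    rw [← hφ, this]
    exact h _ _ _ ⟨a, ha, rfl⟩ ⟨b, hb, rfl⟩ (degree_modByMonicHom_lt hpos hNκ a)
      (degree_modByMonicHom_lt hpos hNκ b)
  -- The factors become polynomials in a new variable standing for `X ^ ℓ ^ r₂`, with blocks of
  -- length `ℓ ^ r₂` as coefficients.
  set f := bivariate (ℓ ^ r₂) n a with hf
  set g := bivariate (ℓ ^ r₂) n b with hg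
  have hnle : n ≤ ℓ * ℓ ^ r := Nat.mul_le_mul_right _ (Nat.sub_le _ _)
  have hdeg_map : ∀ p : A[X],
      ((bivariate (ℓ ^ r₂) n p).map (AdjoinRoot.mk Q)).degree < (ℓ * ℓ ^ r : ℕ) := fun p =>
    degree_map_le.trans_lt ((degree_bivariate_lt _ _ _).trans_le (by exact_mod_cast hnle))
  obtain ⟨H, hHd, hHdvd, hHc⟩ := hK.exists_mul_mod_cyc hℓ hξ hι hmul hr (hdeg_map a) (hdeg_map b)
  have hHc' := KD.poly.andThen hHc (modByMonic_cyc_cost hK.zero hK.sub hpos hn₁ (p := H)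
    (by simp) hHd)
  set P := (f * g) %ₘ cyc A[X] ℓ (ℓ ^ r) with hP
  have hmap : H %ₘ cyc (AdjoinRoot Q) ℓ (ℓ ^ r) = P.map (AdjoinRoot.mk Q) := by
    rw [hP, map_modByMonic _ (monic_cyc hpos hn₁), map_cyc, Polynomial.map_mul]
    exact (modByMonic_eq_of_dvd_sub (monic_cyc hpos hn₁) hHdvd).symm
  -- Products of two blocks have degree below `2 * ℓ ^ r₂`. Reduction in the outer variable forms
  -- only integer combinations of them, so the bound survives.
  have hPdeg : ∀ i, (P.coeff i).degree < (2 * ℓ ^ r₂ : ℕ) := by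
    intro i
    rw [← mem_degreeLT]
    refine coeff_modByMonic_cyc_mem hpos hn₁ (degreeLT A (2 * ℓ ^ r₂)).toAddSubgroup ?_ i
    intro j
    rw [coeff_mul]
    refine AddSubgroup.sum_mem _ fun x _ => ?_
    rw [Submodule.mem_toAddSubgroup, mem_degreeLT, two_mul]
    exact degree_mul_lt_add (degree_coeff_bivariate_lt _ _ _ _) (degree_coeff_bivariate_lt _ _ _ _)
  have hPd : P.degree < n := degree_modByMonic_cyc_lt hpos hn₁ _
  -- By `hκ` the degrees lie below that of `Q`, so the product computed modulo `Q` is the true one.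
  have hlift : ∀ i, φ ((P.map (AdjoinRoot.mk Q)).coeff i) = P.coeff i := by
    intro i
    rw [coeff_map, hφ, AdjoinRoot.modByMonicHom_mk]
    rw [modByMonic_eq_self_iff hQm, hQ, degree_cyc hpos hNκ]
    exact (hPdeg i).trans_le (by exact_mod_cast hκ)
  rw [hmap, CostRel.poly_rel] at hHc'
  have c0 : (arith F A).poly.rel S 0 (⋃ d ∈ ⋃ p ∈ ({f.map (AdjoinRoot.mk Q),
      g.map (AdjoinRoot.mk Q)} : Set (AdjoinRoot Q)[X]), Set.range p.coeff, {φ d}) := by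
    have key : ∀ p ∈ S, ∀ j i, (φ (((bivariate (ℓ ^ r₂) n p).map (AdjoinRoot.mk Q)).coeff j)).coeff i
        = 0 ∨ ∃ q ∈ S, ∃ l, (φ (((bivariate (ℓ ^ r₂) n p).map
          (AdjoinRoot.mk Q)).coeff j)).coeff i = q.coeff l := by
      intro p hp j i
      have : φ (((bivariate (ℓ ^ r₂) n p).map (AdjoinRoot.mk Q)).coeff j) =
          (bivariate (ℓ ^ r₂) n p).coeff j := by
        rw [coeff_map, hφ, AdjoinRoot.modByMonicHom_mk, modByMonic_eq_self_iff hQm, hQ,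
          degree_cyc hpos hNκ]
        refine (degree_coeff_bivariate_lt _ _ _ _).trans_le ?_
        exact_mod_cast (by omega : ℓ ^ r₂ ≤ (ℓ - 1) * ℓ ^ κ)
      rw [this, coeff_bivariate]
      split_ifs
      · rw [coeff_polyBlock]
        split_ifs
        · exact .inr ⟨p, hp, _, rfl⟩
        · exact .inl rfl
      · exact .inl (coeff_zero i)
    refine poly_rel_free ?_
    intro p hp i
    simp only [Set.mem_iUnion] at hp
    obtain ⟨d, ⟨q, hq, j, rfl⟩, rfl⟩ := hp
    rcases hq with rfl | rfl
    · exact key a ha j i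
    · exact key b hb j i
  have c1 := (arith F A).poly.andThen c0 ((arith F A).poly.mono_src Set.subset_union_right hHc')
  -- A coefficient of `P` is twice as long as a block. Its lower and upper halves are glued
  -- separately, which is free, and overlap in a single addition.
  set lo := glue (ℓ ^ r₂) n (fun i => polyBlock (ℓ ^ r₂) 0 (P.coeff i)) with hlo
  set hi := glue (ℓ ^ r₂) n (fun i => polyBlock (ℓ ^ r₂) 1 (P.coeff i)) with hhi
  have hglue : ∀ s, (glue (ℓ ^ r₂) n (fun i => polyBlock (ℓ ^ r₂) s (P.coeff i))).degree <
      (n * ℓ ^ r₂ : ℕ) := fun s => degree_glue_lt hn₂ fun _ _ => degree_polyBlock_lt _ _ _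
  have hbound : n * ℓ ^ r₂ + ℓ ^ r₂ ≤ ℓ * ℓ ^ (r + r₂) := by
    rw [← hnN]
    obtain ⟨l, rfl⟩ : ∃ l, ℓ = l + 1 := ⟨ℓ - 1, by omega⟩
    rw [Nat.add_sub_cancel, Nat.add_mul, Nat.one_mul]
    exact Nat.add_le_add_left (Nat.pow_le_pow_right hpos (by omega)) _
  have hlod : lo.degree < (ℓ * ℓ ^ (r + r₂) : ℕ) :=
    (hglue 0).trans_le (by exact_mod_cast (by omega : n * ℓ ^ r₂ ≤ ℓ * ℓ ^ (r + r₂)))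
  have hhid : degree (X ^ ℓ ^ r₂ * hi) < ((ℓ * ℓ ^ (r + r₂) : ℕ) : WithBot ℕ) := by
    rw [degree_lt_iff_coeff_zero]
    intro i hi'
    rw [coeff_X_pow_mul', if_pos (by omega), (degree_lt_iff_coeff_zero _ _).mp (hglue 1)]
    omega
  have hE : P.eval (X ^ ℓ ^ r₂) = lo + X ^ ℓ ^ r₂ * hi := by
    rw [hlo, hhi, glue, glue, Finset.mul_sum, ← Finset.sum_add_distrib]
    conv_lhs => rw [eq_sum_of_degree_lt hPd]
    rw [eval_finsetSum]
    refine Finset.sum_congr rfl fun i _ => ?_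
    conv_lhs => rw [← glue_polyBlock (n := 2) hn₂ (hPdeg i)]
    simp only [glue, Finset.sum_range_succ, Finset.sum_range_zero, eval_mul, eval_C, eval_pow,
      eval_X]
    ring
  have hmod : (a * b) %ₘ cyc A ℓ (ℓ ^ (r + r₂)) =
      (lo + X ^ ℓ ^ r₂ * hi) %ₘ cyc A ℓ (ℓ ^ (r + r₂)) := by
    refine modByMonic_eq_of_dvd_sub (monic_cyc hpos hN) ?_
    have e1 := modByMonic_add_div (f * g) (cyc A[X] ℓ (ℓ ^ r))
    have e2 := congrArg (fun p => p.eval (X ^ ℓ ^ r₂)) e1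
    simp only [eval_add, eval_mul] at e2
    rw [← hP, hE, hf, hg, eval_bivariate hn₂ hda, eval_bivariate hn₂ hdb] at e2
    -- Undoing the substitution turns the outer modulus into the wanted one.
    have e3 : (cyc A[X] ℓ (ℓ ^ r)).eval (X ^ ℓ ^ r₂) = cyc A ℓ (ℓ ^ (r + r₂)) := by
      simp only [cyc, eval_finsetSum, eval_pow, eval_X, ← pow_mul]
      refine Finset.sum_congr rfl fun t _ => ?_
      congr 1
      rw [pow_add]; ring
    rw [e3] at e2
    exact ⟨_, by rw [← e2, add_sub_cancel_left]⟩
  have c2 := (arith F A).poly.andThen c1 (poly_rel_free (n := 0)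
    (T := {lo} ∪ {X ^ ℓ ^ r₂ * hi}) (by
      have hmem : ∀ i, P.coeff i ∈ S ∪ ⋃ d ∈ ⋃ p ∈ ({P.map (AdjoinRoot.mk Q)} :
          Set (AdjoinRoot Q)[X]), Set.range p.coeff, {φ d} := by
        intro i
        right
        simp only [Set.mem_iUnion]
        exact ⟨_, ⟨_, rfl, i, rfl⟩, (hlift i).symm⟩
      have key : ∀ s i, (glue (ℓ ^ r₂) n (fun i => polyBlock (ℓ ^ r₂) s (P.coeff i))).coeff i = 0 ∨
          ∃ j l, (glue (ℓ ^ r₂) n (fun i => polyBlock (ℓ ^ r₂) s (P.coeff i))).coeff i =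
            (P.coeff j).coeff l := by
        intro s i
        rw [coeff_glue hn₂ fun _ _ => degree_polyBlock_lt _ _ _]
        split_ifs
        · rw [coeff_polyBlock]
          split_ifs
          · exact .inr ⟨_, _, rfl⟩
          · exact .inl rfl
        · exact .inl rfl
      rintro p (rfl | rfl) i
      · rcases key 0 i with h1 | ⟨j, l, h1⟩
        · exact .inl h1
        · exact .inr ⟨_, hmem j, l, h1⟩
      · rw [coeff_X_pow_mul']
        split_ifs
        · rcases key 1 (i - ℓ ^ r₂) with h1 | ⟨j, l, h1⟩
          · exact .inl h1
          · exact .inr ⟨_, hmem j, l, h1⟩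
        · exact .inl rfl))
  have c3 := (arith F A).poly.andThen c2 (poly_rel_add (p := lo) (q := X ^ ℓ ^ r₂ * hi)
    (by simp) (by simp) hlod hhid)
  have c4 := (arith F A).poly.andThen c3 (modByMonic_cyc_cost arith_zero (w := 1)
    (fun S a b => arith_sub) hpos hN (p := lo + X ^ ℓ ^ r₂ * hi) (by simp)
    ((degree_add_le _ _).trans_lt (max_lt hlod hhid)))
  rw [hmod]
  refine (arith F A).poly.mono_cost (le_of_eq ?_) c4
  ring

end Adjoin

/-! ### Solving the recursion: multiplication in `O(n log n log log n)` over any field -/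

section FastMul

variable {F A : Type*} [Field F] [CommRing A] [Algebra F A] {ℓ : ℕ}

lemma MulCost.mono {k T T' : ℕ} (hT : T ≤ T') (h : MulCost F A ℓ k T) : MulCost F A ℓ k T' :=
  fun S a b ha hb hda hdb => (arith F A).poly.mono_cost hT (h S a b ha hb hda hdb)

/-- The normalized cost of multiplication modulo `cyc A ℓ (ℓ ^ k)`. -/
def mulRate (u : ℕ) : ℕ := 2000 * u * (Nat.log 2 u + 1) + 60

/-- The recurrence behind the double logarithm: `u` is the logarithm of the length, and halving it
twice-fold with a linear extra cost gives `u log u`. The numbers `228` and `359` are those of radix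
`3`, which exceed those of radix `2`. -/
lemma mulRate_half {u r : ℕ} (hu : 0 < u) (hr : 2 * r ≤ u + 3) :
    2 * mulRate (u / 2) + 228 * r + 359 ≤ mulRate u := by
  unfold mulRate
  rcases Nat.lt_or_ge u 2 with h | h
  · obtain rfl : u = 1 := by omega
    simp
    omega
  · have hlog : Nat.log 2 (u / 2) + 1 = Nat.log 2 u := by
      rw [Nat.log_div_base]
      have : 0 < Nat.log 2 u := Nat.log_pos (by norm_num) h
      omega
    rw [hlog]
    have h1 : 2000 * (u / 2) * Nat.log 2 u ≤ 1000 * u * Nat.log 2 u := by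
      apply Nat.mul_le_mul_right
      omega
    have h2 : 2000 * u * (Nat.log 2 u + 1) = 2 * (1000 * u * Nat.log 2 u) + 2000 * u := by ring
    omega

lemma mulCost_fast [Nontrivial A] {δ : ℕ} (hℓ : ℓ = 2 ∧ δ = 1 ∨ ℓ = 3 ∧ δ = 0)
    (hF : (ℓ : F) ≠ 0) (u : ℕ) :
    MulCost F A ℓ (u + 2 * δ + 1) (ℓ ^ (u + 2 * δ + 1) * mulRate u) := by
  induction u using Nat.strong_induction_on with
  | _ u ih =>
  have hℓ' : ℓ = 2 ∨ ℓ = 3 := by omega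
  rcases Nat.eq_zero_or_pos u with rfl | hu
  -- The summand `60` of `mulRate` is the schoolbook cost `180` at radix `3` divided by `3`. Radix
  -- `2` needs only `384 / 8 = 48`.
  · refine (mulCost_naive (by omega) _).mono ?_
    rcases hℓ with ⟨rfl, rfl⟩ | ⟨rfl, rfl⟩ <;> norm_num [mulRate]
  · set k := u + 2 * δ + 1 with hk
    set r := k / 2 with hr
    set r₂ := k - r with hr₂
    -- The offset `2 * δ + 1` is a fixed point of the recursion: passing from `k` to `r₂ + δ`, with
    -- `r₂` the larger half of `k`, replaces `u` by exactly `u / 2`.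
    set κ := u / 2 + 2 * δ + 1 with hκ
    have hκr : κ = r₂ + δ := by omega
    have hkr : k = r + r₂ := by omega
    have h1 := (ih (u / 2) (by omega)).step (r := r) (r₂ := r₂) hℓ' hF (by omega) (by
      -- The room for products of blocks, `2 * ℓ ^ r₂ ≤ (ℓ - 1) * ℓ ^ (r₂ + δ)`, is an equality for
      -- both radices; this determines `δ`.
      rw [← hκ, hκr, pow_add]
      rcases hℓ with ⟨rfl, hδ⟩ | ⟨rfl, hδ⟩ <;> rw [hδ] <;> norm_num
      omega)
    rw [hkr]
    refine h1.mono ?_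
    have hrate := mulRate_half (u := u) (r := r) hu (by omega)
    have hX : ℓ ^ r * ℓ ^ κ = ℓ ^ δ * ℓ ^ (r + r₂) := by
      rw [← pow_add, ← pow_add]; congr 1; omega
    generalize mulRate (u / 2) = t at hrate
    rw [← hκ]
    rcases hℓ with ⟨rfl, hδ⟩ | ⟨rfl, hδ⟩ <;> rw [hδ] at hX
    · have e1 : (2 - 1) * (2 ^ r * (2 ^ κ * t) + r * ((6 * 2 + 1) * 2 ^ r * (2 * (2 * 2 ^ κ)))) +
          (6 * 2 + 1) * (2 * 2 ^ r) * (2 * (2 * 2 ^ κ)) + (2 - 1) * 2 ^ r * (2 * (2 * 2 ^ κ)) +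
          2 * 2 ^ (r + r₂) + (2 - 1) * 2 ^ (r + r₂) =
          (2 ^ r * 2 ^ κ) * (t + 52 * r + 108) + 3 * 2 ^ (r + r₂) := by norm_num; ring
      rw [e1, hX]
      calc _ = 2 ^ (r + r₂) * (2 * t + 104 * r + 219) := by ring
        _ ≤ _ := Nat.mul_le_mul_left _ (by omega)
    · have e1 : (3 - 1) * (3 ^ r * (3 ^ κ * t) + r * ((6 * 3 + 1) * 3 ^ r * (2 * (3 * 3 ^ κ)))) +
          (6 * 3 + 1) * (3 * 3 ^ r) * (2 * (3 * 3 ^ κ)) + (3 - 1) * 3 ^ r * (2 * (3 * 3 ^ κ)) +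
          3 * 3 ^ (r + r₂) + (3 - 1) * 3 ^ (r + r₂) =
          (3 ^ r * 3 ^ κ) * (2 * t + 228 * r + 354) + 5 * 3 ^ (r + r₂) := by norm_num; ring
      rw [e1, hX]
      calc _ = 3 ^ (r + r₂) * (2 * t + 228 * r + 359) := by ring
        _ ≤ _ := Nat.mul_le_mul_left _ (by omega)

lemma mulRate_mono {u v : ℕ} (h : u ≤ v) : mulRate u ≤ mulRate v := by
  unfold mulRate
  have := Nat.log_mono_right (b := 2) h
  gcongr

/-- Fast multiplication of polynomials over an algebra over a field. -/
lemma poly_rel_mul {S : Set A[X]} {p q : A[X]} (j : ℕ) (hp : p ∈ S) (hq : q ∈ S)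
    (hdp : p.degree < (2 ^ j : ℕ)) (hdq : q.degree < (2 ^ j : ℕ)) :
    (arith F A).poly.rel S (2 ^ j * (8 * mulRate j)) {p * q} := by
  rcases subsingleton_or_nontrivial A with hA | hA
  · rw [Subsingleton.elim (p * q) 0]
    exact poly_rel_zero _
  have key : ∀ (ℓ k T : ℕ), 0 < ℓ → MulCost F A ℓ k T → 2 * 2 ^ j ≤ (ℓ - 1) * ℓ ^ k →
      T ≤ 2 ^ j * (8 * mulRate j) →
      (arith F A).poly.rel S (2 ^ j * (8 * mulRate j)) {p * q} := by
    intro ℓ k T hℓ hM hk hT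
    have hle : ((2 ^ j : ℕ) : WithBot ℕ) ≤ ((ℓ - 1) * ℓ ^ k : ℕ) := by
      exact_mod_cast (by omega : 2 ^ j ≤ (ℓ - 1) * ℓ ^ k)
    have h1 := hM S p q hp hq (hdp.trans_le hle) (hdq.trans_le hle)
    rw [(modByMonic_eq_self_iff (monic_cyc hℓ (by positivity))).mpr] at h1
    · exact (arith F A).poly.mono_cost hT h1
    · rw [degree_cyc hℓ (by positivity)]
      refine (degree_mul_lt_add hdp hdq).trans_le ?_
      exact_mod_cast (by omega : 2 ^ j + 2 ^ j ≤ (ℓ - 1) * ℓ ^ k)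
  -- Where `2` vanishes, `3 = 1` is invertible, so one of the two radices is always available. The
  -- exponent is chosen so that the modulus has degree at least that of a full product and no
  -- reduction takes place.
  by_cases h2 : (2 : F) = 0
  · have h3 : ((3 : ℕ) : F) ≠ 0 := by
      have : ((3 : ℕ) : F) = 2 + 1 := by norm_num
      rw [this, h2, zero_add]
      exact one_ne_zero
    set u := Nat.log 3 (2 ^ j) with hu
    have hu1 : 3 ^ u ≤ 2 ^ j := Nat.pow_log_le_self 3 (by positivity)
    have hu2 : 2 ^ j < 3 ^ (u + 1) := Nat.lt_pow_succ_log_self (by norm_num) _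
    have huj : u ≤ j := by
      have : 2 ^ u ≤ 2 ^ j := (Nat.pow_le_pow_left (by norm_num) u).trans hu1
      exact (Nat.pow_le_pow_iff_right (by norm_num)).mp this
    refine key 3 _ _ (by norm_num) (mulCost_fast (.inr ⟨rfl, rfl⟩) h3 u) ?_ ?_
    · simp only [Nat.mul_zero, Nat.add_zero]
      omega
    · simp only [Nat.mul_zero, Nat.add_zero, pow_succ]
      calc 3 ^ u * 3 * mulRate u ≤ 2 ^ j * 8 * mulRate j := by
            gcongr
            · norm_num
            · exact mulRate_mono huj
        _ = _ := by ring
  · refine key 2 _ _ (by norm_num) (mulCost_fast (.inl ⟨rfl, rfl⟩) (by exact_mod_cast h2) j) ?_ ?_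
    · simp only [Nat.mul_one, pow_succ]
      omega
    · simp only [Nat.mul_one, pow_succ]
      apply le_of_eq
      ring

end FastMul

/-! ### Power series inversion -/

section Inverse

variable {F A : Type*} [Field F] [CommRing A] [Algebra F A] {S : Set A[X]} {p q : A[X]}

/-- A bound for the cost per coefficient of multiplying polynomials of degree less than `2 ^ k`. -/
def mulTime (k : ℕ) : ℕ := 8 * mulRate k

lemma poly_rel_mul_of_le {j k : ℕ} (hjk : j ≤ k) (hp : p ∈ S) (hq : q ∈ S)
    (hdp : p.degree < (2 ^ j : ℕ)) (hdq : q.degree < (2 ^ j : ℕ)) :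
    (arith F A).poly.rel S (2 ^ j * mulTime k) {p * q} :=
  (arith F A).poly.mono_cost
    (Nat.mul_le_mul_left _ (Nat.mul_le_mul_left _ (mulRate_mono hjk))) (poly_rel_mul j hp hq hdp hdq)

lemma poly_rel_const (c : F) (n : ℕ) : (arith F A).poly.rel S n {C (algebraMap F A c)} := by
  refine arith_const fun x hx => ?_
  simp only [Set.mem_singleton_iff, Set.iUnion_iUnion_eq_left, Set.mem_range] at hx
  obtain ⟨i, rfl⟩ := hx
  right
  rw [coeff_C]
  split_ifs
  · exact ⟨c, rfl⟩
  · exact ⟨0, map_zero _⟩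

lemma poly_rel_polyBlock (h u : ℕ) (hp : p ∈ S) : (arith F A).poly.rel S 0 {polyBlock h u p} := by
  refine poly_rel_free ?_
  rintro _ rfl i
  rw [coeff_polyBlock]
  split_ifs
  · exact .inr ⟨p, hp, _, rfl⟩
  · exact .inl rfl

lemma X_pow_dvd_sub_polyBlock (n : ℕ) (p : A[X]) : X ^ n ∣ p - polyBlock n 0 p := by
  rw [X_pow_dvd_iff]
  intro d hd
  rw [coeff_sub, coeff_polyBlock, if_pos hd]
  simp

/-- Inversion of a power series by Newton iteration. -/
lemma exists_inverse {G : A[X]} (hG : G ∈ S) (h0 : G.coeff 0 = 1) {j k : ℕ} (hjk : j ≤ k) :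
    ∃ H : A[X], H.degree < (2 ^ j : ℕ) ∧ X ^ 2 ^ j ∣ G * H - 1 ∧
      (arith F A).poly.rel S (2 ^ j * (4 * mulTime k + 2)) {H} := by
  induction j with
  | zero =>
    refine ⟨1, degree_one_le.trans_lt ?_, ?_, ?_⟩
    · rw [pow_zero]; exact_mod_cast Nat.one_pos
    · rw [pow_zero, X_pow_dvd_iff]
      intro d hd
      obtain rfl : d = 0 := by omega
      simp [h0]
    · have := poly_rel_const (A := A) (S := S) (1 : F) (2 ^ 0 * (4 * mulTime k + 2))
      rwa [map_one, C_1] at this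
  | succ j ih =>
    obtain ⟨H, hHd, ⟨Z, hZ⟩, hHc⟩ := ih (by omega)
    set n := 2 ^ (j + 1) with hn
    have hn2 : n = 2 ^ j + 2 ^ j := by rw [hn, pow_succ]; ring
    have hj := Nat.two_pow_pos j
    have hHd' : H.degree < (n : ℕ) :=
      hHd.trans_le (by exact_mod_cast (by omega : 2 ^ j ≤ n))
    set G' := polyBlock n 0 G with hG'
    set E := polyBlock n 0 (G' * H) with hE
    have hCd : (C (algebraMap F A 2)).degree < (n : ℕ) := by
      refine degree_C_le.trans_lt ?_
      exact_mod_cast (by positivity : 0 < n)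
    have hDd : (C (algebraMap F A 2) - E).degree < (n : ℕ) :=
      (degree_sub_le _ _).trans_lt (max_lt hCd (degree_polyBlock_lt _ _ _))
    refine ⟨polyBlock n 0 (H * (C (algebraMap F A 2) - E)), degree_polyBlock_lt _ _ _, ?_, ?_⟩
    · obtain ⟨a, ha⟩ := X_pow_dvd_sub_polyBlock n G
      obtain ⟨b, hb⟩ := X_pow_dvd_sub_polyBlock n (G' * H)
      obtain ⟨c, hc⟩ := X_pow_dvd_sub_polyBlock n (H * (C (algebraMap F A 2) - E))
      rw [← hG'] at ha
      rw [← hE] at hb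
      have h2 : C (algebraMap F A 2) = (2 : A[X]) := by rw [map_ofNat, map_ofNat]
      have hX : (X : A[X]) ^ n = X ^ 2 ^ j * X ^ 2 ^ j := by rw [hn2, pow_add]
      -- Newton's identity `G * H * (2 - G * H) - 1 = -(G * H - 1) ^ 2` squares the error `X ^ 2 ^ j
      -- * Z`. The terms in `a`, `b`, `c` account for truncating `G`, the product `G' * H` and the
      -- result.
      refine ⟨-Z ^ 2 + G * H * b + G * H * (a * H) - G * c, ?_⟩
      rw [h2] at hc ⊢
      linear_combination (-G) * hc + G * H * hb + G * H * H * ha -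
        (G * H - 1 + X ^ 2 ^ j * Z) * hZ + Z ^ 2 * hX
    · have K := (arith F A).poly.union (poly_rel_polyBlock (F := F) n 0 hG) hHc
      have c1 := K
      have c2 := (arith F A).poly.trans c1 (poly_rel_mul_of_le (j := j + 1) hjk (p := G') (q := H)
        (by simp [hG']) (by simp) (degree_polyBlock_lt _ _ _) hHd')
      have c3 := (arith F A).poly.trans c2 (poly_rel_polyBlock n 0 (p := G' * H) (by simp))
      have c4 := (arith F A).poly.trans c3 (poly_rel_const (2 : F) 0)
      have c5 := (arith F A).poly.trans c4 (poly_rel_sub (h := n) (p := C (algebraMap F A 2))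
        (q := E) (by simp) (by simp [hE]) hCd (degree_polyBlock_lt _ _ _))
      have c6 := (arith F A).poly.trans c5 (poly_rel_mul_of_le (j := j + 1) hjk (p := H)
        (q := C (algebraMap F A 2) - E) (by simp) (by simp) hHd' hDd)
      have c7 := (arith F A).poly.andThen c6 (poly_rel_polyBlock n 0
        (p := H * (C (algebraMap F A 2) - E)) (by simp))
      refine (arith F A).poly.mono_cost (le_of_eq ?_) c7
      rw [hn, pow_succ]
      ring

end Inverse

/-! ### Subproduct trees -/

section Tree

variable {F A : Type*} [Field F] [CommRing A] [Algebra F A]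

/-- The product of the factors `1 - x t * X` with `t ∈ I`. -/
noncomputable def linProd (x : ℕ → A) (I : Finset ℕ) : A[X] := ∏ t ∈ I, (1 - C (x t) * X)

/-- The numerator of `∑ t ∈ I, c t / (1 - x t * X)`. -/
noncomputable def numer (x c : ℕ → A) (I : Finset ℕ) : A[X] :=
  ∑ t ∈ I, C (c t) * linProd x (I.erase t)

/-- The `s`-th interval of length `2 ^ i`. -/
def dyadic (i s : ℕ) : Finset ℕ := Finset.Ico (s * 2 ^ i) ((s + 1) * 2 ^ i)

lemma card_dyadic (i s : ℕ) : (dyadic i s).card = 2 ^ i := by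
  rw [dyadic, Nat.card_Ico, ← Nat.sub_mul]
  simp

lemma dyadic_zero (s : ℕ) : dyadic 0 s = {s} := by
  simp [dyadic]

lemma dyadic_succ (i s : ℕ) : dyadic (i + 1) s = dyadic i (2 * s) ∪ dyadic i (2 * s + 1) := by
  rw [dyadic, dyadic, dyadic, Finset.Ico_union_Ico_eq_Ico]
  · congr 1 <;> ring
  · gcongr; omega
  · gcongr; omega

lemma disjoint_dyadic {i s s' : ℕ} (h : s ≠ s') : Disjoint (dyadic i s) (dyadic i s') := by
  rw [Finset.disjoint_left]
  intro t ht ht'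
  simp only [dyadic, Finset.mem_Ico] at ht ht'
  have h1 := lt_of_mul_lt_mul_right (ht.1.trans_lt ht'.2) (Nat.zero_le _)
  have h2 := lt_of_mul_lt_mul_right (ht'.1.trans_lt ht.2) (Nat.zero_le _)
  omega

/-- The other half of the interval of length `2 ^ (i + 1)` containing the `s`-th of length
`2 ^ i`. -/
def sibling (s : ℕ) : ℕ := if s % 2 = 0 then s + 1 else s - 1

lemma dyadic_half (i s : ℕ) : dyadic (i + 1) (s / 2) = dyadic i s ∪ dyadic i (sibling s) := by
  rw [dyadic_succ, sibling]
  split_ifs with h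
  · rw [show 2 * (s / 2) = s by omega]
  · rw [show 2 * (s / 2) + 1 = s by omega, show 2 * (s / 2) = s - 1 by omega, Finset.union_comm]

lemma sibling_ne (s : ℕ) : s ≠ sibling s := by
  unfold sibling; split_ifs <;> omega

lemma sibling_lt {s d : ℕ} (h : s < 2 ^ (d + 1)) : sibling s < 2 ^ (d + 1) := by
  rw [pow_succ] at *
  unfold sibling; split_ifs <;> omega

variable {x c : ℕ → A}

lemma linProd_union {I J : Finset ℕ} (h : Disjoint I J) :
    linProd x (I ∪ J) = linProd x I * linProd x J := Finset.prod_union h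

lemma erase_union_left {I J : Finset ℕ} (h : Disjoint I J) {t : ℕ} (ht : t ∈ I) :
    (I ∪ J).erase t = I.erase t ∪ J := by
  rw [Finset.erase_union_distrib, Finset.erase_eq_of_notMem (Finset.disjoint_left.mp h ht)]

lemma linProd_erase_union {I J : Finset ℕ} (h : Disjoint I J) {t : ℕ} (ht : t ∈ I) :
    linProd x ((I ∪ J).erase t) = linProd x (I.erase t) * linProd x J := by
  rw [erase_union_left h ht, linProd_union (h.mono_left (Finset.erase_subset _ _))]

lemma linProd_erase_mul {I : Finset ℕ} {t : ℕ} (ht : t ∈ I) :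
    linProd x (I.erase t) * (1 - C (x t) * X) = linProd x I := Finset.prod_erase_mul _ _ ht

lemma numer_union {I J : Finset ℕ} (h : Disjoint I J) :
    numer x c (I ∪ J) = numer x c I * linProd x J + linProd x I * numer x c J := by
  rw [numer, Finset.sum_union h, numer, numer, Finset.sum_mul, Finset.mul_sum]
  congr 1
  · refine Finset.sum_congr rfl fun t ht => ?_
    rw [linProd_erase_union h ht, mul_assoc]
  · refine Finset.sum_congr rfl fun t ht => ?_
    rw [Finset.union_comm, linProd_erase_union h.symm ht]
    ring

lemma degree_lin_lt (a : A) : degree (1 - C a * X) < ((2 : ℕ) : WithBot ℕ) := by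
  refine (degree_sub_le _ _).trans_lt (max_lt ?_ ?_)
  · exact degree_one_le.trans_lt (by exact_mod_cast Nat.two_pos)
  · exact (degree_C_mul_X_le a).trans_lt (by exact_mod_cast Nat.one_lt_two)

lemma natDegree_linProd_le (x : ℕ → A) (I : Finset ℕ) : (linProd x I).natDegree ≤ I.card := by
  refine (natDegree_prod_le _ _).trans ?_
  rw [Finset.card_eq_sum_ones]
  refine Finset.sum_le_sum fun t _ => ?_
  have := degree_lin_lt (x t)
  rw [natDegree_le_iff_coeff_eq_zero]
  exact fun i hi => (degree_lt_iff_coeff_zero _ _).mp this i hi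

lemma degree_linProd_lt {I : Finset ℕ} {n : ℕ} (h : I.card < n) : (linProd x I).degree < n :=
  degree_le_natDegree.trans_lt (by exact_mod_cast (natDegree_linProd_le x I).trans_lt h)

lemma degree_numer_lt (I : Finset ℕ) : (numer x c I).degree < I.card := by
  rw [degree_lt_iff_coeff_zero]
  intro i hi
  rw [numer, finsetSum_coeff]
  refine Finset.sum_eq_zero fun t ht => ?_
  have : (linProd x (I.erase t)).degree < I.card :=
    degree_linProd_lt (by rw [Finset.card_erase_of_mem ht]; have := Finset.card_pos.mpr ⟨t, ht⟩; omega)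
  exact (degree_lt_iff_coeff_zero _ _).mp (degree_C_mul_lt _ this) i hi

variable {S : Set A[X]} {k : ℕ}

/-- On each level the lengths of the products add up to `2 ^ k`, so each level costs about one
multiplication of that length. All nodes are kept, since both later passes reuse them. -/
lemma linProd_dyadic_cost (hx : ∀ t < 2 ^ k, C (x t) ∈ S) {i : ℕ} (hi : i ≤ k) :
    (arith F A).poly.rel S (2 ^ k * 2 + i * (2 ^ k * mulTime k))
      {P | ∃ j ≤ i, ∃ s < 2 ^ (k - j), P = linProd x (dyadic j s)} := by
  induction i with
  | zero =>
    have h1 := (arith F A).poly.biUnion (S := S) (Finset.range (2 ^ k))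
      (fun s => {linProd x (dyadic 0 s)}) 2 (by
        intro s hs
        have : linProd x (dyadic 0 s) = C (algebraMap F A 1) - C (x s) * X := by
          simp [linProd, dyadic_zero]
        rw [this]
        refine poly_rel_of_coeff (h := 2) (v := 1) arith_zero
          (by simpa using degree_lin_lt (x s)) fun i hi => ?_
        interval_cases i
        · refine arith_const ?_
          rintro _ rfl
          right
          exact ⟨1, by simp⟩
        · have : (C (algebraMap F A 1) - C (x s) * X).coeff 1 = algebraMap F A 0 - (C (x s)).coeff 0 := by
            simp [coeff_one]
          rw [this]
          exact arith_const_sub 0 (coeff_mem_biUnion (hx s (by simpa using hs)) 0))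
    refine (arith F A).poly.mono subset_rfl (by simp) ?_ h1
    rintro P ⟨j, hj, s, hs, rfl⟩
    obtain rfl : j = 0 := by omega
    simp only [Set.mem_iUnion]
    exact ⟨s, by simpa using hs, rfl⟩
  | succ i ih =>
    have h1 := (arith F A).poly.biUnion
      (S := S ∪ {P | ∃ j ≤ i, ∃ s < 2 ^ (k - j), P = linProd x (dyadic j s)})
      (Finset.range (2 ^ (k - (i + 1))))
      (fun s => {linProd x (dyadic (i + 1) s)}) (2 ^ (i + 1) * mulTime k) (by
        intro s hs
        have hs' : s < 2 ^ (k - (i + 1)) := by simpa using hs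
        have h2 : 2 ^ (k - i) = 2 ^ (k - (i + 1)) * 2 := by
          rw [← pow_succ]; congr 1; omega
        rw [dyadic_succ, linProd_union (disjoint_dyadic (by omega))]
        have hc : ∀ s', (dyadic i s').card < 2 ^ (i + 1) := fun s' => by
          rw [card_dyadic]; exact Nat.pow_lt_pow_right (by norm_num) (by omega)
        exact poly_rel_mul_of_le hi (.inr ⟨i, le_rfl, 2 * s, by omega, rfl⟩)
          (.inr ⟨i, le_rfl, 2 * s + 1, by omega, rfl⟩) (degree_linProd_lt (hc _))
          (degree_linProd_lt (hc _)))
    refine (arith F A).poly.mono subset_rfl ?_ ?_ ((arith F A).poly.trans (ih (by omega)) h1)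
    · have e : 2 ^ (k - (i + 1)) * 2 ^ (i + 1) = 2 ^ k := by rw [← pow_add, Nat.sub_add_cancel hi]
      rw [Finset.card_range, ← e]
      apply le_of_eq; ring
    · rintro P ⟨j, hj, s, hs, rfl⟩
      rcases Nat.lt_or_ge i j with h | h
      · obtain rfl : j = i + 1 := by omega
        right
        simp only [Set.mem_iUnion]
        exact ⟨s, by simpa using hs, rfl⟩
      · exact .inl ⟨j, h, s, hs, rfl⟩

/-- Two neighbouring sums of fractions are put over a common denominator, with two products by nodes
of the tree and one addition. -/
lemma numer_dyadic_cost (hc : ∀ t < 2 ^ k, C (c t) ∈ S)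
    (hnode : ∀ j ≤ k, ∀ s < 2 ^ (k - j), linProd x (dyadic j s) ∈ S) {i : ℕ} (hi : i ≤ k) :
    (arith F A).poly.rel S (i * (2 ^ k * (2 * mulTime k + 1)))
      {P | ∃ s < 2 ^ (k - i), P = numer x c (dyadic i s)} := by
  induction i with
  | zero =>
    refine (arith F A).poly.of_subset' ?_
    rintro P ⟨s, hs, rfl⟩
    rw [dyadic_zero, numer, Finset.sum_singleton, Finset.erase_singleton, linProd,
      Finset.prod_empty, mul_one]
    exact hc s hs
  | succ i ih =>
    have h1 := (arith F A).poly.biUnion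
      (S := S ∪ {P | ∃ s < 2 ^ (k - i), P = numer x c (dyadic i s)})
      (Finset.range (2 ^ (k - (i + 1))))
      (fun s => {numer x c (dyadic (i + 1) s)}) (2 ^ (i + 1) * (2 * mulTime k + 1)) (by
        intro s hs
        have hs' : s < 2 ^ (k - (i + 1)) := by simpa using hs
        have h2 : 2 ^ (k - i) = 2 ^ (k - (i + 1)) * 2 := by
          rw [← pow_succ]; congr 1; omega
        have hlt : 2 ^ i < 2 ^ (i + 1) := Nat.pow_lt_pow_right (by norm_num) (by omega)
        have hdl : ∀ s', (linProd x (dyadic i s')).degree < (2 ^ (i + 1) : ℕ) := fun s' =>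
          degree_linProd_lt (by rw [card_dyadic]; exact hlt)
        have hdn' : ∀ s', (numer x c (dyadic i s')).degree < (2 ^ i : ℕ) := fun s' => by
          rw [← card_dyadic i s']
          exact degree_numer_lt _
        have hdn : ∀ s', (numer x c (dyadic i s')).degree < (2 ^ (i + 1) : ℕ) := fun s' =>
          (hdn' s').trans (by exact_mod_cast hlt)
        have hdm : ∀ s' s'', (numer x c (dyadic i s') * linProd x (dyadic i s'')).degree <
            (2 ^ (i + 1) : ℕ) := by
          intro s' s''
          rw [degree_lt_iff_coeff_zero]
          intro m hm
          rw [coeff_mul]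
          refine Finset.sum_eq_zero fun y hy => ?_
          have hy' : y.1 + y.2 = m := by simpa using hy
          rw [pow_succ] at hm
          by_cases h : 2 ^ i ≤ y.1
          · rw [(degree_lt_iff_coeff_zero _ _).mp (hdn' s') _ h, zero_mul]
          · have hd : (linProd x (dyadic i s'')).degree < (2 ^ i + 1 : ℕ) :=
              degree_linProd_lt (by rw [card_dyadic]; omega)
            rw [(degree_lt_iff_coeff_zero _ _).mp hd y.2 (by omega), mul_zero]
        rw [dyadic_succ, numer_union (disjoint_dyadic (by omega))]
        have c1 := poly_rel_mul_of_le (F := F)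
          (S := S ∪ {P | ∃ s < 2 ^ (k - i), P = numer x c (dyadic i s)}) hi
          (p := numer x c (dyadic i (2 * s))) (q := linProd x (dyadic i (2 * s + 1)))
          (.inr ⟨2 * s, by omega, rfl⟩) (.inl (hnode i (by omega) _ (by omega))) (hdn _) (hdl _)
        have c2 := poly_rel_mul_of_le (F := F)
          (S := S ∪ {P | ∃ s < 2 ^ (k - i), P = numer x c (dyadic i s)}) hi
          (p := linProd x (dyadic i (2 * s))) (q := numer x c (dyadic i (2 * s + 1)))
          (.inl (hnode i (by omega) _ (by omega))) (.inr ⟨2 * s + 1, by omega, rfl⟩) (hdl _) (hdn _)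
        have c3 := (arith F A).poly.andThen ((arith F A).poly.union c1 c2)
          (poly_rel_add (p := numer x c (dyadic i (2 * s)) * linProd x (dyadic i (2 * s + 1)))
            (q := linProd x (dyadic i (2 * s)) * numer x c (dyadic i (2 * s + 1)))
            (.inr (.inl rfl)) (.inr (.inr rfl)) (hdm (2 * s) (2 * s + 1))
            (by rw [mul_comm]; exact hdm (2 * s + 1) (2 * s)))
        exact (arith F A).poly.mono_cost (le_of_eq (by ring)) c3)
    refine (arith F A).poly.mono subset_rfl ?_ ?_ ((arith F A).poly.andThen (ih (by omega)) h1)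
    · have e : 2 ^ (k - (i + 1)) * 2 ^ (i + 1) = 2 ^ k := by rw [← pow_add, Nat.sub_add_cancel hi]
      rw [Finset.card_range, ← e]
      apply le_of_eq; ring
    · rintro P ⟨s, hs, rfl⟩
      simp only [Set.mem_iUnion]
      exact ⟨s, by simpa using hs, rfl⟩

/-- With `Q` this short, only the coefficients `d, …, 2 * d - 1` of `P` enter. The descent may
therefore halve its window at every level. -/
lemma coeff_polyBlock_one_mul {d : ℕ} (hd : 0 < d) (P : A[X]) {Q : A[X]} (hQ : Q.degree < d) :
    (polyBlock d 1 P * Q).coeff (d - 1) = (P * Q).coeff (2 * d - 1) := by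
  have hQ' := (degree_lt_iff_coeff_zero _ _).mp hQ
  rw [mul_comm, mul_comm P, coeff_mul, coeff_mul, Finset.Nat.sum_antidiagonal_eq_sum_range_succ_mk,
    Finset.Nat.sum_antidiagonal_eq_sum_range_succ_mk]
  have h1 : (2 * d - 1).succ = d + d := by omega
  have h2 : (d - 1).succ = d := by omega
  rw [h1, h2, Finset.sum_range_add]
  rw [Finset.sum_eq_zero (s := Finset.range d)
    (f := fun i => (Q.coeff (d + i)) * P.coeff (2 * d - 1 - (d + i)))
    (fun i _ => by rw [hQ' _ (by omega), zero_mul]), add_zero]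
  refine Finset.sum_congr rfl fun i hi => ?_
  have hi' : i < d := by simpa using hi
  rw [coeff_polyBlock, if_pos (by omega)]
  congr 2
  omega

/-- Going down a subproduct tree: from a window of `2 ^ k` coefficients at the root to the values
at the leaves. -/
lemma exists_descent (hnode : ∀ j ≤ k, ∀ s < 2 ^ (k - j), linProd x (dyadic j s) ∈ S)
    {W₀ : A[X]} (hW₀ : W₀ ∈ S) (hd₀ : W₀.degree < (2 ^ k : ℕ)) {d : ℕ} (hd : d ≤ k) :
    ∃ W : ℕ → A[X], (∀ s, (W s).degree < (2 ^ (k - d) : ℕ)) ∧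
      (∀ s < 2 ^ d, ∀ t ∈ dyadic (k - d) s,
        (W s * linProd x ((dyadic (k - d) s).erase t)).coeff (2 ^ (k - d) - 1) =
          (W₀ * linProd x ((dyadic k 0).erase t)).coeff (2 ^ k - 1)) ∧
      (arith F A).poly.rel S (d * (2 ^ k * (2 * mulTime k))) {P | ∃ s < 2 ^ d, P = W s} := by
  induction d with
  | zero =>
    refine ⟨fun _ => W₀, fun _ => by simpa using hd₀, ?_, ?_⟩
    · intro s hs t _
      obtain rfl : s = 0 := by simpa using hs
      simp
    · refine (arith F A).poly.of_subset' ?_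
      rintro P ⟨s, _, rfl⟩
      exact hW₀
  | succ d ih =>
    obtain ⟨W, hWd, hW, hWc⟩ := ih (by omega)
    obtain ⟨i, hi⟩ : ∃ i, k - d = i + 1 := ⟨k - d - 1, by omega⟩
    have hi' : k - (d + 1) = i := by omega
    rw [hi'] at *
    rw [hi] at hWd hW
    -- A child multiplies its parent's window by the sibling's node and keeps the upper half. The
    -- invariant is the top coefficient after multiplying by all remaining factors except that of
    -- `t`; at a leaf none remain.
    refine ⟨fun s => polyBlock (2 ^ i) 1 (W (s / 2) * linProd x (dyadic i (sibling s))),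
      fun s => degree_polyBlock_lt _ _ _, ?_, ?_⟩
    · intro s hs t ht
      have hdisj := disjoint_dyadic (i := i) (sibling_ne s)
      have ht' : t ∈ dyadic (i + 1) (s / 2) := by
        rw [dyadic_half]; exact Finset.mem_union_left _ ht
      have hs2 : s / 2 < 2 ^ d := by rw [pow_succ] at hs; omega
      have h1 := hW (s / 2) hs2 t ht'
      rw [dyadic_half, linProd_erase_union hdisj ht] at h1
      rw [coeff_polyBlock_one_mul (by positivity), ← h1]
      · rw [pow_succ, mul_comm 2]
        congr 1
        ring
      · refine degree_linProd_lt ?_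
        rw [Finset.card_erase_of_mem ht, card_dyadic]
        have : 0 < 2 ^ i := by positivity
        omega
    · have h1 := (arith F A).poly.biUnion
        (S := S ∪ {P | ∃ s < 2 ^ d, P = W s}) (Finset.range (2 ^ (d + 1)))
        (fun s => {polyBlock (2 ^ i) 1 (W (s / 2) * linProd x (dyadic i (sibling s)))})
        (2 ^ (i + 1) * mulTime k) (by
          intro s hs
          have hs' : s < 2 ^ (d + 1) := by simpa using hs
          have hs2 : s / 2 < 2 ^ d := by rw [pow_succ] at hs'; omega
          have c1 := poly_rel_mul_of_le (F := F) (S := S ∪ {P | ∃ s < 2 ^ d, P = W s}) (j := i + 1)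
            (k := k) (by omega) (p := W (s / 2)) (q := linProd x (dyadic i (sibling s)))
            (.inr ⟨_, hs2, rfl⟩)
            (.inl (hnode i (by omega) _ (by
              have : k - i = d + 1 := by omega
              rw [this]; exact sibling_lt hs')))
            (hWd _) (degree_linProd_lt (by
              rw [card_dyadic]; exact Nat.pow_lt_pow_right (by norm_num) (by omega)))
          have c2 := (arith F A).poly.andThen c1 (poly_rel_polyBlock (2 ^ i) 1 (.inr rfl))
          rwa [Nat.add_zero] at c2)
      refine (arith F A).poly.mono subset_rfl ?_ ?_ ((arith F A).poly.andThen hWc h1)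
      · have e : 2 ^ d * 2 ^ (i + 1) = 2 ^ k := by rw [← pow_add]; congr 1; omega
        rw [Finset.card_range, ← e]
        apply le_of_eq; ring
      · rintro P ⟨s, hs, rfl⟩
        simp only [Set.mem_iUnion]
        exact ⟨s, by simpa using hs, rfl⟩

end Tree

/-! ### Multipoint evaluation and interpolation -/

section Interpolation

variable {F A : Type*} [Field F] [CommRing A] [Algebra F A] {S : Set A[X]} {k : ℕ} {x : ℕ → A}

/-- Modulo `X ^ (m + 1)` the polynomial `Y` is `R / (1 - a * X)`, and the geometric series expresses
its coefficient as a value of the reversed `R`. -/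
lemma coeff_eq_sum_of_dvd (a : A) (Y R : A[X]) (m : ℕ)
    (h : X ^ (m + 1) ∣ (1 - C a * X) * Y - R) :
    Y.coeff m = ∑ e ∈ Finset.range (m + 1), R.coeff e * a ^ (m - e) := by
  have hc : ∀ d < m + 1, ((1 - C a * X) * Y).coeff d = R.coeff d := by
    intro d hd
    have := (X_pow_dvd_iff.mp h) d hd
    rwa [coeff_sub, sub_eq_zero] at this
  clear h
  induction m with
  | zero =>
    have := hc 0 (by omega)
    simpa [sub_mul, mul_assoc] using this
  | succ m ih =>
    have h1 := hc (m + 1) (by omega)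
    rw [sub_mul, one_mul, mul_assoc, coeff_sub, coeff_C_mul, coeff_X_mul] at h1
    rw [Finset.sum_range_succ, Nat.sub_self, pow_zero, mul_one, ← h1, ih fun d hd => hc d (by omega),
      Finset.mul_sum]
    have : ∀ e ∈ Finset.range (m + 1), R.coeff e * a ^ (m + 1 - e) =
        a * (R.coeff e * a ^ (m - e)) := by
      intro e he
      have : m + 1 - e = (m - e) + 1 := by
        have : e < m + 1 := by simpa using he
        omega
      rw [this, pow_succ]; ring
    rw [Finset.sum_congr rfl this]
    ring

lemma coeff_zero_linProd (x : ℕ → A) (I : Finset ℕ) : (linProd x I).coeff 0 = 1 := by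
  rw [coeff_zero_eq_eval_zero, linProd, eval_prod]
  simp

lemma dyadic_top (k : ℕ) : dyadic k 0 = Finset.range (2 ^ k) := by
  simp [dyadic]

/-- Evaluation of the reversed polynomial at all points of a subproduct tree. -/
lemma multipoint_cost (hnode : ∀ j ≤ k, ∀ s < 2 ^ (k - j), linProd x (dyadic j s) ∈ S)
    {R : A[X]} (hR : R ∈ S) (hRd : R.degree < (2 ^ k : ℕ)) :
    (arith F A).poly.rel S
      (2 ^ k * (4 * mulTime k + 2) + (2 ^ k * mulTime k + k * (2 ^ k * (2 * mulTime k))))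
      {P | ∃ t < 2 ^ k, P = C (∑ e ∈ Finset.range (2 ^ k), R.coeff e * x t ^ (2 ^ k - 1 - e))} := by
  set n := 2 ^ k with hn
  have hnpos : 0 < n := by positivity
  set G := linProd x (dyadic k 0) with hG
  obtain ⟨H, hHd, ⟨Z, hZ⟩, hHc⟩ := exists_inverse (F := F) (S := S) (G := G)
    (hnode k le_rfl 0 (by simp)) (coeff_zero_linProd _ _) (le_refl k)
  -- `W₀` is `R / G` to precision `n`. Multiplying it by all factors except that of `t` leaves `R /
  -- (1 - x t * X)`, whose last coefficient is the wanted value.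
  set W₀ := polyBlock n 0 (R * H) with hW₀
  refine (arith F A).poly.andThen hHc ?_
  have c1 := (arith F A).poly.andThen (poly_rel_mul_of_le (F := F) (S := S ∪ {H}) (le_refl k)
    (.inl hR) (.inr rfl) hRd hHd) (poly_rel_polyBlock n 0 (p := R * H) (.inr rfl))
  rw [Nat.add_zero] at c1
  refine (arith F A).poly.andThen c1 ?_
  obtain ⟨W, hWd, hW, hWc⟩ := exists_descent (F := F) (x := x) (k := k) (S := S ∪ {H} ∪ {W₀})
    (fun j hj s hs => .inl (.inl (hnode j hj s hs))) (W₀ := W₀) (.inr rfl)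
    (degree_polyBlock_lt _ _ _) (le_refl k)
  refine (arith F A).poly.mono_tgt ?_ hWc
  rintro P ⟨t, ht, rfl⟩
  refine ⟨t, ht, ?_⟩
  rw [Nat.sub_self] at hW hWd
  have h1 := hW t ht t (by simp [dyadic_zero])
  have h2 : W t = C ((W t).coeff 0) := eq_C_of_degree_le_zero (by
    simpa [Nat.WithBot.lt_one_iff_le_zero] using hWd t)
  rw [h2]
  congr 1
  rw [dyadic_zero, Finset.erase_singleton, linProd, Finset.prod_empty, mul_one, pow_zero,
    Nat.sub_self] at h1
  rw [h1]
  obtain ⟨m, hm⟩ : ∃ m, n = m + 1 := ⟨n - 1, by omega⟩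
  rw [← hn, hm, Nat.add_sub_cancel]
  refine (coeff_eq_sum_of_dvd _ _ _ _ ?_).symm
  rw [← hm]
  obtain ⟨a, ha⟩ := X_pow_dvd_sub_polyBlock n (R * H)
  have h3 := linProd_erase_mul (x := x) (I := dyadic k 0) (t := t)
    (by rw [dyadic_top]; simpa using ht)
  refine ⟨R * Z - a * G, ?_⟩
  linear_combination W₀ * h3 - G * ha + R * hZ

lemma reflect_finset_sum {ι : Type*} (N : ℕ) (I : Finset ι) (f : ι → A[X]) :
    reflect N (∑ i ∈ I, f i) = ∑ i ∈ I, reflect N (f i) := by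
  classical
  induction I using Finset.induction_on with
  | empty => simp
  | insert i I hi ih => rw [Finset.sum_insert hi, Finset.sum_insert hi, reflect_add, ih]

lemma reflect_linProd (x : ℕ → A) (I : Finset ℕ) :
    reflect I.card (linProd x I) = ∏ t ∈ I, (X - C (x t)) := by
  induction I using Finset.induction_on with
  | empty => simp [linProd]
  | insert i I hi ih =>
    rw [linProd, Finset.prod_insert hi, Finset.prod_insert hi, Finset.card_insert_of_notMem hi,
      add_comm, ← linProd, reflect_mul _ _ _ (natDegree_linProd_le x I), ih]
    · congr 1
      rw [sub_eq_add_neg, ← neg_mul, ← C_neg, reflect_add, reflect_one, reflect_C_mul,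
        reflect_one_X, C_neg]
      ring
    · have := natDegree_linProd_le x {i}
      simpa [linProd] using this

lemma reflect_numer (x c : ℕ → A) (I : Finset ℕ) :
    reflect (I.card - 1) (numer x c I) =
      ∑ t ∈ I, C (c t) * ∏ u ∈ I.erase t, (X - C (x u)) := by
  rw [numer, reflect_finset_sum]
  refine Finset.sum_congr rfl fun t ht => ?_
  rw [reflect_C_mul, ← reflect_linProd, Finset.card_erase_of_mem ht]

lemma sum_coeff_mul_pow_eq {n : ℕ} (hn : 0 < n) {p : A[X]} (hp : p.degree < n) (a : A) :
    ∑ e ∈ Finset.range n, p.coeff e * a ^ (n - 1 - e) = (reflect (n - 1) p).eval a := by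
  have hd : (reflect (n - 1) p).natDegree < n := by
    have : p.natDegree ≤ n - 1 := by
      rw [natDegree_le_iff_coeff_eq_zero]
      exact fun i hi => (degree_lt_iff_coeff_zero _ _).mp hp i (by omega)
    have h2 := natDegree_reflect_le (p := p) (N := n - 1)
    omega
  rw [eval_eq_sum_range' hd, ← Finset.sum_range_reflect]
  refine Finset.sum_congr rfl fun e he => ?_
  have : e < n := by simpa using he
  rw [coeff_reflect, revAt_le (by omega)]
  congr 2
  omega

lemma eval_sum_prod_erase {I : Finset ℕ} (x c : ℕ → A) {i : ℕ} (hi : i ∈ I) :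
    (∑ t ∈ I, C (c t) * ∏ u ∈ I.erase t, (X - C (x u))).eval (x i) =
      c i * ∏ u ∈ I.erase i, (x i - x u) := by
  rw [eval_finsetSum, Finset.sum_eq_single_of_mem i hi]
  · simp [eval_prod]
  · intro t _ hti
    rw [eval_mul, eval_prod, Finset.prod_eq_zero (i := i)]
    · simp
    · simp [hi, hti.symm]
    · simp

/-- The ring is not a domain, so counting roots is unavailable. Unit differences make the linear
factors coprime, and their monic product of degree `n` divides `p - q`. -/
lemma eq_of_eval_eq [Nontrivial A] {n : ℕ} (hu : ∀ i < n, ∀ j < n, i ≠ j → IsUnit (x i - x j))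
    {p q : A[X]} (hp : p.degree < n) (hq : q.degree < n)
    (h : ∀ i < n, p.eval (x i) = q.eval (x i)) : p = q := by
  rw [← sub_eq_zero]
  by_contra h0
  have hdvd : ∏ i ∈ Finset.range n, (X - C (x i)) ∣ p - q := by
    refine Finset.prod_dvd_of_coprime ?_ fun i hi => ?_
    · intro i hi j hj hij
      exact isCoprime_X_sub_C_of_isUnit_sub (hu i (by simpa using hi) j (by simpa using hj) hij)
    · rw [dvd_iff_isRoot, IsRoot, eval_sub, h i (by simpa using hi), sub_self]
  have hm : (∏ i ∈ Finset.range n, (X - C (x i))).Monic :=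
    monic_prod_of_monic _ _ fun i _ => monic_X_sub_C _
  refine hm.not_dvd_of_degree_lt h0 ?_ hdvd
  rw [degree_eq_natDegree hm.ne_zero, natDegree_finsetProd_X_sub_C_eq_card, Finset.card_range]
  exact (degree_sub_le _ _).trans_lt (max_lt hp hq)

/-- The reversed factors `1 - x t * X` allow padding to a power of two: the point `0` contributes
the factor `1`, and the weight `0` contributes no summand. -/
lemma numer_pad {c : ℕ → A} {n N : ℕ} (hn : n ≤ N) :
    numer (fun t => if t < n then x t else 0) (fun t => if t < n then c t else 0)
      (Finset.range N) = numer x c (Finset.range n) := by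
  rw [numer, numer, ← Finset.sum_subset (Finset.range_subset_range.mpr hn)]
  · refine Finset.sum_congr rfl fun t ht => ?_
    have ht' : t < n := by simpa using ht
    rw [if_pos ht', linProd, linProd, ← Finset.prod_subset
      (Finset.erase_subset_erase t (Finset.range_subset_range.mpr hn))]
    · congr 1
      refine Finset.prod_congr rfl fun u hu => ?_
      have : u < n := by simpa using Finset.mem_of_mem_erase hu
      simp [this]
    · intro u hu hu'
      have : ¬ u < n := fun h => hu' (by simp at hu ⊢; exact ⟨hu.1, h⟩)
      simp [this]
  · intro t _ ht
    have : ¬ t < n := by simpa using ht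
    simp [this]

/-- Interpolation: the coefficients of a polynomial from its values. -/
lemma interpolation_cost [Nontrivial A] {y : ℕ → A} {n : ℕ} (hn0 : 0 < n) (hn : n ≤ 2 ^ k)
    (hu : ∀ i < n, ∀ j < n, i ≠ j → IsUnit (x i - x j)) {P : A[X]} (hP : P.degree < n)
    (hy : ∀ i < n, P.eval (x i) = y i) {S : Set A} (hxS : ∀ i < n, x i ∈ S)
    (hyS : ∀ i < n, y i ∈ S) :
    (arith F A).rel S (2 ^ k * ((k + 1) * (7 * mulTime k + 5))) (Set.range P.coeff) := by
  set τ := mulTime k with hτ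
  set x' : ℕ → A := fun t => if t < n then x t else 0 with hx'
  -- The denominators of Lagrange's formula. Each is a unit, so the quotients `y t / w t` exist and
  -- may be computed by division.
  set w : ℕ → A := fun t => ∏ u ∈ (Finset.range n).erase t, (x t - x u) with hw
  have hwu : ∀ t < n, IsUnit (w t) := by
    intro t ht
    refine Finset.prod_induction _ IsUnit (fun _ _ => IsUnit.mul) isUnit_one ?_
    intro u hu'
    simp only [Finset.mem_erase, Finset.mem_range] at hu'
    exact hu t ht u hu'.2 hu'.1.symm
  choose! q hq using fun t ht => show ∃ q, q * w t = y t from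
    let ⟨v, hv⟩ := (hwu t ht).exists_left_inv
    ⟨y t * v, by rw [mul_assoc, hv, mul_one]⟩
  let c₁ : ℕ → A := fun t => if t < n then 1 else 0
  let c₂ : ℕ → A := fun t => if t < n then q t else 0
  have hcard : (Finset.range n).card = n := Finset.card_range n
  have hnum₁ : numer x' c₁ (Finset.range (2 ^ k)) = numer x (fun _ => 1) (Finset.range n) :=
    numer_pad (c := fun _ => 1) hn
  have hnum₂ : numer x' c₂ (Finset.range (2 ^ k)) = numer x q (Finset.range n) :=
    numer_pad (c := q) hn
  have hPeq : P = reflect (n - 1) (numer x q (Finset.range n)) := by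
    have hr := reflect_numer x q (Finset.range n)
    rw [hcard] at hr
    refine eq_of_eval_eq hu hP ?_ ?_
    · have h1 : (numer x q (Finset.range n)).degree < n := by
        simpa using degree_numer_lt (x := x) (c := q) (Finset.range n)
      rw [degree_lt_iff_coeff_zero]
      intro i hi
      rw [coeff_reflect, revAt_eq_self_of_lt (by omega)]
      exact (degree_lt_iff_coeff_zero _ _).mp h1 i hi
    · intro i hi
      rw [hr, eval_sum_prod_erase x q (by simpa using hi), hy i hi]
      exact (hq i hi).symm
  -- With all weights `1`, the reversed numerator takes the value `w t` at `x t`. The shift makes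
  -- reversal at length `2 ^ k` agree with reversal at length `n`.
  set R := X ^ (2 ^ k - n) * numer x (fun _ => 1) (Finset.range n) with hR
  have hnumd : (numer x (fun _ => 1) (Finset.range n)).degree < n := by
    simpa using degree_numer_lt (x := x) (c := fun _ => 1) (Finset.range n)
  have hRd : R.degree < (2 ^ k : ℕ) := by
    rw [degree_lt_iff_coeff_zero]
    intro i hi
    rw [hR, coeff_X_pow_mul', if_pos (by omega)]
    exact (degree_lt_iff_coeff_zero _ _).mp hnumd _ (by omega)
  have hval : ∀ t < n, ∑ e ∈ Finset.range (2 ^ k), R.coeff e * x' t ^ (2 ^ k - 1 - e) = w t := by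
    intro t ht
    have h1 : 2 ^ k = (2 ^ k - n) + n := by omega
    have h2 : x' t = x t := by simp [hx', ht]
    rw [h2]
    conv_lhs => rw [h1, Finset.sum_range_add]
    rw [Finset.sum_eq_zero, zero_add]
    · have h3 : ∀ e ∈ Finset.range n,
          R.coeff (2 ^ k - n + e) * x t ^ (2 ^ k - n + n - 1 - (2 ^ k - n + e)) =
          (numer x (fun _ => 1) (Finset.range n)).coeff e * x t ^ (n - 1 - e) := by
        intro e _
        rw [hR, coeff_X_pow_mul', if_pos (by omega), Nat.add_sub_cancel_left]
        congr 2
        omega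
      rw [Finset.sum_congr rfl h3, sum_coeff_mul_pow_eq hn0 hnumd]
      have hr := reflect_numer x (fun _ => 1) (Finset.range n)
      rw [hcard] at hr
      rw [hr, eval_sum_prod_erase x (fun _ => (1 : A)) (by simpa using ht), one_mul]
    · intro e he
      have : e < 2 ^ k - n := by simpa using he
      rw [hR, coeff_X_pow_mul', if_neg (by omega), zero_mul]
  let S₁ : Set A[X] := {p | ∃ t < 2 ^ k, p = C (x' t)} ∪ {p | ∃ t < n, p = C (y t)} ∪
    ({0} ∪ {1})
  let V : Set A[X] := {p | ∃ t < 2 ^ k,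
    p = C (∑ e ∈ Finset.range (2 ^ k), R.coeff e * x' t ^ (2 ^ k - 1 - e))}
  have hmain : (arith F A).poly.rel S₁ ((2 ^ k * 2 + k * (2 ^ k * τ)) +
      (k * (2 ^ k * (2 * τ + 1)) + (0 +
        ((2 ^ k * (4 * τ + 2) + (2 ^ k * τ + k * (2 ^ k * (2 * τ)))) +
          (n * 1 + (k * (2 ^ k * (2 * τ + 1)) + 0)))))) {P} := by
    refine (arith F A).poly.andThen (linProd_dyadic_cost (x := x') (k := k)
      (fun t ht => .inl (.inl ⟨t, ht, rfl⟩)) (le_refl k)) ?_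
    refine (arith F A).poly.andThen (numer_dyadic_cost (x := x') (c := c₁) (k := k) (fun t _ => ?_)
      (fun j hj s hs => .inr ⟨j, hj, s, hs, rfl⟩) (le_refl k)) ?_
    · left; right
      by_cases ht : t < n
      · right; simp [c₁, ht]
      · left; simp [c₁, ht]
    refine (arith F A).poly.andThen (T := {R}) (poly_rel_free ?_) ?_
    · rintro _ rfl i
      rw [hR, coeff_X_pow_mul']
      split_ifs
      · refine .inr ⟨_, .inr ⟨0, by simp, ?_⟩, _, rfl⟩
        rw [dyadic_top, hnum₁]
      · exact .inl rfl
    refine (arith F A).poly.andThen (multipoint_cost (x := x') (k := k) (R := R)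
      (fun j hj s hs => .inl (.inl (.inr ⟨j, hj, s, hs, rfl⟩))) (.inr rfl) hRd) ?_
    have hdiv := (arith F A).poly.biUnion (S := S₁ ∪ V) (Finset.range n) (fun t => {C (q t)}) 1 (by
      intro t ht
      have ht' : t < n := by simpa using ht
      refine poly_rel_of_coeff (h := 1) (v := 1) arith_zero (degree_C_le.trans_lt
        (by exact_mod_cast Nat.one_pos)) fun i hi => ?_
      obtain rfl : i = 0 := by omega
      rw [coeff_C_zero]
      have m1 := coeff_mem_biUnion (S := S₁ ∪ V) (p := C (y t))
        (.inl (.inl (.inr ⟨t, ht', rfl⟩))) 0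
      have m2 := coeff_mem_biUnion (S := S₁ ∪ V) (p := C (w t))
        (.inr ⟨t, by omega, by rw [hval t ht']⟩) 0
      rw [coeff_C_zero] at m1 m2
      exact arith_div m1 m2 (hwu t ht') (hq t ht'))
    rw [Finset.card_range] at hdiv
    refine (arith F A).poly.andThen ((arith F A).poly.mono_src ?_ hdiv) ?_
    · exact Set.union_subset_union_left _ fun p hp => .inl (.inl (.inl hp))
    refine (arith F A).poly.andThen (numer_dyadic_cost (x := x') (c := c₂) (k := k) (fun t _ => ?_)
      (fun j hj s hs => .inl (.inl (.inl (.inl (.inr ⟨j, hj, s, hs, rfl⟩))))) (le_refl k)) ?_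
    · by_cases ht : t < n
      · right
        simp only [Set.mem_iUnion]
        exact ⟨t, by simpa using ht, by simp [c₂, ht]⟩
      · left; left; left; left; left; right; left
        simp [c₂, ht]
    refine poly_rel_free ?_
    rintro _ rfl i
    rw [hPeq, coeff_reflect]
    refine .inr ⟨_, .inr ⟨0, by simp, ?_⟩, _, rfl⟩
    rw [dyadic_top, hnum₂]
  have hsrc : (arith F A).rel S 0 (⋃ p ∈ S₁, Set.range p.coeff) := by
    refine arith_const ?_
    intro z hz
    simp only [Set.mem_iUnion] at hz
    obtain ⟨p, hp, i, rfl⟩ := hz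
    have hC : ∀ a : A, (a ∈ S ∨ a = 0) → (C a).coeff i ∈ S ∪ Set.range (algebraMap F A) := by
      intro a ha
      rw [coeff_C]
      split_ifs
      · rcases ha with ha | rfl
        · exact .inl ha
        · exact .inr ⟨0, map_zero _⟩
      · exact .inr ⟨0, map_zero _⟩
    rcases hp with (⟨t, _, rfl⟩ | ⟨t, ht, rfl⟩) | rfl | rfl
    · apply hC
      by_cases ht : t < n
      · left; simpa [hx', ht] using hxS t ht
      · right; simp [hx', ht]
    · exact hC _ (.inl (hyS t ht))
    · exact .inr ⟨0, by simp⟩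
    · show (1 : A[X]).coeff i ∈ _
      rw [coeff_one]
      split_ifs
      · exact .inr ⟨1, map_one _⟩
      · exact .inr ⟨0, map_zero _⟩
  rw [CostRel.poly_rel] at hmain
  have hfin := (arith F A).andThen hsrc ((arith F A).mono_src Set.subset_union_right hmain)
  refine (arith F A).mono subset_rfl ?_ (by simp) hfin
  generalize 2 ^ k = M at hn
  calc _ ≤ 0 + ((M * 2 + k * (M * τ)) + (k * (M * (2 * τ + 1)) + (0 +
        ((M * (4 * τ + 2) + (M * τ + k * (M * (2 * τ)))) +
          (M * 1 + (k * (M * (2 * τ + 1)) + 0)))))) := by gcongr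
    _ = M * (k * (7 * τ + 2) + (5 * τ + 5)) := by ring
    _ ≤ M * (k * (7 * τ + 5) + (7 * τ + 5)) := by gcongr <;> omega
    _ = _ := by ring

end Interpolation

/-! ### Size of the interpolation cost -/

/-- The cost of interpolation from at most `2 ^ k` points. -/
def interpTime (k : ℕ) : ℕ := 2 ^ k * ((k + 1) * (7 * mulTime k + 5))

/-- For `n ≥ 3 > e` both `log n` and `log log n` are bounded below by positive constants, which
absorb all lower-order terms. -/
lemma exists_interpTime_le : ∃ C : ℝ, 0 < C ∧ ∀ n : ℕ, 3 ≤ n → ∃ k, n ≤ 2 ^ k ∧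
    (interpTime k : ℝ) ≤ C * (n * Real.log n ^ 2 * Real.log (Real.log n)) := by
  have h3 : 1 < Real.log 3 := by
    rw [Real.lt_log_iff_exp_lt (by norm_num)]
    exact Real.exp_one_lt_d9.trans (by norm_num)
  set c₀ := Real.log (Real.log 3) with hc₀
  have hc₀pos : 0 < c₀ := Real.log_pos h3
  -- The factor `8` comes from `2 ^ k ≤ 2 * n` and `k + 1 ≤ 4 * log n`. A constant summand turns
  -- into a multiple of `M` at the price of a factor `1 / c₀`.
  refine ⟨8 * (56 * (6000 * (2 + 5 / c₀) + 60 / c₀) + 5 / c₀), by positivity, fun n hn => ?_⟩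
  have hn' : (3 : ℝ) ≤ n := by exact_mod_cast hn
  set L := Real.log n with hL
  have hL3 : Real.log 3 ≤ L := Real.log_le_log (by norm_num) hn'
  have hL1 : 1 ≤ L := by linarith
  set M := Real.log L with hM
  have hMc : c₀ ≤ M := Real.log_le_log (by linarith) hL3
  have hMpos : 0 < M := hc₀pos.trans_le hMc
  have h1M : 1 ≤ M / c₀ := by rwa [one_le_div hc₀pos]
  refine ⟨Nat.clog 2 n, Nat.le_pow_clog (by norm_num) n, ?_⟩
  set k := Nat.clog 2 n with hk
  have hkpos : 0 < k := Nat.clog_pos (by norm_num) (by omega)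
  have hlog2 : 1 / 2 ≤ Real.log 2 := by have := Real.log_two_gt_d9; linarith
  have hpow : (2 : ℝ) ^ k ≤ 2 * n := by
    have h1 : 2 ^ (k - 1) < n := Nat.pow_pred_clog_lt_self (by norm_num) (by omega)
    have h2 : 2 ^ k = 2 * 2 ^ (k - 1) := by rw [← pow_succ']; congr 1; omega
    have : 2 ^ k ≤ 2 * n := by omega
    exact_mod_cast this
  have hkL : (k : ℝ) ≤ 3 * L := by
    have h1 : Real.log ((2 : ℝ) ^ k) ≤ Real.log (2 * n) := Real.log_le_log (by positivity) hpow
    rw [Real.log_pow, Real.log_mul (by norm_num) (by positivity)] at h1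
    have h2 : ((k : ℝ) - 1) * Real.log 2 ≤ L := by linarith
    have h3 : (1 : ℝ) ≤ k := by exact_mod_cast hkpos
    nlinarith
  have hlk : (Nat.log 2 k : ℝ) + 1 ≤ (2 + 5 / c₀) * M := by
    have h1 : (2 : ℝ) ^ Nat.log 2 k ≤ 3 * L :=
      le_trans (by exact_mod_cast Nat.pow_log_le_self 2 hkpos.ne') hkL
    have h2 := Real.log_le_log (by positivity) h1
    rw [Real.log_pow, Real.log_mul (by norm_num) (by linarith), ← hM] at h2
    have h4 : Real.log 3 ≤ 2 := by
      have := Real.log_le_sub_one_of_pos (show (0 : ℝ) < 3 by norm_num)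
      linarith
    have h5 : (Nat.log 2 k : ℝ) ≤ 2 * (2 + M) := by
      have : (0 : ℝ) ≤ Nat.log 2 k := Nat.cast_nonneg _
      nlinarith
    have h6 : (2 + 5 / c₀) * M = 2 * M + 5 * (M / c₀) := by ring
    rw [h6]
    linarith
  have hrate : (mulRate k : ℝ) ≤ (6000 * (2 + 5 / c₀) + 60 / c₀) * (L * M) := by
    unfold mulRate
    push_cast
    have h1 : (2000 * k * (Nat.log 2 k + 1) : ℝ) ≤ 2000 * (3 * L) * ((2 + 5 / c₀) * M) := by
      gcongr
    have h2 : (60 : ℝ) ≤ 60 / c₀ * (L * M) := by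
      have : 60 / c₀ * (L * M) = 60 * (L * (M / c₀)) := by ring
      rw [this]
      nlinarith
    linarith
  have h5 : (5 : ℝ) ≤ 5 / c₀ * (L * M) := by
    have : 5 / c₀ * (L * M) = 5 * (L * (M / c₀)) := by ring
    rw [this]
    nlinarith
  unfold interpTime mulTime
  push_cast
  have hk1 : (k : ℝ) + 1 ≤ 4 * L := by linarith
  calc (2 : ℝ) ^ k * ((k + 1) * (7 * (8 * mulRate k) + 5))
      ≤ (2 * n) * ((4 * L) * (7 * (8 * ((6000 * (2 + 5 / c₀) + 60 / c₀) * (L * M))) +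
          5 / c₀ * (L * M))) := by gcongr
    _ = _ := by ring

/-! ### Building blocks for programs -/

section Blocks

variable {F A : Type*} [Field F] [CommRing A] [Algebra F A]

lemma CostRel.range {R κ : Type*} [Fintype κ] (K : CostRel R) {S : Set R} {n : ℕ} {f : κ → R}
    (h : ∀ i, K.rel S n {f i}) : K.rel S (Fintype.card κ * n) (Set.range f) := by
  refine K.mono subset_rfl le_rfl ?_ (K.biUnion Finset.univ (fun i => {f i}) n fun i _ => h i)
  rintro _ ⟨i, rfl⟩
  simp

lemma arith_dot {ι : Type*} [Fintype ι] {S : Set A} {f g : ι → A} (hf : ∀ i, f i ∈ S)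
    (hg : ∀ i, g i ∈ S) :
    (arith F A).rel S (2 * Fintype.card ι) {∑ i, f i * g i} := by
  classical
  have key : ∀ I : Finset ι, (arith F A).rel S (2 * I.card) {∑ i ∈ I, f i * g i} := by
    intro I
    induction I using Finset.induction_on with
    | empty => simpa using arith_zero S
    | insert i I hi ih =>
      rw [Finset.sum_insert hi, Finset.card_insert_of_notMem hi]
      have h1 := (arith F A).union (arith_mul (hf i) (hg i)) ih
      refine (arith F A).mono_cost (le_of_eq ?_) ((arith F A).andThen h1
        (arith_add (.inr (.inl rfl)) (.inr (.inr rfl))))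
      ring
  exact key Finset.univ

/-- The powers `x ^ e`, `e < d`. -/
lemma arith_powers {S : Set A} {x : A} (hx : x ∈ S) (d : ℕ) :
    (arith F A).rel S d {a | ∃ e < d, a = x ^ e} := by
  induction d with
  | zero => exact (arith F A).of_subset (by simp)
  | succ d ih =>
    rcases Nat.eq_zero_or_pos d with rfl | hd
    · refine arith_const ?_
      rintro a ⟨e, he, rfl⟩
      obtain rfl : e = 0 := by omega
      exact .inr ⟨1, by simp⟩
    · have h1 := (arith F A).trans ih (arith_mul (a := x ^ (d - 1)) (b := x)
        (.inr ⟨d - 1, by omega, rfl⟩) (.inl hx))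
      refine (arith F A).mono_tgt ?_ h1
      rintro a ⟨e, he, rfl⟩
      rcases Nat.lt_or_ge e d with h | h
      · exact .inl ⟨e, h, rfl⟩
      · right
        obtain rfl : e = d := by omega
        rw [Set.mem_singleton_iff, ← pow_succ]
        congr 1
        omega

variable {Ω ι κ ε : Type*}

/-- The polynomial over the ring of functions with given values. -/
noncomputable def polyOfFamily (n : ℕ) (p : Ω → F[X]) : (Ω → F)[X] :=
  ∑ e ∈ Finset.range n, C (fun ω => (p ω).coeff e) * X ^ e

lemma coeff_polyOfFamily {n : ℕ} {p : Ω → F[X]} (hp : ∀ ω, (p ω).degree < n) (e : ℕ) :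
    (polyOfFamily n p).coeff e = fun ω => (p ω).coeff e := by
  rw [polyOfFamily, finsetSum_coeff]
  simp only [coeff_C_mul_X_pow, Finset.sum_ite_eq, Finset.mem_range]
  split_ifs with h
  · rfl
  · funext ω
    exact ((degree_lt_iff_coeff_zero _ _).mp (hp ω) e (by omega)).symm

lemma eval_polyOfFamily {n : ℕ} {p : Ω → F[X]} (hp : ∀ ω, (p ω).degree < n) (x : Ω → F) :
    (polyOfFamily n p).eval x = fun ω => (p ω).eval (x ω) := by
  funext ω
  conv_rhs => rw [eq_sum_of_degree_lt (hp ω)]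
  simp [polyOfFamily, eval_finsetSum]

lemma degree_polyOfFamily_lt (n : ℕ) (p : Ω → F[X]) : (polyOfFamily n p).degree < n := by
  rw [degree_lt_iff_coeff_zero]
  intro e he
  rw [polyOfFamily, finsetSum_coeff]
  refine Finset.sum_eq_zero fun i hi => ?_
  have : i < n := by simpa using hi
  rw [coeff_C_mul_X_pow, if_neg (by omega)]

/-- A program that interpolates a finite family of polynomials. -/
lemma exists_interpolation_program [Fintype ε] {n k : ℕ} (hn0 : 0 < n) (hn : n ≤ 2 ^ k)
    (x : Ω → Fin n → F) (hx : ∀ ω, Function.Injective (x ω)) (p : Ω → ε → F[X])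
    (hp : ∀ ω e, (p ω e).degree < n) (out : κ → ε × ℕ) :
    ∃ P : Program F (Fin n ⊕ (Fin n × ε)) κ, P.cost ≤ Fintype.card ε * interpTime k ∧
      ∀ ω, P.Computes (Sum.elim (x ω) fun q : Fin n × ε => (p ω q.2).eval (x ω q.1))
        fun i => (p ω (out i).1).coeff (out i).2 := by
  -- Without admissible inputs the ring `Ω → F` is trivial and `interpolation_cost` does not apply,
  -- but nothing has to be computed.
  rcases isEmpty_or_nonempty Ω with hΩ | hΩ
  · exact ⟨⟨[], fun _ => .const 0⟩, Nat.zero_le _, fun ω => hΩ.elim ω⟩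
  refine exists_program (fun ω => Sum.elim (x ω) fun q : Fin n × ε => (p ω q.2).eval (x ω q.1))
    (fun ω i => (p ω (out i).1).coeff (out i).2) ?_
  set S : Set (Ω → F) := Set.range fun i ω =>
    (Sum.elim (x ω) fun q : Fin n × ε => (p ω q.2).eval (x ω q.1) : Fin n ⊕ (Fin n × ε) → F) i with hS
  have key := (arith F (Ω → F)).biUnion (S := S) (Finset.univ : Finset ε)
    (fun e => Set.range (polyOfFamily n fun ω => p ω e).coeff) (interpTime k) (by
      intro e _
      refine interpolation_cost (F := F) (A := Ω → F) (k := k)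
        (x := fun i => if h : i < n then fun ω => x ω ⟨i, h⟩ else 0)
        (y := fun i => if h : i < n then fun ω => (p ω e).eval (x ω ⟨i, h⟩) else 0)
        hn0 hn ?_ (degree_polyOfFamily_lt n _) ?_ ?_ ?_
      · intro i hi j hj hij
        -- Distinct points on every admissible input make each difference a nowhere vanishing
        -- function, hence a unit.
        rw [Pi.isUnit_iff]
        intro ω
        simp only [hi, hj, dif_pos, Pi.sub_apply]
        rw [isUnit_iff_ne_zero, sub_ne_zero]
        exact fun h => hij (by simpa using hx ω h)
      · intro i hi
        simp only [hi, dif_pos]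
        exact eval_polyOfFamily (fun ω => hp ω e) _
      · intro i hi
        simp only [hi, dif_pos]
        exact ⟨.inl ⟨i, hi⟩, rfl⟩
      · intro i hi
        simp only [hi, dif_pos]
        exact ⟨.inr (⟨i, hi⟩, e), rfl⟩)
  refine (arith F (Ω → F)).mono_tgt ?_ key
  rintro _ ⟨i, rfl⟩
  simp only [Set.mem_iUnion]
  exact ⟨(out i).1, Finset.mem_univ _, (out i).2, coeff_polyOfFamily (fun ω => hp ω _) _⟩

end Blocks

open Matrix

/-! ### The encodings as polynomials -/

section Scheme

variable {F : Type*} [Field F] {a b c : ℕ} (K₁ m s X' : ℕ)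

/-- The exponents in the encoding of `A`. -/
def expA : (Fin K₁ × Fin m) ⊕ Fin X' → ℕ :=
  Sum.elim (fun q => q.2 + q.1 * m) fun i => K₁ * m + i

/-- The exponents in the encoding of `U`. -/
def expU : (Fin m × Fin s) ⊕ Fin X' → ℕ :=
  Sum.elim (fun q => (m - 1 - q.1) + q.2 * (K₁ * m + X'))
    fun i => (s - 1) * (K₁ * m + X') + K₁ * m + i

/-- The exponents in the encoding of `V`. -/
def expV : (Fin K₁ × Fin s) ⊕ Fin X' → ℕ :=
  Sum.elim (fun q => (K₁ - 1 - q.1) * m + (K₁ * m + X') * q.2)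
    fun i => (s - 1) * (K₁ * m + X') + K₁ * m + i

variable {K₁ m s X'} {R : Type*}

/-- The coefficients in entry `(u, v)` of the encoding of a matrix with masking matrices `T`. -/
def encCoeff {K L : ℕ} (M : Matrix (Fin a) (Fin b) R)
    (T : Fin X' → Matrix (Fin (a / K)) (Fin (b / L)) R) (u : Fin (a / K)) (v : Fin (b / L)) :
    (Fin K × Fin L) ⊕ Fin X' → R :=
  Sum.elim (fun q => M (blockIndex K q.1 u) (blockIndex L q.2 v)) fun i => T i u v

lemma encA_apply (A : Matrix (Fin a) (Fin b) F)
    (T : Fin X' → Matrix (Fin (a / K₁)) (Fin (b / m)) F) (x : F) (u : Fin (a / K₁))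
    (v : Fin (b / m)) :
    encA K₁ m X' A T x u v = ∑ α, x ^ expA K₁ m X' α * encCoeff A T u v α := by
  simp [encA, expA, encCoeff, block, Matrix.sum_apply, Fintype.sum_prod_type]

lemma encU_apply (U : Matrix (Fin b) (Fin c) F)
    (T : Fin X' → Matrix (Fin (b / m)) (Fin (c / s)) F) (x : F) (u : Fin (b / m))
    (v : Fin (c / s)) :
    encU K₁ m s X' U T x u v = ∑ β, x ^ expU K₁ m s X' β * encCoeff U T u v β := by
  simp [encU, expU, encCoeff, block, Matrix.sum_apply, Fintype.sum_prod_type]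

lemma encV_apply (V : Matrix (Fin a) (Fin c) F)
    (T : Fin X' → Matrix (Fin (a / K₁)) (Fin (c / s)) F) (x : F) (u : Fin (a / K₁))
    (v : Fin (c / s)) :
    encV K₁ m s X' V T x u v = ∑ β, x ^ expV K₁ m s X' β * encCoeff V T u v β := by
  simp [encV, expV, encCoeff, block, Matrix.sum_apply, Fintype.sum_prod_type]

lemma expA_lt (α : (Fin K₁ × Fin m) ⊕ Fin X') : expA K₁ m X' α < K₁ * m + X' := by
  rcases α with ⟨j, k⟩ | i
  · have h1 : (j + 1 : ℕ) * m ≤ K₁ * m := Nat.mul_le_mul_right _ j.2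
    rw [Nat.add_mul] at h1
    have := k.2
    simp only [expA, Sum.elim_inl]
    omega
  · have := i.2
    simp only [expA, Sum.elim_inr]
    omega

lemma mul_add_lt {s D k e : ℕ} (hk : k < s) (he : e < D) : k * D + e < s * D := by
  have h1 : (k + 1) * D ≤ s * D := Nat.mul_le_mul_right _ hk
  rw [Nat.add_mul] at h1
  omega

lemma expU_lt (hK : 0 < K₁) (hs : 0 < s) (β : (Fin m × Fin s) ⊕ Fin X') :
    expU K₁ m s X' β < s * (K₁ * m + X') := by
  rcases β with ⟨j, k⟩ | i
  · have h1 : 1 * m ≤ K₁ * m := Nat.mul_le_mul_right _ hK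
    have := j.2
    have := mul_add_lt (D := K₁ * m + X') k.2 (show m - 1 - j < K₁ * m + X' by omega)
    simp only [expU, Sum.elim_inl]
    omega
  · have := mul_add_lt (D := K₁ * m + X') (show s - 1 < s by omega)
      (show K₁ * m + i < K₁ * m + X' by omega)
    simp only [expU, Sum.elim_inr]
    omega

lemma expV_lt (hm : 0 < m) (hs : 0 < s) (β : (Fin K₁ × Fin s) ⊕ Fin X') :
    expV K₁ m s X' β < s * (K₁ * m + X') := by
  rcases β with ⟨j, k⟩ | i
  · have h1 : (K₁ - 1 - j : ℕ) * m < K₁ * m := Nat.mul_lt_mul_of_pos_right (by omega) hm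
    have := mul_add_lt (D := K₁ * m + X') k.2 (show (K₁ - 1 - j : ℕ) * m < K₁ * m + X' by omega)
    simp only [expV, Sum.elim_inl]
    rw [mul_comm (K₁ * m + X')]
    omega
  · have := mul_add_lt (D := K₁ * m + X') (show s - 1 < s by omega)
      (show K₁ * m + i < K₁ * m + X' by omega)
    simp only [expV, Sum.elim_inr]
    omega

/-- The polynomial with coefficients `f` at the exponents `e`. -/
noncomputable def expPoly {α : Type*} [Fintype α] (e : α → ℕ) (f : α → F) : F[X] :=
  ∑ i, monomial (e i) (f i)

lemma eval_expPoly {α : Type*} [Fintype α] (e : α → ℕ) (f : α → F) (x : F) :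
    (expPoly e f).eval x = ∑ i, x ^ e i * f i := by
  simp [expPoly, eval_finsetSum, mul_comm]

lemma coeff_expPoly_mul {α β : Type*} [Fintype α] [Fintype β] (e : α → ℕ) (f : α → F)
    (e' : β → ℕ) (g : β → F) (E : ℕ) :
    (expPoly e f * expPoly e' g).coeff E =
      ∑ i, ∑ j, if e i + e' j = E then f i * g j else 0 := by
  simp only [expPoly, Finset.sum_mul_sum, monomial_mul_monomial, finsetSum_coeff, coeff_monomial]

lemma sum_ite_eq_sum {α β γ : Type*} [Fintype α] [Fintype β] [Fintype γ] {p : α → β → Prop}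
    [∀ i j, Decidable (p i j)] {φ : γ → α} {ψ : γ → β} (hφ : Function.Injective φ)
    (hp : ∀ i j, p i j ↔ ∃ l, φ l = i ∧ ψ l = j) (f : α → β → F) :
    ∑ i, ∑ j, (if p i j then f i j else 0) = ∑ l, f (φ l) (ψ l) := by
  classical
  rw [← Fintype.sum_prod_type', ← Finset.sum_filter]
  symm
  refine Finset.sum_nbij (fun l => (φ l, ψ l)) ?_ ?_ ?_ fun _ _ => rfl
  · intro l _
    simp only [Finset.mem_filter, Finset.mem_univ, true_and]
    exact (hp _ _).mpr ⟨l, rfl, rfl⟩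
  · intro l _ l' _ h
    exact hφ (Prod.ext_iff.mp h).1
  · rintro ⟨i, j⟩ h
    simp only [Finset.coe_filter, Finset.mem_univ, true_and, Set.mem_ofPred_eq] at h
    obtain ⟨l, rfl, rfl⟩ := (hp _ _).mp h
    exact ⟨l, by simp, rfl⟩

/-- Two numbers `z + k * D` with `|z - z'| < D` agree only if their quotients do. -/
lemma eq_of_add_mul_eq {z z' k k' D : ℤ} (h : z + k * D = z' + k' * D) (h1 : z - z' < D)
    (h2 : z' - z < D) : k = k' ∧ z = z' := by
  have hd : D ∣ z - z' := ⟨k' - k, by linear_combination h⟩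
  have h0 := Int.eq_zero_of_abs_lt_dvd hd (abs_lt.mpr ⟨by linarith, h1⟩)
  have hz : z = z' := by linarith
  refine ⟨?_, hz⟩
  subst hz
  have hD : D ≠ 0 := by rintro rfl; linarith
  exact mul_right_cancel₀ hD (by linarith)

/-- The alignment that makes phase I decodable: these exponents collect exactly the products
`A_{j,l} U_{l,k}`. Comparing in steps of `D` fixes `k`; comparing the rest in steps of `m` fixes `j`
and matches the inner indices. -/
lemma expA_add_expU_iff (hm : 0 < m) (hs : 0 < s) (j : Fin K₁) (k : Fin s)
    (α : (Fin K₁ × Fin m) ⊕ Fin X') (β : (Fin m × Fin s) ⊕ Fin X') :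
    expA K₁ m X' α + expU K₁ m s X' β = (m - 1) + j * m + k * (K₁ * m + X') ↔
      ∃ l : Fin m, Sum.inl (j, l) = α ∧ Sum.inl (l, k) = β := by
  have hj1 : ((j : ℕ) + 1) * m ≤ K₁ * m := Nat.mul_le_mul_right _ j.2
  rw [Nat.add_mul] at hj1
  constructor
  · intro h
    rcases β with ⟨j'', k''⟩ | i
    · rcases α with ⟨j', k'⟩ | i
      · have hj' : ((j' : ℕ) + 1) * m ≤ K₁ * m := Nat.mul_le_mul_right _ j'.2
        rw [Nat.add_mul] at hj'
        simp only [expA, expU, Sum.elim_inl] at h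
        have hk' := k'.2
        have hj'' := j''.2
        have h1 : ((j' * m : ℕ) : ℤ) + k' - j'' + k'' * ((K₁ * m + X' : ℕ) : ℤ) =
            ((j * m : ℕ) : ℤ) + k * ((K₁ * m + X' : ℕ) : ℤ) := by
          have h2 : (k' : ℕ) + j' * m + (m - 1) + k'' * (K₁ * m + X') =
            m - 1 + j * m + k * (K₁ * m + X') + j'' := by omega
          zify at h2
          push_cast
          linear_combination h2
        obtain ⟨e1, e2⟩ := eq_of_add_mul_eq h1 (by omega) (by omega)
        have h3 : ((k' : ℤ) - j'') + j' * (m : ℤ) = 0 + j * (m : ℤ) := by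
          push_cast at e2; linear_combination e2
        obtain ⟨e3, e4⟩ := eq_of_add_mul_eq h3 (by omega) (by omega)
        have f1 : k'' = k := Fin.ext (by omega)
        have f2 : j' = j := Fin.ext (by omega)
        have f3 : k' = j'' := Fin.ext (by omega)
        subst f1 f2 f3
        exact ⟨k', rfl, rfl⟩
      · exfalso
        simp only [expA, expU, Sum.elim_inl, Sum.elim_inr] at h
        have hi := i.2
        have hj'' := j''.2
        -- A mask of `A` would force `K₁ * m + i - j'' = j * m`, but `j * m ≤ K₁ * m - m < K₁ * m -
        -- j''`.
        have h1 : ((K₁ * m : ℕ) : ℤ) + i - j'' + k'' * ((K₁ * m + X' : ℕ) : ℤ) =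
            ((j * m : ℕ) : ℤ) + k * ((K₁ * m + X' : ℕ) : ℤ) := by
          have h2 : K₁ * m + (i : ℕ) + (m - 1) + k'' * (K₁ * m + X') =
            m - 1 + j * m + k * (K₁ * m + X') + j'' := by omega
          zify at h2
          push_cast
          linear_combination h2
        obtain ⟨e1, e2⟩ := eq_of_add_mul_eq h1 (by omega) (by omega)
        omega
    · exfalso
      simp only [expU, Sum.elim_inr] at h
      -- The masks of `U` start at `(s - 1) * D + K₁ * m`, one above the largest exponent that is
      -- read off.
      have hk : (k : ℕ) * (K₁ * m + X') ≤ (s - 1) * (K₁ * m + X') :=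
        Nat.mul_le_mul_right _ (by omega)
      omega
  · rintro ⟨l, rfl, rfl⟩
    have := l.2
    simp only [expA, expU, Sum.elim_inl]
    omega

/-- The same encoding of `A` serves phase II because the row indices of `V` run backwards in steps
of `m`: now `j` cancels and `l` survives as the remainder. A mask of `A` would leave a remainder of
at least `m > l`. -/
lemma expA_add_expV_iff (hK : 0 < K₁) (hs : 0 < s) (l : Fin m) (k : Fin s)
    (α : (Fin K₁ × Fin m) ⊕ Fin X') (β : (Fin K₁ × Fin s) ⊕ Fin X') :
    expA K₁ m X' α + expV K₁ m s X' β = (K₁ - 1) * m + l + k * (K₁ * m + X') ↔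
      ∃ j : Fin K₁, Sum.inl (j, l) = α ∧ Sum.inl (j, k) = β := by
  have hl := l.2
  have hsplit : ∀ j : Fin K₁, (K₁ - 1 - j : ℕ) * m + j * m = (K₁ - 1) * m := fun j => by
    rw [← Nat.add_mul]; congr 1; omega
  have hKm : (K₁ - 1) * m + m = K₁ * m := by
    obtain ⟨K, rfl⟩ : ∃ K, K₁ = K + 1 := ⟨K₁ - 1, by omega⟩
    rw [Nat.add_sub_cancel, Nat.add_mul, Nat.one_mul]
  constructor
  · intro h
    rcases β with ⟨j'', k''⟩ | i
    · have hs'' := hsplit j''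
      have hcomm := mul_comm (K₁ * m + X') (k'' : ℕ)
      rcases α with ⟨j', k'⟩ | i
      · have hs' := hsplit j'
        have hk' := k'.2
        simp only [expA, expV, Sum.elim_inl] at h
        have h1 : ((k' : ℤ) + ((j' * m : ℕ) : ℤ) - ((j'' * m : ℕ) : ℤ)) +
            k'' * ((K₁ * m + X' : ℕ) : ℤ) = (l : ℤ) + k * ((K₁ * m + X' : ℕ) : ℤ) := by
          have h2 : (k' : ℕ) + j' * m + (K₁ - 1) * m + k'' * (K₁ * m + X') =
            (K₁ - 1) * m + l + k * (K₁ * m + X') + j'' * m := by omega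
          zify at h2
          push_cast
          linear_combination h2
        obtain ⟨e1, e2⟩ := eq_of_add_mul_eq h1 (by omega) (by omega)
        have h3 : (k' : ℤ) + j' * (m : ℤ) = l + j'' * (m : ℤ) := by
          push_cast at e2; linear_combination e2
        obtain ⟨e3, e4⟩ := eq_of_add_mul_eq h3 (by omega) (by omega)
        have f1 : k'' = k := Fin.ext (by omega)
        have f2 : j' = j'' := Fin.ext (by omega)
        have f3 : k' = l := Fin.ext (by omega)
        subst f1 f2 f3
        exact ⟨j', rfl, rfl⟩
      · exfalso
        have hi := i.2
        simp only [expA, expV, Sum.elim_inl, Sum.elim_inr] at h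
        have h1 : (((K₁ * m : ℕ) : ℤ) + i - ((j'' * m : ℕ) : ℤ)) +
            k'' * ((K₁ * m + X' : ℕ) : ℤ) = (l : ℤ) + k * ((K₁ * m + X' : ℕ) : ℤ) := by
          have h2 : K₁ * m + (i : ℕ) + (K₁ - 1) * m + k'' * (K₁ * m + X') =
            (K₁ - 1) * m + l + k * (K₁ * m + X') + j'' * m := by omega
          zify at h2
          push_cast
          linear_combination h2
        obtain ⟨e1, e2⟩ := eq_of_add_mul_eq h1 (by omega) (by omega)
        omega
    · exfalso
      simp only [expV, Sum.elim_inr] at h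
      have hk : (k : ℕ) * (K₁ * m + X') ≤ (s - 1) * (K₁ * m + X') :=
        Nat.mul_le_mul_right _ (by omega)
      omega
  · rintro ⟨j, rfl, rfl⟩
    have := hsplit j
    have hcomm := mul_comm (K₁ * m + X') (k : ℕ)
    simp only [expA, expV, Sum.elim_inl]
    omega

lemma blockIndex_bijective {K : ℕ} (hK : K ∣ a) :
    Function.Bijective fun q : Fin K × Fin (a / K) => (blockIndex K q.1 q.2 : Fin a) := by
  rw [Fintype.bijective_iff_injective_and_card]
  constructor
  · rintro ⟨j, u⟩ ⟨j', u'⟩ h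
    have h1 : (j : ℕ) * (a / K) + u = j' * (a / K) + u' := congrArg Fin.val h
    have h2 : (u : ℤ) + j * ((a / K : ℕ) : ℤ) = u' + j' * ((a / K : ℕ) : ℤ) := by
      exact_mod_cast (by omega : (u : ℕ) + j * (a / K) = u' + j' * (a / K))
    obtain ⟨e1, e2⟩ := eq_of_add_mul_eq h2 (by omega) (by omega)
    exact Prod.ext (Fin.ext (by exact_mod_cast e1)) (Fin.ext (by exact_mod_cast e2))
  · simp [Nat.mul_div_cancel' hK]

lemma sum_blockIndex {K : ℕ} (hK : K ∣ a) (f : Fin a → F) :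
    ∑ r, f r = ∑ u : Fin (a / K), ∑ j : Fin K, f (blockIndex K j u) := by
  rw [Finset.sum_comm, ← Fintype.sum_prod_type' (f := fun j u => f (blockIndex K j u))]
  exact ((blockIndex_bijective hK).sum_comp f).symm

/-- The polynomial interpolated at entry `(u, v)` in phase I. -/
noncomputable def polyI (A : Matrix (Fin a) (Fin b) F) (U : Matrix (Fin b) (Fin c) F)
    (R : Fin X' → Matrix (Fin (a / K₁)) (Fin (b / m)) F)
    (T : Fin X' → Matrix (Fin (b / m)) (Fin (c / s)) F) (q : Fin (a / K₁) × Fin (c / s)) : F[X] :=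
  ∑ w, expPoly (expA K₁ m X') (encCoeff A R q.1 w) * expPoly (expU K₁ m s X') (encCoeff U T w q.2)

/-- The polynomial interpolated at entry `(u, v)` in phase II. -/
noncomputable def polyII (A : Matrix (Fin a) (Fin b) F) (V : Matrix (Fin a) (Fin c) F)
    (R : Fin X' → Matrix (Fin (a / K₁)) (Fin (b / m)) F)
    (H : Fin X' → Matrix (Fin (a / K₁)) (Fin (c / s)) F) (q : Fin (b / m) × Fin (c / s)) : F[X] :=
  ∑ w, expPoly (expA K₁ m X') (encCoeff A R w q.1) * expPoly (expV K₁ m s X') (encCoeff V H w q.2)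

/-- Exponents below `D` and below `D' = s * D` add up to at most `D + D' - 2`; this is where
`threshold` comes from. -/
lemma degree_sum_expPoly_mul_lt {γ α β : Type*} [Fintype γ] [Fintype α] [Fintype β] {e : α → ℕ}
    {e' : β → ℕ} {D D' : ℕ} (he : ∀ i, e i < D) (he' : ∀ i, e' i < D') (f : γ → α → F)
    (g : γ → β → F) :
    (∑ w, expPoly e (f w) * expPoly e' (g w)).degree < (D + D' - 1 : ℕ) := by
  rw [degree_lt_iff_coeff_zero]
  intro E hE
  rw [finsetSum_coeff]
  refine Finset.sum_eq_zero fun w _ => ?_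
  rw [coeff_expPoly_mul]
  refine Finset.sum_eq_zero fun i _ => Finset.sum_eq_zero fun j _ => if_neg ?_
  have := he i
  have := he' j
  omega

lemma threshold_eq : threshold K₁ m s X' = (K₁ * m + X') + s * (K₁ * m + X') - 1 := by
  rw [threshold, Nat.add_mul, Nat.one_mul, Nat.add_comm]

section Phases

variable (A : Matrix (Fin a) (Fin b) F) (U : Matrix (Fin b) (Fin c) F)
  (V : Matrix (Fin a) (Fin c) F) (R : Fin X' → Matrix (Fin (a / K₁)) (Fin (b / m)) F)
  (T : Fin X' → Matrix (Fin (b / m)) (Fin (c / s)) F)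
  (H : Fin X' → Matrix (Fin (a / K₁)) (Fin (c / s)) F)

lemma degree_polyI_lt (hK : 0 < K₁) (hs : 0 < s) (q : Fin (a / K₁) × Fin (c / s)) :
    (polyI A U R T q).degree < (threshold K₁ m s X' : ℕ) := by
  rw [threshold_eq]
  exact degree_sum_expPoly_mul_lt expA_lt (expU_lt hK hs) _ _

lemma degree_polyII_lt (hm : 0 < m) (hs : 0 < s) (q : Fin (b / m) × Fin (c / s)) :
    (polyII A V R H q).degree < (threshold K₁ m s X' : ℕ) := by
  rw [threshold_eq]
  exact degree_sum_expPoly_mul_lt expA_lt (expV_lt hm hs) _ _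

lemma eval_polyI (x : F) (q : Fin (a / K₁) × Fin (c / s)) :
    (polyI A U R T q).eval x = (encA K₁ m X' A R x * encU K₁ m s X' U T x) q.1 q.2 := by
  simp only [polyI, eval_finsetSum, eval_mul, eval_expPoly, Matrix.mul_apply, encA_apply,
    encU_apply]

lemma eval_polyII (x : F) (q : Fin (b / m) × Fin (c / s)) :
    (polyII A V R H q).eval x = ((encA K₁ m X' A R x)ᵀ * encV K₁ m s X' V H x) q.1 q.2 := by
  simp only [polyII, eval_finsetSum, eval_mul, eval_expPoly, Matrix.mul_apply, encA_apply,
    encV_apply, Matrix.transpose_apply]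

lemma coeff_polyI (hm : 0 < m) (hs : 0 < s) (hmb : m ∣ b) (q : Fin (a / K₁) × Fin (c / s))
    (j : Fin K₁) (k : Fin s) :
    (polyI A U R T q).coeff ((m - 1) + j * m + k * (K₁ * m + X')) =
      (A * U) (blockIndex K₁ j q.1) (blockIndex s k q.2) := by
  rw [polyI, finsetSum_coeff, Matrix.mul_apply, sum_blockIndex hmb]
  refine Finset.sum_congr rfl fun w _ => ?_
  rw [coeff_expPoly_mul, sum_ite_eq_sum (φ := fun l : Fin m => Sum.inl (j, l))
    (ψ := fun l => Sum.inl (l, k)) (fun l l' h => by simpa using h)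
    (expA_add_expU_iff hm hs j k)]
  rfl

lemma coeff_polyII (hK : 0 < K₁) (hs : 0 < s) (hKa : K₁ ∣ a) (q : Fin (b / m) × Fin (c / s))
    (l : Fin m) (k : Fin s) :
    (polyII A V R H q).coeff ((K₁ - 1) * m + l + k * (K₁ * m + X')) =
      (Aᵀ * V) (blockIndex m l q.1) (blockIndex s k q.2) := by
  rw [polyII, finsetSum_coeff, Matrix.mul_apply, sum_blockIndex hKa]
  refine Finset.sum_congr rfl fun w _ => ?_
  rw [coeff_expPoly_mul, sum_ite_eq_sum (φ := fun j : Fin K₁ => Sum.inl (j, l))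
    (ψ := fun j => Sum.inl (j, k)) (fun j j' h => by simpa using h)
    (expA_add_expV_iff hK hs l k)]
  rfl

end Phases

/-! ### The programs of the scheme -/

lemma cost_sum_mul {Ω κ ι : Type*} [Fintype κ] [Fintype ι] {S : Set (Ω → F)}
    {f g : κ → ι → Ω → F} (hf : ∀ k i, f k i ∈ S) (hg : ∀ k i, g k i ∈ S) :
    (arith F (Ω → F)).rel S (Fintype.card κ * (2 * Fintype.card ι))
      (Set.range fun k ω => ∑ i, f k i ω * g k i ω) := by
  refine CostRel.range _ fun k => ?_
  have : (fun ω => ∑ i, f k i ω * g k i ω) = ∑ i, f k i * g k i := by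
    funext ω; simp
  rw [this]
  exact arith_dot (hf k) (hg k)

variable (F a b c K₁ m s X')

lemma exists_program_encA (N : ℕ) :
    ∃ P : Program F (Fin N ⊕ (Fin a × Fin b) ⊕ (Fin X' × Fin (a / K₁) × Fin (b / m)))
        (Fin N × Fin (a / K₁) × Fin (b / m)),
      P.cost ≤ N * (K₁ * m + X') + N * ((a / K₁) * (b / m)) * (2 * (K₁ * m + X')) ∧
      ∀ (x : Fin N → F) (A : Matrix (Fin a) (Fin b) F)
        (R : Fin X' → Matrix (Fin (a / K₁)) (Fin (b / m)) F),
        P.Computes (Sum.elim x (Sum.elim (ents A) (famEnts R)))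
          (famEnts fun i => encA K₁ m X' A R (x i)) := by
  let Ω := (Fin N → F) × Matrix (Fin a) (Fin b) F ×
    (Fin X' → Matrix (Fin (a / K₁)) (Fin (b / m)) F)
  obtain ⟨P, hc, hP⟩ := exists_program (F := F) (Ω := Ω)
    (fun ω => Sum.elim ω.1 (Sum.elim (ents ω.2.1) (famEnts ω.2.2)))
    (fun ω => famEnts fun i => encA K₁ m X' ω.2.1 ω.2.2 (ω.1 i))
    (n := N * (K₁ * m + X') + N * ((a / K₁) * (b / m)) * (2 * (K₁ * m + X'))) (by
      have h1 := (arith F (Ω → F)).biUnion (S := Set.range fun i (ω : Ω) =>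
        (Sum.elim ω.1 (Sum.elim (ents ω.2.1) (famEnts ω.2.2)) :
          Fin N ⊕ (Fin a × Fin b) ⊕ (Fin X' × Fin (a / K₁) × Fin (b / m)) → F) i)
        (Finset.univ : Finset (Fin N))
        (fun i => {f : Ω → F | ∃ e < K₁ * m + X', f = (fun ω => ω.1 i) ^ e}) (K₁ * m + X')
        -- The points are inputs here, so the `K₁ * m + X'` powers of each are paid for before the
        -- dot products.
        fun i _ => arith_powers (Set.mem_range_self (Sum.inl i)) _
      rw [Finset.card_univ, Fintype.card_fin] at h1
      refine (arith F (Ω → F)).andThen h1 ?_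
      have h2 := cost_sum_mul (F := F) (Ω := Ω) (κ := Fin N × Fin (a / K₁) × Fin (b / m))
        (ι := (Fin K₁ × Fin m) ⊕ Fin X') (S := (Set.range fun i (ω : Ω) =>
        (Sum.elim ω.1 (Sum.elim (ents ω.2.1) (famEnts ω.2.2)) :
          Fin N ⊕ (Fin a × Fin b) ⊕ (Fin X' × Fin (a / K₁) × Fin (b / m)) → F) i) ∪
          ⋃ i ∈ (Finset.univ : Finset (Fin N)),
            {f : Ω → F | ∃ e < K₁ * m + X', f = (fun ω => ω.1 i) ^ e})
        (f := fun k α ω => ω.1 k.1 ^ expA K₁ m X' α)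
        (g := fun k α ω => encCoeff ω.2.1 ω.2.2 k.2.1 k.2.2 α)
        (fun k α => by
          right
          simp only [Set.mem_iUnion]
          exact ⟨k.1, Finset.mem_univ _, _, expA_lt α, rfl⟩)
        (fun k α => by
          left
          rcases α with q | i
          · exact ⟨.inr (.inl (blockIndex K₁ q.1 k.2.1, blockIndex m q.2 k.2.2)), rfl⟩
          · exact ⟨.inr (.inr (i, k.2)), rfl⟩)
      refine (arith F (Ω → F)).mono subset_rfl (le_of_eq (by simp)) (le_of_eq ?_) h2
      congr 1
      funext k ω
      exact encA_apply _ _ _ _ _)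
  exact ⟨P, hc, fun x A R => hP (x, A, R)⟩

/-- All exponents lie below `s * (K₁ * m + X')`, so every power is read from the table and only dot
products of length `m * s + X'` are paid for. -/
lemma exists_program_encU (N : ℕ) (hK : 0 < K₁) (hs : 0 < s) :
    ∃ P : Program F ((Fin N × Fin (s * (K₁ * m + X'))) ⊕ (Fin b × Fin c) ⊕
          (Fin X' × Fin (b / m) × Fin (c / s)))
        (Fin N × Fin (b / m) × Fin (c / s)),
      P.cost ≤ N * ((b / m) * (c / s)) * (2 * (m * s + X')) ∧
      ∀ (x : Fin N → F) (U : Matrix (Fin b) (Fin c) F)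
        (T : Fin X' → Matrix (Fin (b / m)) (Fin (c / s)) F),
        P.Computes (Sum.elim (powerTable (s * (K₁ * m + X')) x) (Sum.elim (ents U) (famEnts T)))
          (famEnts fun i => encU K₁ m s X' U T (x i)) := by
  let Ω := (Fin N → F) × Matrix (Fin b) (Fin c) F ×
    (Fin X' → Matrix (Fin (b / m)) (Fin (c / s)) F)
  obtain ⟨P, hc, hP⟩ := exists_program (F := F) (Ω := Ω)
    (fun ω => Sum.elim (powerTable (s * (K₁ * m + X')) ω.1)
      (Sum.elim (ents ω.2.1) (famEnts ω.2.2)))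
    (fun ω => famEnts fun i => encU K₁ m s X' ω.2.1 ω.2.2 (ω.1 i))
    (n := N * ((b / m) * (c / s)) * (2 * (m * s + X'))) (by
      have h2 := cost_sum_mul (F := F) (Ω := Ω) (κ := Fin N × Fin (b / m) × Fin (c / s))
        (ι := (Fin m × Fin s) ⊕ Fin X') (S := Set.range fun i (ω : Ω) =>
          (Sum.elim (powerTable (s * (K₁ * m + X')) ω.1) (Sum.elim (ents ω.2.1) (famEnts ω.2.2)) :
            (Fin N × Fin (s * (K₁ * m + X'))) ⊕ (Fin b × Fin c) ⊕
              (Fin X' × Fin (b / m) × Fin (c / s)) → F) i)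
        (f := fun k α ω => ω.1 k.1 ^ expU K₁ m s X' α)
        (g := fun k α ω => encCoeff ω.2.1 ω.2.2 k.2.1 k.2.2 α)
        (fun k α => ⟨.inl (k.1, ⟨_, expU_lt hK hs α⟩), rfl⟩)
        (fun k α => by
          rcases α with q | i
          · exact ⟨.inr (.inl (blockIndex m q.1 k.2.1, blockIndex s q.2 k.2.2)), rfl⟩
          · exact ⟨.inr (.inr (i, k.2)), rfl⟩)
      refine (arith F (Ω → F)).mono subset_rfl (le_of_eq (by simp)) (le_of_eq ?_) h2
      congr 1
      funext k ω
      exact encU_apply _ _ _ _ _)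
  exact ⟨P, hc, fun x U T => hP (x, U, T)⟩

lemma exists_program_encV (N : ℕ) (hm : 0 < m) (hs : 0 < s) :
    ∃ P : Program F ((Fin N × Fin (s * (K₁ * m + X'))) ⊕ (Fin a × Fin c) ⊕
          (Fin X' × Fin (a / K₁) × Fin (c / s)))
        (Fin N × Fin (a / K₁) × Fin (c / s)),
      P.cost ≤ N * ((a / K₁) * (c / s)) * (2 * (K₁ * s + X')) ∧
      ∀ (x : Fin N → F) (V : Matrix (Fin a) (Fin c) F)
        (H : Fin X' → Matrix (Fin (a / K₁)) (Fin (c / s)) F),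
        P.Computes (Sum.elim (powerTable (s * (K₁ * m + X')) x) (Sum.elim (ents V) (famEnts H)))
          (famEnts fun i => encV K₁ m s X' V H (x i)) := by
  let Ω := (Fin N → F) × Matrix (Fin a) (Fin c) F ×
    (Fin X' → Matrix (Fin (a / K₁)) (Fin (c / s)) F)
  obtain ⟨P, hc, hP⟩ := exists_program (F := F) (Ω := Ω)
    (fun ω => Sum.elim (powerTable (s * (K₁ * m + X')) ω.1)
      (Sum.elim (ents ω.2.1) (famEnts ω.2.2)))
    (fun ω => famEnts fun i => encV K₁ m s X' ω.2.1 ω.2.2 (ω.1 i))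
    (n := N * ((a / K₁) * (c / s)) * (2 * (K₁ * s + X'))) (by
      have h2 := cost_sum_mul (F := F) (Ω := Ω) (κ := Fin N × Fin (a / K₁) × Fin (c / s))
        (ι := (Fin K₁ × Fin s) ⊕ Fin X') (S := Set.range fun i (ω : Ω) =>
          (Sum.elim (powerTable (s * (K₁ * m + X')) ω.1) (Sum.elim (ents ω.2.1) (famEnts ω.2.2)) :
            (Fin N × Fin (s * (K₁ * m + X'))) ⊕ (Fin a × Fin c) ⊕
              (Fin X' × Fin (a / K₁) × Fin (c / s)) → F) i)
        (f := fun k α ω => ω.1 k.1 ^ expV K₁ m s X' α)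
        (g := fun k α ω => encCoeff ω.2.1 ω.2.2 k.2.1 k.2.2 α)
        (fun k α => ⟨.inl (k.1, ⟨_, expV_lt hm hs α⟩), rfl⟩)
        (fun k α => by
          rcases α with q | i
          · exact ⟨.inr (.inl (blockIndex K₁ q.1 k.2.1, blockIndex s q.2 k.2.2)), rfl⟩
          · exact ⟨.inr (.inr (i, k.2)), rfl⟩)
      refine (arith F (Ω → F)).mono subset_rfl (le_of_eq (by simp)) (le_of_eq ?_) h2
      congr 1
      funext k ω
      exact encV_apply _ _ _ _ _)
  exact ⟨P, hc, fun x V H => hP (x, V, H)⟩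

end Scheme

/-! ### Programs for families of dot products of inputs -/

section Bilinear

variable {F : Type*} [Field F] {ι κ : Type*} [Fintype κ]

lemma arith_range_dot {γ : Type*} [Fintype γ] (l r : κ → γ → ι) :
    (arith F ((ι → F) → F)).rel (Set.range fun i inp => inp i)
      (Fintype.card κ * (2 * Fintype.card γ))
      (Set.range fun k inp => ∑ w, inp (l k w) * inp (r k w)) :=
  cost_sum_mul (Ω := ι → F) (f := fun k w inp => inp (l k w)) (g := fun k w inp => inp (r k w))
    (fun k w => ⟨l k w, rfl⟩) fun k w => ⟨r k w, rfl⟩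

/-- Sums of products of two inputs each are computed at the obvious cost. -/
lemma exists_program_dot {γ : Type*} [Fintype γ] (l r : κ → γ → ι) :
    ∃ P : Program F ι κ, P.cost ≤ Fintype.card κ * (2 * Fintype.card γ) ∧
      ∀ inp, P.Computes inp fun k => ∑ w, inp (l k w) * inp (r k w) :=
  exists_program (F := F) (fun inp : ι → F => inp) _ (arith_range_dot l r)

/-- Two families of sums of products of inputs are computed at the obvious cost. -/
lemma exists_program_dot_sum {κ' γ γ' : Type*} [Fintype κ'] [Fintype γ] [Fintype γ']
    (l r : κ → γ → ι) (l' r' : κ' → γ' → ι) :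
    ∃ P : Program F ι (κ ⊕ κ'),
      P.cost ≤ Fintype.card κ * (2 * Fintype.card γ) + Fintype.card κ' * (2 * Fintype.card γ') ∧
      ∀ inp, P.Computes inp (Sum.elim (fun k => ∑ w, inp (l k w) * inp (r k w))
        fun k => ∑ w, inp (l' k w) * inp (r' k w)) := by
  refine exists_program (F := F) (fun inp : ι → F => inp) _ ?_
  refine (arith F ((ι → F) → F)).mono subset_rfl le_rfl ?_
    ((arith F ((ι → F) → F)).union (arith_range_dot (F := F) l r) (arith_range_dot (F := F) l' r'))
  rintro _ ⟨k | k, rfl⟩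
  · exact .inl ⟨k, rfl⟩
  · exact .inr ⟨k, rfl⟩

/-- Two families of sums of products of inputs are compared at the obvious cost. -/
lemma exists_checkProgram_dot {γ γ' : Type*} [Fintype γ] [Fintype γ'] (l r : κ → γ → ι)
    (l' r' : κ → γ' → ι) :
    ∃ P : CheckProgram F ι,
      P.cost ≤ Fintype.card κ * (2 * Fintype.card γ) + Fintype.card κ * (2 * Fintype.card γ') +
        Fintype.card κ ∧
      ∀ inp, P.Decides inp ((fun k => ∑ w, inp (l k w) * inp (r k w)) =
        fun k => ∑ w, inp (l' k w) * inp (r' k w)) := by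
  refine exists_checkProgram (F := F) (fun inp : ι → F => inp) _ _ ?_
  exact (arith F _).union (arith_range_dot l r) (arith_range_dot l' r')

end Bilinear

/-! ### Check vectors, worker products and Freivalds checks -/

section Workers

variable (F : Type*) [Field F] (p q r N : ℕ)

lemma exists_program_checkVectors :
    ∃ P : Program F ((Fin N × Fin p × Fin q) ⊕ (Fin N × Fin p) ⊕ (Fin N × Fin q))
        ((Fin N × Fin q) ⊕ (Fin N × Fin p)),
      P.cost ≤ 4 * (N * (p * q)) ∧
      ∀ (M : Fin N → Matrix (Fin p) (Fin q) F) (r₁ : Fin N → Fin p → F) (r₂ : Fin N → Fin q → F),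
        P.Computes (Sum.elim (famEnts M) (Sum.elim (famVec r₁) (famVec r₂)))
          (Sum.elim (famVec fun i => r₁ i ᵥ* M i) (famVec fun i => r₂ i ᵥ* (M i)ᵀ)) := by
  obtain ⟨P, hc, hP⟩ := exists_program_dot_sum (F := F)
    (ι := (Fin N × Fin p × Fin q) ⊕ (Fin N × Fin p) ⊕ (Fin N × Fin q))
    (κ := Fin N × Fin q) (κ' := Fin N × Fin p) (γ := Fin p) (γ' := Fin q)
    (fun k w => .inr (.inl (k.1, w))) (fun k w => .inl (k.1, w, k.2))
    (fun k w => .inr (.inr (k.1, w))) (fun k w => .inl (k.1, k.2, w))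
  exact ⟨P, hc.trans (le_of_eq (by simp; ring)), fun M r₁ r₂ => hP _⟩

lemma exists_program_mul :
    ∃ P : Program F (Fin (p * q) ⊕ (Fin q × Fin r)) (Fin p × Fin r),
      P.cost ≤ 2 * (p * q * r) ∧
      ∀ (M : Matrix (Fin p) (Fin q) F) (M' : Matrix (Fin q) (Fin r) F),
        P.Computes (Sum.elim (ents M ∘ finProdFinEquiv.symm) (ents M')) (ents (M * M')) := by
  obtain ⟨P, hc, hP⟩ := exists_program_dot (F := F) (ι := Fin (p * q) ⊕ (Fin q × Fin r))
    (κ := Fin p × Fin r) (γ := Fin q)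
    (fun k w => .inl (finProdFinEquiv (k.1, w))) (fun k w => .inr (w, k.2))
  refine ⟨P, hc.trans (le_of_eq (by simp; ring)), fun M M' => ?_⟩
  convert hP _ using 1
  funext k
  simp [ents, Matrix.mul_apply]

/-- The stored matrix is read through the same linear layout as in `exists_program_mul`, only with
its indices exchanged; no second copy is needed. -/
lemma exists_program_transpose_mul :
    ∃ P : Program F (Fin (p * q) ⊕ (Fin p × Fin r)) (Fin q × Fin r),
      P.cost ≤ 2 * (p * q * r) ∧
      ∀ (M : Matrix (Fin p) (Fin q) F) (M' : Matrix (Fin p) (Fin r) F),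
        P.Computes (Sum.elim (ents M ∘ finProdFinEquiv.symm) (ents M')) (ents (Mᵀ * M')) := by
  obtain ⟨P, hc, hP⟩ := exists_program_dot (F := F) (ι := Fin (p * q) ⊕ (Fin p × Fin r))
    (κ := Fin q × Fin r) (γ := Fin p)
    (fun k w => .inl (finProdFinEquiv (w, k.1))) (fun k w => .inr (w, k.2))
  refine ⟨P, hc.trans (le_of_eq (by simp; ring)), fun M M' => ?_⟩
  convert hP _ using 1
  funext k
  simp [ents, Matrix.mul_apply]

/-- The Freivalds check. -/
lemma exists_checkProgram_vecMul :
    ∃ P : CheckProgram F ((Fin p ⊕ Fin q) ⊕ (Fin p × Fin r) ⊕ (Fin q × Fin r)),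
      P.cost ≤ r * (2 * p) + r * (2 * q) + r ∧
      ∀ (y : Fin p → F) (z : Fin q → F) (M : Matrix (Fin p) (Fin r) F)
        (M' : Matrix (Fin q) (Fin r) F),
        P.Decides (Sum.elim (Sum.elim y z) (Sum.elim (ents M) (ents M'))) (y ᵥ* M = z ᵥ* M') := by
  obtain ⟨P, hc, hP⟩ := exists_checkProgram_dot (F := F)
    (ι := (Fin p ⊕ Fin q) ⊕ (Fin p × Fin r) ⊕ (Fin q × Fin r)) (κ := Fin r)
    (γ := Fin p) (γ' := Fin q)
    (fun _ w => .inl (.inl w)) (fun k w => .inr (.inl (w, k)))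
    (fun _ w => .inl (.inr w)) (fun k w => .inr (.inr (w, k)))
  exact ⟨P, by simpa using hc, fun y z M M' => hP _⟩

end Workers

/-! ### Decoding by interpolating every entry of the responses -/

section Decoding

variable (F : Type*) [Field F] {a b c K₁ m s : ℕ} (X' N : ℕ)

lemma exists_program_decodeI (hm : 0 < m) (hK : 0 < K₁) (hs : 0 < s) (hKa : K₁ ∣ a) (hmb : m ∣ b)
    (hsc : s ∣ c) (h0 : 0 < threshold K₁ m s X') {k : ℕ} (hk : threshold K₁ m s X' ≤ 2 ^ k) :
    ∃ P : Program F (Fin (threshold K₁ m s X') ⊕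
        (Fin (threshold K₁ m s X') × Fin (a / K₁) × Fin (c / s))) (Fin a × Fin c),
      P.cost ≤ (a / K₁) * (c / s) * interpTime k ∧
      ∀ (x : Fin N → F), Function.Injective x → ∀ (τ : Fin (threshold K₁ m s X') ↪ Fin N)
        (A : Matrix (Fin a) (Fin b) F) (U : Matrix (Fin b) (Fin c) F)
        (R : Fin X' → Matrix (Fin (a / K₁)) (Fin (b / m)) F)
        (T : Fin X' → Matrix (Fin (b / m)) (Fin (c / s)) F),
        P.Computes (Sum.elim (x ∘ τ) (famEnts fun i =>
          encA K₁ m X' A R (x (τ i)) * encU K₁ m s X' U T (x (τ i)))) (ents (A * U)) := by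
  let Ω := {x : Fin (threshold K₁ m s X') → F // Function.Injective x} ×
    Matrix (Fin a) (Fin b) F × Matrix (Fin b) (Fin c) F ×
    (Fin X' → Matrix (Fin (a / K₁)) (Fin (b / m)) F) ×
    (Fin X' → Matrix (Fin (b / m)) (Fin (c / s)) F)
  let row := (Equiv.ofBijective _ (blockIndex_bijective hKa)).symm
  let col := (Equiv.ofBijective _ (blockIndex_bijective hsc)).symm
  obtain ⟨P, hc, hP⟩ := exists_interpolation_program (F := F) (Ω := Ω) h0 hk
    (fun ω => ω.1.1) (fun ω => ω.1.2) (ε := Fin (a / K₁) × Fin (c / s)) (κ := Fin a × Fin c)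
    (fun ω => polyI ω.2.1 ω.2.2.1 ω.2.2.2.1 ω.2.2.2.2)
    (fun ω q => degree_polyI_lt _ _ _ _ hK hs q)
    -- The position of an output entry inside its block selects the interpolated polynomial; the
    -- indices of the block select the coefficient.
    (fun q => (((row q.1).2, (col q.2).2),
      (m - 1) + (row q.1).1 * m + (col q.2).1 * (K₁ * m + X')))
  refine ⟨P, by simpa using hc, fun x hx τ A U R T => ?_⟩
  convert hP ⟨⟨x ∘ τ, hx.comp τ.injective⟩, A, U, R, T⟩ using 1
  · congr 1
    funext q
    exact (eval_polyI A U R T _ _).symm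
  · funext q
    have hr : blockIndex K₁ (row q.1).1 (row q.1).2 = q.1 :=
      (Equiv.ofBijective _ (blockIndex_bijective hKa)).apply_symm_apply q.1
    have hq : blockIndex s (col q.2).1 (col q.2).2 = q.2 :=
      (Equiv.ofBijective _ (blockIndex_bijective hsc)).apply_symm_apply q.2
    rw [coeff_polyI A U R T hm hs hmb, hr, hq]
    rfl

lemma exists_program_decodeII (hm : 0 < m) (hK : 0 < K₁) (hs : 0 < s) (hKa : K₁ ∣ a) (hmb : m ∣ b)
    (hsc : s ∣ c) (h0 : 0 < threshold K₁ m s X') {k : ℕ} (hk : threshold K₁ m s X' ≤ 2 ^ k) :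
    ∃ P : Program F (Fin (threshold K₁ m s X') ⊕
        (Fin (threshold K₁ m s X') × Fin (b / m) × Fin (c / s))) (Fin b × Fin c),
      P.cost ≤ (b / m) * (c / s) * interpTime k ∧
      ∀ (x : Fin N → F), Function.Injective x → ∀ (τ : Fin (threshold K₁ m s X') ↪ Fin N)
        (A : Matrix (Fin a) (Fin b) F) (V : Matrix (Fin a) (Fin c) F)
        (R : Fin X' → Matrix (Fin (a / K₁)) (Fin (b / m)) F)
        (H : Fin X' → Matrix (Fin (a / K₁)) (Fin (c / s)) F),
        P.Computes (Sum.elim (x ∘ τ) (famEnts fun i =>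
          (encA K₁ m X' A R (x (τ i)))ᵀ * encV K₁ m s X' V H (x (τ i)))) (ents (Aᵀ * V)) := by
  let Ω := {x : Fin (threshold K₁ m s X') → F // Function.Injective x} ×
    Matrix (Fin a) (Fin b) F × Matrix (Fin a) (Fin c) F ×
    (Fin X' → Matrix (Fin (a / K₁)) (Fin (b / m)) F) ×
    (Fin X' → Matrix (Fin (a / K₁)) (Fin (c / s)) F)
  let row := (Equiv.ofBijective _ (blockIndex_bijective hmb)).symm
  let col := (Equiv.ofBijective _ (blockIndex_bijective hsc)).symm
  obtain ⟨P, hc, hP⟩ := exists_interpolation_program (F := F) (Ω := Ω) h0 hk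
    (fun ω => ω.1.1) (fun ω => ω.1.2) (ε := Fin (b / m) × Fin (c / s)) (κ := Fin b × Fin c)
    (fun ω => polyII ω.2.1 ω.2.2.1 ω.2.2.2.1 ω.2.2.2.2)
    (fun ω q => degree_polyII_lt _ _ _ _ hm hs q)
    (fun q => (((row q.1).2, (col q.2).2),
      (K₁ - 1) * m + (row q.1).1 + (col q.2).1 * (K₁ * m + X')))
  refine ⟨P, by simpa using hc, fun x hx τ A V R H => ?_⟩
  convert hP ⟨⟨x ∘ τ, hx.comp τ.injective⟩, A, V, R, H⟩ using 1
  · congr 1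
    funext q
    exact (eval_polyII A V R H _ _).symm
  · funext q
    have hr : blockIndex m (row q.1).1 (row q.1).2 = q.1 :=
      (Equiv.ofBijective _ (blockIndex_bijective hmb)).apply_symm_apply q.1
    have hq : blockIndex s (col q.2).1 (col q.2).2 = q.2 :=
      (Equiv.ofBijective _ (blockIndex_bijective hsc)).apply_symm_apply q.2
    rw [coeff_polyII A V R H hK hs hKa, hr, hq]
    rfl

end Decoding

end CodedMM

/-! ### Assembly of the theorem -/

open CodedMM Matrix in
theorem mainTheorem11 :
    ∃ C : ℝ, 0 < C ∧
      ∀ (F : Type*) [Field F] (a b c K₁ m s X N : ℕ),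
        0 < a → 0 < b → 0 < c → 0 < K₁ → 0 < m → 0 < s → K₁ ∣ a → m ∣ b → s ∣ c →
        -- (1) encoding `A` for all `N` workers, the evaluation points being inputs
        (∃ P : Program F
            (Fin N ⊕ (Fin a × Fin b) ⊕ (Fin X × Fin (a / K₁) × Fin (b / m)))
            (Fin N × Fin (a / K₁) × Fin (b / m)),
          (P.cost : ℝ) ≤ C * (((K₁ * m + X : ℝ) / (K₁ * m)) * N * a * b) ∧
          ∀ (x : Fin N → F) (A : Matrix (Fin a) (Fin b) F)
            (R : Fin X → Matrix (Fin (a / K₁)) (Fin (b / m)) F),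
            P.Computes (Sum.elim x (Sum.elim (ents A) (famEnts R)))
              (famEnts fun i => encA K₁ m X A R (x i))) ∧
        -- (2) the check vectors `r¹ᵢ Āᵢ` and `r²ᵢ Āᵢᵀ` for all `N` workers
        (∃ P : Program F
            ((Fin N × Fin (a / K₁) × Fin (b / m)) ⊕
              (Fin N × Fin (a / K₁)) ⊕ (Fin N × Fin (b / m)))
            ((Fin N × Fin (b / m)) ⊕ (Fin N × Fin (a / K₁))),
          (P.cost : ℝ) ≤ C * ((a * b * N : ℝ) / (K₁ * m)) ∧
          ∀ (Abar : Fin N → Matrix (Fin (a / K₁)) (Fin (b / m)) F)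
            (r₁ : Fin N → Fin (a / K₁) → F) (r₂ : Fin N → Fin (b / m) → F),
            P.Computes (Sum.elim (famEnts Abar) (Sum.elim (famVec r₁) (famVec r₂)))
              (Sum.elim (famVec fun i => r₁ i ᵥ* Abar i)
                (famVec fun i => r₂ i ᵥ* (Abar i)ᵀ))) ∧
        -- (3), (7) a worker stores `S = ab / (K₁ m)` field elements, the entries of `Āᵢ`;
        -- this one memory serves the computations of both phases
        (∃ (S : ℕ) (layout : Fin S ≃ Fin (a / K₁) × Fin (b / m)),
          (S : ℝ) = (a * b : ℝ) / (K₁ * m) ∧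
          (∃ P : Program F (Fin S ⊕ (Fin (b / m) × Fin (c / s)))
              (Fin (a / K₁) × Fin (c / s)),
            (P.cost : ℝ) ≤ C * ((a * b * c : ℝ) / (K₁ * m * s)) ∧
            ∀ (Abar : Matrix (Fin (a / K₁)) (Fin (b / m)) F)
              (Ubar : Matrix (Fin (b / m)) (Fin (c / s)) F),
              P.Computes (Sum.elim (ents Abar ∘ layout) (ents Ubar)) (ents (Abar * Ubar))) ∧
          (∃ P : Program F (Fin S ⊕ (Fin (a / K₁) × Fin (c / s)))
              (Fin (b / m) × Fin (c / s)),
            (P.cost : ℝ) ≤ C * ((a * b * c : ℝ) / (K₁ * m * s)) ∧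
            ∀ (Abar : Matrix (Fin (a / K₁)) (Fin (b / m)) F)
              (Vbar : Matrix (Fin (a / K₁)) (Fin (c / s)) F),
              P.Computes (Sum.elim (ents Abar ∘ layout) (ents Vbar))
                (ents (Abarᵀ * Vbar)))) ∧
        -- (4) the Freivalds check of one response, phases I and II
        (∃ P : CheckProgram F
            ((Fin (a / K₁) ⊕ Fin (b / m)) ⊕
              (Fin (a / K₁) × Fin (c / s)) ⊕ (Fin (b / m) × Fin (c / s))),
          (P.cost : ℝ) ≤ C * ((c : ℝ) / s * ((a : ℝ) / K₁ + (b : ℝ) / m)) ∧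
          ∀ (r₁ : Fin (a / K₁) → F) (s₁ : Fin (b / m) → F)
            (lam : Matrix (Fin (a / K₁)) (Fin (c / s)) F)
            (Ubar : Matrix (Fin (b / m)) (Fin (c / s)) F),
            P.Decides (Sum.elim (Sum.elim r₁ s₁) (Sum.elim (ents lam) (ents Ubar)))
              (r₁ ᵥ* lam = s₁ ᵥ* Ubar)) ∧
        (∃ P : CheckProgram F
            ((Fin (b / m) ⊕ Fin (a / K₁)) ⊕
              (Fin (b / m) × Fin (c / s)) ⊕ (Fin (a / K₁) × Fin (c / s))),
          (P.cost : ℝ) ≤ C * ((c : ℝ) / s * ((a : ℝ) / K₁ + (b : ℝ) / m)) ∧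
          ∀ (r₂ : Fin (b / m) → F) (s₂ : Fin (a / K₁) → F)
            (mu : Matrix (Fin (b / m)) (Fin (c / s)) F)
            (Vbar : Matrix (Fin (a / K₁)) (Fin (c / s)) F),
            P.Decides (Sum.elim (Sum.elim r₂ s₂) (Sum.elim (ents mu) (ents Vbar)))
              (r₂ ᵥ* mu = s₂ ᵥ* Vbar)) ∧
        -- (5) encoding `U` and encoding `V` for all `N` workers, in every iteration; the
        -- points are fixed beforehand and the powers of them that occur are tabulated
        (∃ P : Program F
            ((Fin N × Fin (s * (K₁ * m + X))) ⊕ (Fin b × Fin c) ⊕ (Fin X × Fin (b / m) × Fin (c / s)))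
            (Fin N × Fin (b / m) × Fin (c / s)),
          (P.cost : ℝ) ≤ C * (((m * s + X : ℝ) / (m * s)) * N * b * c) ∧
          ∀ (x : Fin N → F) (U : Matrix (Fin b) (Fin c) F)
            (T : Fin X → Matrix (Fin (b / m)) (Fin (c / s)) F),
            P.Computes (Sum.elim (powerTable (s * (K₁ * m + X)) x) (Sum.elim (ents U) (famEnts T)))
              (famEnts fun i => encU K₁ m s X U T (x i))) ∧
        (∃ P : Program F
            ((Fin N × Fin (s * (K₁ * m + X))) ⊕ (Fin a × Fin c) ⊕ (Fin X × Fin (a / K₁) × Fin (c / s)))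
            (Fin N × Fin (a / K₁) × Fin (c / s)),
          (P.cost : ℝ) ≤ C * (((K₁ * s + X : ℝ) / (K₁ * s)) * N * a * c) ∧
          ∀ (x : Fin N → F) (V : Matrix (Fin a) (Fin c) F)
            (H : Fin X → Matrix (Fin (a / K₁)) (Fin (c / s)) F),
            P.Computes (Sum.elim (powerTable (s * (K₁ * m + X)) x) (Sum.elim (ents V) (famEnts H)))
              (famEnts fun i => encV K₁ m s X V H (x i))) ∧
        -- (6) decoding from the responses of any `n = (s + 1)(K₁ m + X) - 1` workers, whose
        -- evaluation points are inputs, phases I and II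
        (3 ≤ threshold K₁ m s X →
          (∃ P : Program F
              (Fin (threshold K₁ m s X) ⊕
                (Fin (threshold K₁ m s X) × Fin (a / K₁) × Fin (c / s)))
              (Fin a × Fin c),
            (P.cost : ℝ) ≤ C * ((a * c : ℝ) / (K₁ * s) * threshold K₁ m s X *
              Real.log (threshold K₁ m s X) ^ 2 *
              Real.log (Real.log (threshold K₁ m s X))) ∧
            ∀ (x : Fin N → F), Function.Injective x →
            ∀ (τ : Fin (threshold K₁ m s X) ↪ Fin N)
              (A : Matrix (Fin a) (Fin b) F) (U : Matrix (Fin b) (Fin c) F)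
              (R : Fin X → Matrix (Fin (a / K₁)) (Fin (b / m)) F)
              (T : Fin X → Matrix (Fin (b / m)) (Fin (c / s)) F),
              P.Computes
                (Sum.elim (x ∘ τ) (famEnts fun i =>
                  encA K₁ m X A R (x (τ i)) * encU K₁ m s X U T (x (τ i))))
                (ents (A * U))) ∧
          (∃ P : Program F
              (Fin (threshold K₁ m s X) ⊕
                (Fin (threshold K₁ m s X) × Fin (b / m) × Fin (c / s)))
              (Fin b × Fin c),
            (P.cost : ℝ) ≤ C * ((b * c : ℝ) / (m * s) * threshold K₁ m s X *
              Real.log (threshold K₁ m s X) ^ 2 *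
              Real.log (Real.log (threshold K₁ m s X))) ∧
            ∀ (x : Fin N → F), Function.Injective x →
            ∀ (τ : Fin (threshold K₁ m s X) ↪ Fin N)
              (A : Matrix (Fin a) (Fin b) F) (V : Matrix (Fin a) (Fin c) F)
              (R : Fin X → Matrix (Fin (a / K₁)) (Fin (b / m)) F)
              (H : Fin X → Matrix (Fin (a / K₁)) (Fin (c / s)) F),
              P.Computes
                (Sum.elim (x ∘ τ) (famEnts fun i =>
                  (encA K₁ m X A R (x (τ i)))ᵀ * encV K₁ m s X V H (x (τ i))))
                (ents (Aᵀ * V)))) := by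
  obtain ⟨C, hC, hI⟩ := exists_interpTime_le
  -- `C` serves decoding, and `4` covers every explicit count, for instance the two operations per
  -- term in each of the two families of check vectors.
  refine ⟨C + 4, by linarith, ?_⟩
  intro F _ a b c K₁ m s X N ha hb hc hK hm hs hKa hmb hsc
  have hK' : (0 : ℝ) < K₁ := by exact_mod_cast hK
  have hm' : (0 : ℝ) < m := by exact_mod_cast hm
  have hs' : (0 : ℝ) < s := by exact_mod_cast hs
  have eA : (a : ℝ) = K₁ * (a / K₁ : ℕ) := by exact_mod_cast (Nat.mul_div_cancel' hKa).symm
  have eB : (b : ℝ) = m * (b / m : ℕ) := by exact_mod_cast (Nat.mul_div_cancel' hmb).symm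
  have eC : (c : ℝ) = s * (c / s : ℕ) := by exact_mod_cast (Nat.mul_div_cancel' hsc).symm
  -- Blocks are nonempty, so the powers of the points in item 1 and the equality tests in item 4 are
  -- absorbed by the main terms.
  have hA : (1 : ℝ) ≤ (a / K₁ : ℕ) := by
    exact_mod_cast Nat.div_pos (Nat.le_of_dvd ha hKa) hK
  have hB : (1 : ℝ) ≤ (b / m : ℕ) := by
    exact_mod_cast Nat.div_pos (Nat.le_of_dvd hb hmb) hm
  have hle : ∀ {P : ℕ} {B B' : ℝ}, (P : ℝ) ≤ 4 * B → 0 ≤ B → B' = B → (P : ℝ) ≤ (C + 4) * B' := by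
    rintro P B _ h1 h2 rfl
    nlinarith [mul_nonneg hC.le h2]
  have hle' : ∀ {n P : ℕ} {B B' : ℝ}, P ≤ n → (n : ℝ) ≤ 4 * B → 0 ≤ B → B' = B →
      (P : ℝ) ≤ (C + 4) * B' := fun h h1 => hle (le_trans (by exact_mod_cast h) h1)
  refine ⟨?_, ?_, ?_, ?_, ?_, ?_, ?_, ?_⟩
  · obtain ⟨P, hc, hP⟩ := exists_program_encA F a b K₁ m X N
    refine ⟨P, hle' hc (B := (K₁ * m + X) * (N * ((a / K₁ : ℕ) * (b / m : ℕ)))) ?_ (by positivity)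
      ?_, hP⟩
    · push_cast
      have h1 : (1 : ℝ) ≤ (a / K₁ : ℕ) * (b / m : ℕ) := one_le_mul_of_one_le_of_one_le hA hB
      have h2 : (0 : ℝ) ≤ N * (K₁ * m + X) := by positivity
      nlinarith [mul_le_mul_of_nonneg_left h1 h2, mul_nonneg h2 (zero_le_one.trans h1)]
    · rw [eA, eB]
      field_simp
  · obtain ⟨P, hc, hP⟩ := exists_program_checkVectors F (a / K₁) (b / m) N
    refine ⟨P, hle' hc (B := N * ((a / K₁ : ℕ) * (b / m : ℕ))) (le_of_eq (by push_cast; ring))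
      (by positivity) ?_, hP⟩
    rw [eA, eB]
    field_simp
  · refine ⟨(a / K₁) * (b / m), finProdFinEquiv.symm, ?_, ?_, ?_⟩
    · push_cast
      rw [eA, eB]
      field_simp
    · obtain ⟨P, hc, hP⟩ := exists_program_mul F (a / K₁) (b / m) (c / s)
      refine ⟨P, hle' hc (B := (a / K₁ : ℕ) * (b / m : ℕ) * (c / s : ℕ)) ?_ (by positivity) ?_, hP⟩
      · push_cast
        have : (0 : ℝ) ≤ (a / K₁ : ℕ) * (b / m : ℕ) * (c / s : ℕ) := by positivity
        linarith
      · rw [eA, eB, eC]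
        field_simp
    · obtain ⟨P, hc, hP⟩ := exists_program_transpose_mul F (a / K₁) (b / m) (c / s)
      refine ⟨P, hle' hc (B := (a / K₁ : ℕ) * (b / m : ℕ) * (c / s : ℕ)) ?_ (by positivity) ?_, hP⟩
      · push_cast
        have : (0 : ℝ) ≤ (a / K₁ : ℕ) * (b / m : ℕ) * (c / s : ℕ) := by positivity
        linarith
      · rw [eA, eB, eC]
        field_simp
  · obtain ⟨P, hc, hP⟩ := exists_checkProgram_vecMul F (a / K₁) (b / m) (c / s)
    refine ⟨P, hle' hc (B := (c / s : ℕ) * ((a / K₁ : ℕ) + (b / m : ℕ))) ?_ (by positivity) ?_, hP⟩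
    · push_cast
      nlinarith [mul_le_mul_of_nonneg_left hA (Nat.cast_nonneg (α := ℝ) (c / s)),
        mul_le_mul_of_nonneg_left hB (Nat.cast_nonneg (α := ℝ) (c / s))]
    · rw [eA, eB, eC]
      field_simp
  · obtain ⟨P, hc, hP⟩ := exists_checkProgram_vecMul F (b / m) (a / K₁) (c / s)
    refine ⟨P, hle' hc (B := (c / s : ℕ) * ((a / K₁ : ℕ) + (b / m : ℕ))) ?_ (by positivity) ?_, hP⟩
    · push_cast
      nlinarith [mul_le_mul_of_nonneg_left hA (Nat.cast_nonneg (α := ℝ) (c / s)),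
        mul_le_mul_of_nonneg_left hB (Nat.cast_nonneg (α := ℝ) (c / s))]
    · rw [eA, eB, eC]
      field_simp
  · obtain ⟨P, hc, hP⟩ := exists_program_encU F b c K₁ m s X N hK hs
    refine ⟨P, hle' hc (B := (m * s + X) * (N * ((b / m : ℕ) * (c / s : ℕ)))) ?_ (by positivity)
      ?_, hP⟩
    · push_cast
      have : (0 : ℝ) ≤ (m * s + X) * (N * ((b / m : ℕ) * (c / s : ℕ))) := by positivity
      linarith
    · rw [eB, eC]
      field_simp
  · obtain ⟨P, hc, hP⟩ := exists_program_encV F a c K₁ m s X N hm hs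
    refine ⟨P, hle' hc (B := (K₁ * s + X) * (N * ((a / K₁ : ℕ) * (c / s : ℕ)))) ?_ (by positivity)
      ?_, hP⟩
    · push_cast
      have : (0 : ℝ) ≤ (K₁ * s + X) * (N * ((a / K₁ : ℕ) * (c / s : ℕ))) := by positivity
      linarith
    · rw [eA, eC]
      field_simp
  · intro hn
    obtain ⟨k, hk, ht⟩ := hI _ hn
    have hdec : ∀ {P q : ℕ} {E : ℝ}, P ≤ q * interpTime k → E = q →
        (P : ℝ) ≤ (C + 4) * (E * threshold K₁ m s X * Real.log (threshold K₁ m s X) ^ 2 *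
          Real.log (Real.log (threshold K₁ m s X))) := by
      rintro P q _ h rfl
      set L : ℝ := threshold K₁ m s X * Real.log (threshold K₁ m s X) ^ 2 *
        Real.log (Real.log (threshold K₁ m s X))
      -- No analysis is needed for the sign: `C * L` bounds the natural number `interpTime k` from
      -- above.
      have hL : 0 ≤ L := by
        by_contra hneg
        have : (0 : ℝ) ≤ interpTime k := Nat.cast_nonneg _
        nlinarith
      calc (P : ℝ) ≤ q * interpTime k := by exact_mod_cast h
        _ ≤ q * (C * L) := by gcongr
        _ ≤ q * ((C + 4) * L) := by gcongr; linarith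
        _ = _ := by ring
    constructor
    · obtain ⟨P, hc, hP⟩ := exists_program_decodeI F X N hm hK hs hKa hmb hsc (by omega) hk
      refine ⟨P, hdec hc ?_, hP⟩
      push_cast
      rw [eA, eC]
      field_simp
    · obtain ⟨P, hc, hP⟩ := exists_program_decodeII F X N hm hK hs hKa hmb hsc (by omega) hk
      refine ⟨P, hdec hc ?_, hP⟩
      push_cast
      rw [eB, eC]
      field_simp
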